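/- **Tableaux.** Let $\gamma=(\gamma_1>\dots>\gamma_\ell>0)$ be a strict partition and $r\ge 0$ an integer with $\ell\le r+1$. The shifted diagram of $\gamma$ (French notation, rows counted from the bottom) consists of the cells in row $k$ and columns $k,k+1,\dots,k+\gamma_k-1$, for $1\le k\le\ell$. $\mathrm{SSHT}_{r+1}(\gamma)$ is the set of its fillings $T$ with entries from $\bar 1<1<\bar 2<2<\cdots<\overline{r+1}<r+1$ that weakly increase along rows (left to right) and columns (upwards), with at most one $\bar v$ in each row and at most one $v$ in each column for every $v$, and no marked entry on the main diagonal. The weight $\mathrm{wt}(T)\in\mathbb Z^{r+1}$ has $j$-th part the number of entries $\bar j$ and $j$ of $T$. The $v$-ribbon containing a cell with entry $\bar v$ or $v$ is the connected component of that cell among the cells with entries $\bar v,v$; it runs from northwest to southeast. **Reading word.** The hook reading word $w(T)=w_1\cdots w_k$ reads, for $j$ from $\max(\gamma_1,\ell)$ down to $1$, the marked entries of column $j$ upwards and then the unmarked entries of row $j$ from left to right. With markings disregarded, let $m_i(w,p)$ be the number of $i$ minus the number of $i+1$ among $w_1,\dots,w_p$ (so $m_i(w,0)=0$), and $m_i(w)=\max_{0\le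 p\le k}m_i(w,p)$. Entries of value $i$ or $i+1$ are $i$-paired by bracketing: $w_a$ and $w_b$ with $a<b$ are $i$-paired if $w_a$ has value $i+1$, $w_b$ has value $i$, and each letter of value $i$ or $i+1$ strictly between them is $i$-paired with a letter strictly between them. Entries of value $i$ or $i+1$ that are in no $i$-pair are $i$-free. **Lowering operators.** For $1\le i\le r$, set $\bar f_i(T)=0$ if $m_i(w(T))=0$. Otherwise let $p$ be the smallest index with $m_i(w(T),p)=m_i(w(T))$, $x$ the entry of $T$ read as $w_p$, and $y$, $z$ the entries directly north and east of $x$; apply the first rule that fits. - If $x=i$: (a) if $z=\overline{i+1}$, change $x$ to $\overline{i+1}$ and $z$ to $i+1$; (b) if $y$ does not exist or $y>i+1$, change $x$ to $i+1$; (c) if the northwestern-most cell of the $(i+1)$-ribbon containing $y$ is marked, remove that marking and change $x$ to $\overline{i+1}$; (d) change $x$ to $\overline{i+1}$. - If $x=\bar i$: (a) if $y=i$, change $x$ to $i$ and $y$ to $\overline{i+1}$; (b) if $z$ does not exist or $z>\overline{i+1}$, change $x$ to $\overline{i+1}$; (c) change $x$ to $i$, and change to $\overline{i+1}$ the first entry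 $i$, going southeast from $x$ along the $i$-ribbon containing $x$, whose east neighbour is neither $i$ nor $\overline{i+1}$. **Raising operators.** For $1\le i\le r$, set $\bar e_i(T)=0$ if $m_i(w(T),k)=m_i(w(T))$. Otherwise let $q$ be the largest index with $m_i(w(T),q)=m_i(w(T))$, $x$ the entry of $T$ read as $w_{q+1}$, and $y$, $z$ the entries directly south and west of $x$; apply the first rule that fits. - If $x=i+1$: (a) if $z=\overline{i+1}$, change $x$ to $\overline{i+1}$ and $z$ to $i$; (b) if $y$ does not exist or $y<i$, change $x$ to $i$; (c) change $x$ to $\overline{i+1}$, and change to $i$ the first entry $\overline{i+1}$, going southeast from $x$ along the $(i+1)$-ribbon containing $x$, whose south neighbour is neither $i$ nor $\overline{i+1}$. - If $x=\overline{i+1}$: (a) if $y=i$, change $x$ to $i$ and $y$ to $\bar i$; (b) if $z$ does not exist or $z<\bar i$, change $x$ to $\bar i$; (c) if the northwestern-most cell of the $i$-ribbon containing $z$ is not on the main diagonal, add a marking to that cell and change $x$ to $i$; (d) change $x$ to $i$. **Theorem.** The operators $\bar e_i,\bar f_i$ ($1\le i\le r$) are well-defined maps $\mathrm{SSHT}_{r+1}(\gamma)\to\mathrm{SSHT}_{r+1}(\gamma)\cup\{0\}$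 and, together with $\mathrm{wt}$, define a crystal of dimension $r+1$ on $\mathrm{SSHT}_{r+1}(\gamma)$. That is, $\mathrm{SSHT}_{r+1}(\gamma)$ is nonempty, and for all $T,T'$ in it and $1\le i\le r$: 1. $\bar e_i(T)=T'$ if and only if $\bar f_i(T')=T$, and in this case $\mathrm{wt}(T')=\mathrm{wt}(T)+\mathbf e_i-\mathbf e_{i+1}$, where $\mathbf e_1,\dots,\mathbf e_{r+1}$ is the standard basis of $\mathbb Z^{r+1}$; 2. the maxima $\varepsilon_i(T)=\max\{k\ge0:\bar e_i^{\,k}(T)\ne0\}$ and $\varphi_i(T)=\max\{k\ge0:\bar f_i^{\,k}(T)\ne0\}$ exist, and $\varphi_i(T)-\varepsilon_i(T)=\mathrm{wt}(T)_i-\mathrm{wt}(T)_{i+1}$. Moreover, $\varepsilon_i(T)$ is the number of $i$-free entries $\overline{i+1},i+1$ of $T$, and $\varphi_i(T)$ is the number of $i$-free entries $\bar i,i$ of $T$. -/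

import Mathlib

/-! ## Crystals of dimension `r + 1` (type A) -/

/-- The `k`-th power of a partial map `g : B → B ∪ {0}`, applied to `b`; `none` plays the role
of `0`, which is sent to `0`. -/
def partialPow {B : Type*} (g : B → Option B) (k : ℕ) (b : B) : Option B :=
  (fun o : Option B => o.bind g)^[k] (some b)

/-- `n = max {k ≥ 0 | g ^ k (b) ≠ 0}` (in particular the maximum exists). -/
def IsStringLength {B : Type*} (g : B → Option B) (b : B) (n : ℕ) : Prop :=
  IsGreatest {k : ℕ | partialPow g k b ≠ none} n

/-- The simple root `α_i = e_i - e_{i+1}` in `ℤ ^ (r + 1)`. -/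
def simpleRoot {r : ℕ} (i : Fin r) : Fin (r + 1) → ℤ :=
  Pi.single i.castSucc 1 - Pi.single i.succ 1

/-- `e`, `f` and `wt` make `B` a crystal of dimension `r + 1`. -/
structure IsCrystal {r : ℕ} {B : Type*} (e f : Fin r → B → Option B)
    (wt : B → Fin (r + 1) → ℤ) : Prop where
  nonempty : Nonempty B
  inverse : ∀ (i : Fin r) (b b' : B), e i b = some b' ↔ f i b' = some b
  weight : ∀ (i : Fin r) (b b' : B), e i b = some b' → wt b' = wt b + simpleRoot i
  string : ∀ (i : Fin r) (b : B), ∃ ε φ : ℕ,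
    IsStringLength (e i) b ε ∧ IsStringLength (f i) b φ ∧
      (φ : ℤ) = (wt b i.castSucc - wt b i.succ) + (ε : ℤ)

namespace Shifted

/-! ## Shifted diagrams and semistandard shifted tableaux

Cells are pairs `(row, column)`, both counted from `1`, rows from the bottom to the top
(French notation); row `k` of a shifted diagram starts on the main diagonal, at column `k`. -/

/-- A strict partition `γ₁ > γ₂ > ⋯ > γ_ℓ > 0`. -/
structure StrictPartition where
  parts : List ℕ
  sorted : parts.Pairwise (fun a b => b < a)
  pos : ∀ a ∈ parts, 0 < a

namespace StrictPartition

/-- The number of parts `ℓ(γ)`. -/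
def length (γ : StrictPartition) : ℕ := γ.parts.length

/-- The part `γ_k` for `k ≥ 1`, and `0` for `k > ℓ(γ)`. -/
def part (γ : StrictPartition) (k : ℕ) : ℕ := γ.parts.getD (k - 1) 0

/-- The shifted Young diagram of `γ`. -/
def cells (γ : StrictPartition) : Finset (ℕ × ℕ) :=
  (Finset.Icc 1 γ.length).biUnion fun k =>
    (Finset.Ico k (k + γ.part k)).image fun c => (k, c)

end StrictPartition

/-- Marked and unmarked numbers with the order `1' < 1 < 2' < 2 < ⋯`: the pair `(v, false)` is
the marked `v'`, the pair `(v, true)` is the unmarked `v`. -/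
abbrev Entry : Type := ℕ ×ₗ Bool

/-- The marked entry `v'`. -/
def mk (v : ℕ) : Entry := toLex (v, false)

/-- The unmarked entry `v`. -/
def un (v : ℕ) : Entry := toLex (v, true)

/-- The number underlying an entry, its marking being disregarded. -/
def Entry.val (a : Entry) : ℕ := (ofLex a).1

/-- Whether an entry is marked. -/
def Entry.marked (a : Entry) : Bool := !(ofLex a).2

/-- A partial filling of the plane; `none` where there is no cell. -/
abbrev Filling : Type := ℕ × ℕ → Option Entry

/-- `T` is a semistandard shifted tableau of shape `γ` with entries in `{1', 1, …, n', n}`. -/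
structure IsSemistandard (n : ℕ) (γ : StrictPartition) (T : Filling) : Prop where
  shape : ∀ c, (T c).isSome ↔ c ∈ γ.cells
  range : ∀ c, ∀ a ∈ T c, 1 ≤ a.val ∧ a.val ≤ n
  row_weak : ∀ k c c', c < c' → ∀ a ∈ T (k, c), ∀ b ∈ T (k, c'), a ≤ b
  col_weak : ∀ k k' c, k < k' → ∀ a ∈ T (k, c), ∀ b ∈ T (k', c), a ≤ b
  row_marked : ∀ k c c' v, T (k, c) = some (mk v) → T (k, c') = some (mk v) → c = c'
  col_unmarked : ∀ k k' c v, T (k, c) = some (un v) → T (k', c) = some (un v) → k = k'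
  diag : ∀ k v, T (k, k) ≠ some (mk v)

/-- The set `SSHT_n(γ)`. -/
def SSHT (n : ℕ) (γ : StrictPartition) : Type := {T : Filling // IsSemistandard n γ T}

/-- The weight: its part number `j` is the number of entries `j'` and `j` (here `j : Fin n` stands
for the number `j + 1`). -/
def SSHT.wt {n : ℕ} {γ : StrictPartition} (T : SSHT n γ) (j : Fin n) : ℤ :=
  ((γ.cells.filter fun c => (T.1 c).map Entry.val = some ((j : ℕ) + 1)).card : ℤ)

/-! ## The hook reading word -/

/-- The hook reading word of `T`, as the list of the cells in the order in which they are read: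
for `j` from `max (γ₁, ℓ(γ))` down to `1`, first the marked entries of column `j` from the bottom
to the top, then the unmarked entries of row `j` from left to right. -/
def hookCells (γ : StrictPartition) (T : Filling) : List (ℕ × ℕ) :=
  let line := List.range' 1 (max (γ.part 1) γ.length)
  line.reverse.flatMap fun j =>
    (line.map fun k => (k, j)).filter (fun x => (T x).any fun a => a.marked) ++
    (line.map fun c => (j, c)).filter (fun x => (T x).any fun a => !a.marked)

/-- The hook reading word `w(T)`, with the markings disregarded. -/
def hookWord (γ : StrictPartition) (T : Filling) : List ℕ :=
  (hookCells γ T).filterMap fun x => (T x).map Entry.val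

/-- `m_i(w, p)`: the number of `i` minus the number of `i + 1` among the first `p` letters. -/
def prefixDiff (i : ℕ) (w : List ℕ) (p : ℕ) : ℤ :=
  ((w.take p).count i : ℤ) - ((w.take p).count (i + 1) : ℤ)

/-- `m_i(w)`: the maximum of `0` and of all `m_i(w, p)`; the value `0` is the one at `p = 0`. -/
def maxDiff (i : ℕ) (w : List ℕ) : ℤ :=
  (Finset.range (w.length + 1)).sup' ⟨0, by simp⟩ (prefixDiff i w)

/-- The smallest index `p` with `m_i(w, p) = m_i(w)`. -/
def firstMax (i : ℕ) (w : List ℕ) : Option ℕ :=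
  (List.range (w.length + 1)).find? fun p => prefixDiff i w p = maxDiff i w

/-- The largest index `q` with `m_i(w, q) = m_i(w)`. -/
def lastMax (i : ℕ) (w : List ℕ) : Option ℕ :=
  (List.range (w.length + 1)).reverse.find? fun q => prefixDiff i w q = maxDiff i w

/-- Positions `a < b` of `w` (counted from `0`) are `i`-paired: `w_a = i + 1`, `w_b = i`, and every
letter `i` or `i + 1` strictly between them is `i`-paired with a letter (at position `g c`) that
also lies strictly between them. -/
inductive IsPaired (i : ℕ) (w : List ℕ) : ℕ → ℕ → Prop
  | intro (a b : ℕ) (hab : a < b) (ha : w[a]? = some (i + 1)) (hb : w[b]? = some i) (g : ℕ → ℕ)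
      (hg : ∀ c, a < c → c < b → w[c]? = some i ∨ w[c]? = some (i + 1) → a < g c ∧ g c < b)
      (hup : ∀ c, a < c → c < b → w[c]? = some (i + 1) → IsPaired i w c (g c))
      (hlow : ∀ c, a < c → c < b → w[c]? = some i → IsPaired i w (g c) c) :
      IsPaired i w a b

/-- The number of `i`-free letters of `w` equal to `v` (for `v = i` or `v = i + 1`), that is, of
those that are not part of an `i`-pair. -/
noncomputable def numFree (i : ℕ) (w : List ℕ) (v : ℕ) : ℕ :=
  {a : ℕ | w[a]? = some v ∧ ∀ b, ¬ IsPaired i w a b ∧ ¬ IsPaired i w b a}.ncard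

/-! ## Neighbours and ribbons -/

def north (x : ℕ × ℕ) : ℕ × ℕ := (x.1 + 1, x.2)
def east (x : ℕ × ℕ) : ℕ × ℕ := (x.1, x.2 + 1)
def south (x : ℕ × ℕ) : ℕ × ℕ := (x.1 - 1, x.2)
def west (x : ℕ × ℕ) : ℕ × ℕ := (x.1, x.2 - 1)

/-- The cell `x` carries an entry `k'` or `k`. -/
def HasVal (T : Filling) (k : ℕ) (x : ℕ × ℕ) : Prop := (T x).map Entry.val = some k

instance (T : Filling) (k : ℕ) (x : ℕ × ℕ) : Decidable (HasVal T k x) :=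
  inferInstanceAs (Decidable (_ = _))

/-- One step along the `k`-ribbon (the cells with entries `k'`, `k`) towards the northwest; at the
end of the ribbon, stay. -/
def stepNW (T : Filling) (k : ℕ) (x : ℕ × ℕ) : ℕ × ℕ :=
  if HasVal T k (north x) then north x else if HasVal T k (west x) then west x else x

/-- One step along the `k`-ribbon towards the southeast; at the end of the ribbon, stay. -/
def stepSE (T : Filling) (k : ℕ) (x : ℕ × ℕ) : ℕ × ℕ :=
  if HasVal T k (east x) then east x else if HasVal T k (south x) then south x else x

/-- The northwestern-most cell of the `k`-ribbon containing `x`. There are fewer steps to the end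
than cells in the diagram. -/
def ribbonHead (γ : StrictPartition) (T : Filling) (k : ℕ) (x : ℕ × ℕ) : ℕ × ℕ :=
  (stepNW T k)^[γ.cells.card] x

/-- The cells of the `k`-ribbon containing `x` from `x` on towards the southeast (the last one is
repeated). -/
def ribbonFrom (γ : StrictPartition) (T : Filling) (k : ℕ) (x : ℕ × ℕ) : List (ℕ × ℕ) :=
  List.iterate (stepSE T k) x γ.cells.card

/-- Replace the entry of the cell `x` by `a`. -/
def setEntry (T : Filling) (x : ℕ × ℕ) (a : Entry) : Filling := Function.update T x (some a)

/-! ## The shifted lowering and raising operators -/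

/-- The four lowering rules for a cell `x` with the entry `i`; the first that fits is applied. -/
def lowerUnmarked (γ : StrictPartition) (i : ℕ) (T : Filling) (x : ℕ × ℕ) : Filling :=
  if T (east x) = some (mk (i + 1)) then
    setEntry (setEntry T x (mk (i + 1))) (east x) (un (i + 1))
  else if ∀ y ∈ T (north x), un (i + 1) < y then
    setEntry T x (un (i + 1))
  else
    let u := ribbonHead γ T (i + 1) (north x)
    if T u = some (mk (i + 1)) then
      setEntry (setEntry T x (mk (i + 1))) u (un (i + 1))
    else
      setEntry T x (mk (i + 1))

/-- The three lowering rules for a cell `x` with the entry `i'`; the first that fits is applied. The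
result is `none` only if the cell `u` that the last rule asks for does not exist. -/
def lowerMarked (γ : StrictPartition) (i : ℕ) (T : Filling) (x : ℕ × ℕ) : Option Filling :=
  if T (north x) = some (un i) then
    some (setEntry (setEntry T x (un i)) (north x) (mk (i + 1)))
  else if ∀ z ∈ T (east x), mk (i + 1) < z then
    some (setEntry T x (mk (i + 1)))
  else
    ((ribbonFrom γ T i x).find? fun u => T u = some (un i) ∧
        T (east u) ≠ some (un i) ∧ T (east u) ≠ some (mk (i + 1))).map fun u =>
      setEntry (setEntry T x (un i)) u (mk (i + 1))

/-- The shifted lowering operator on fillings; `none` is `0`. -/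
def lower (γ : StrictPartition) (i : ℕ) (T : Filling) : Option Filling :=
  let w := hookWord γ T
  if maxDiff i w ≤ 0 then none
  else
    (firstMax i w).bind fun p => ((hookCells γ T)[p - 1]?).bind fun x =>
      if T x = some (un i) then some (lowerUnmarked γ i T x)
      else if T x = some (mk i) then lowerMarked γ i T x
      else none

/-- The three raising rules for a cell `x` with the entry `i + 1`; the first that fits is applied.
The result is `none` only if the cell `u` that the last rule asks for does not exist. -/
def raiseUnmarked (γ : StrictPartition) (i : ℕ) (T : Filling) (x : ℕ × ℕ) : Option Filling :=
  if T (west x) = some (mk (i + 1)) then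
    some (setEntry (setEntry T x (mk (i + 1))) (west x) (un i))
  else if ∀ y ∈ T (south x), y < un i then
    some (setEntry T x (un i))
  else
    ((ribbonFrom γ T (i + 1) x).find? fun u => T u = some (mk (i + 1)) ∧
        T (south u) ≠ some (un i) ∧ T (south u) ≠ some (mk (i + 1))).map fun u =>
      setEntry (setEntry T x (mk (i + 1))) u (un i)

/-- The four raising rules for a cell `x` with the entry `(i + 1)'`; the first that fits is
applied. -/
def raiseMarked (γ : StrictPartition) (i : ℕ) (T : Filling) (x : ℕ × ℕ) : Filling :=
  if T (south x) = some (un i) then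
    setEntry (setEntry T x (un i)) (south x) (mk i)
  else if ∀ z ∈ T (west x), z < mk i then
    setEntry T x (mk i)
  else
    let u := ribbonHead γ T i (west x)
    if u.1 ≠ u.2 then
      setEntry (setEntry T x (un i)) u (mk i)
    else
      setEntry T x (un i)

/-- The shifted raising operator on fillings; `none` is `0`. It acts on the letter that follows the
last maximum. -/
def raise (γ : StrictPartition) (i : ℕ) (T : Filling) : Option Filling :=
  let w := hookWord γ T
  if prefixDiff i w w.length = maxDiff i w then none
  else
    (lastMax i w).bind fun q => ((hookCells γ T)[q]?).bind fun x =>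
      if T x = some (un (i + 1)) then raiseUnmarked γ i T x
      else if T x = some (mk (i + 1)) then some (raiseMarked γ i T x)
      else none

end Shifted

/-! Fix `i` and keep of a tableau only the entries i', i, (i+1)', i+1, coded 1, 2, 3, 4, with 0 for
smaller entries and 5 for larger entries and missing cells. This gives a function on the half plane
`k ≤ l`, and the combinatorics takes place there. Below, "ones" are the cells with value 1 or 2,
"twos" those with value 3 or 4.

The reading word is replaced by geometry: a cell has a lexicographic position (negated hook, place
on the hook), and the prefix differences of the word are the sums of signs, +1 for a one and -1 for
a two, over the cells read before a position. Changing one or two cells changes these sums by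
explicit indicator functions.

The core is `FirstMax.exists_isLowering`. If the maximum m of the sums is first reached by reading
x, then the fitting lowering rule gives a valid filling with maximum m - 1, last attained before an
explicit cell x', and the raising rule at x' restores the original filling. This is checked rule by
rule. The information beyond the neighbours of x comes from one principle: an injection between the
ones and the twos read in an interval compares the sums at its two ends.

Along the walk southeast from x (`PathInv`), every row passed contains a 3, and every 4 in these
rows has a 2 diagonally southwest of it. Hence a walk that never stops, or an unsuitable neighbour
of x, would contradict the choice of x, and the sum before the stopping cell read as a marked one is
exactly m - 1. Along the walk northwest from the cell above x (`HeadInv`), the comparison of sums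
turns out to be an equality, so that the injection is onto. Its surjectivity produces the ones that
force the raising operator to walk back along the same ribbon.

Raising is reduced to lowering by duality: reflection in the antidiagonal together with g ↦ 5 - g
reverses the reading word and exchanges the two sets of rules. It also exchanges marked with
unmarked entries, so "no marks on the diagonal" cannot be a condition on half-plane fillings.
Instead, `Similar` records that the marking of a diagonal cell never changes, and the last two rules
for a ribbon head are separated by whether the head lies on the diagonal.

Back on tableaux, a lowering together with its inverse raising is one relation `IsStep`, so the
operators are mutually inverse. A step lowers the maximum by 1 and the total sum by 2. In terms of
bracketing, the free i are the records of the prefix differences, so they are as many as the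
maximum; the free i+1 number the maximum minus the total. Both counts change by one along the
operators and vanish exactly where these give 0, so they are the string lengths. -/

namespace Shifted

/-! ## Two adjacent letters on the half plane

A tableau seen through the letters `i', i, (i+1)', i+1` only is a function `G` on the cells `(k, l)`
with `k ≤ l`, with the values `1, 2, 3, 4` for these letters, smaller values for smaller letters and
larger values for larger ones and for missing cells. -/

namespace TwoLetter

/-- Weakly increasing rows and columns, with at most one `1` and one `3` in a row and at most one
`2` and one `4` in a column. -/
structure Valid (G : ℤ × ℤ → ℤ) : Prop where
  east_le : ∀ k l, k ≤ l → G (k, l) ≤ G (k, l + 1)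
  east_ne : ∀ k l, k ≤ l → G (k, l) = G (k, l + 1) → G (k, l) ≠ 1 ∧ G (k, l) ≠ 3
  north_le : ∀ k l, k + 1 ≤ l → G (k, l) ≤ G (k + 1, l)
  north_ne : ∀ k l, k + 1 ≤ l → G (k, l) = G (k + 1, l) → G (k, l) ≠ 2 ∧ G (k, l) ≠ 4

namespace Valid

variable {G : ℤ × ℤ → ℤ}

theorem row_le (hG : Valid G) {k l l' : ℤ} (h : k ≤ l) (h' : l ≤ l') : G (k, l) ≤ G (k, l') := by
  obtain ⟨n, rfl⟩ := Int.le.dest h'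
  clear h'
  induction n with
  | zero => simp
  | succ n ih =>
    have := hG.east_le k (l + n) (by omega)
    push_cast
    rw [← add_assoc]
    omega

theorem col_le (hG : Valid G) {k k' l : ℤ} (h : k' ≤ l) (h' : k ≤ k') :
    G (k, l) ≤ G (k', l) := by
  obtain ⟨n, rfl⟩ := Int.le.dest h'
  clear h'
  induction n with
  | zero => simp
  | succ n ih =>
    have := hG.north_le (k + n) l (by push_cast at h; omega)
    have := ih (by push_cast at h; omega)
    push_cast
    rw [← add_assoc]
    omega

theorem mono (hG : Valid G) {k l k' l' : ℤ} (h : k ≤ l) (hk : k ≤ k') (hl : l ≤ l')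
    (h' : k' ≤ l') : G (k, l) ≤ G (k', l') :=
  (hG.row_le h hl).trans (hG.col_le h' hk)

theorem row_ne (hG : Valid G) {k l l' : ℤ} (h : k ≤ l) (h' : l < l')
    (e : G (k, l) = G (k, l')) : G (k, l) ≠ 1 ∧ G (k, l) ≠ 3 := by
  have h1 := hG.east_le k l h
  have h2 := hG.row_le (k := k) (l := l + 1) (l' := l') (by omega) (by omega)
  exact hG.east_ne k l h (by omega)

theorem col_ne (hG : Valid G) {k k' l : ℤ} (h : k' ≤ l) (h' : k < k')
    (e : G (k, l) = G (k', l)) : G (k, l) ≠ 2 ∧ G (k, l) ≠ 4 := by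
  have h1 := hG.north_le k l (by omega)
  have h2 := hG.col_le (k := k + 1) (k' := k') (l := l) h (by omega)
  exact hG.north_ne k l (by omega) (by omega)

/-- A letter never occurs twice on a diagonal. -/
theorem diag_one (hG : Valid G) {k l k' l' : ℤ} (h : k ≤ l) (h' : k' ≤ l') (hk : k < k')
    (hl : l < l') (h1 : 1 ≤ G (k, l)) : 3 ≤ G (k', l') := by
  have a := hG.row_le h hl.le
  have b := hG.row_ne h hl
  have c := hG.col_le h' hk.le
  have d := hG.col_ne h' hk
  omega

theorem diag_two (hG : Valid G) {k l k' l' : ℤ} (h : k ≤ l) (h' : k' ≤ l') (hk : k < k')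
    (hl : l < l') (h1 : 3 ≤ G (k, l)) : 5 ≤ G (k', l') := by
  have a := hG.row_le h hl.le
  have b := hG.row_ne h hl
  have c := hG.col_le h' hk.le
  have d := hG.col_ne h' hk
  omega

end Valid

/-! ### Reading order and partial sums -/

/-- The lexicographic order on reading positions. -/
def Before (h d h' d' : ℤ) : Prop := h < h' ∨ h = h' ∧ d < d'

instance (h d h' d' : ℤ) : Decidable (Before h d h' d') := by unfold Before; infer_instance

/-- The hook on which an entry `g` in the cell `v` is read, negated. -/
def hookOf (g : ℤ) (v : ℤ × ℤ) : ℤ := if g = 1 ∨ g = 3 then -v.2 else -v.1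

/-- The place on its hook at which an entry `g` in the cell `v` is read. -/
def placeOf (g : ℤ) (v : ℤ × ℤ) : ℤ := if g = 1 ∨ g = 3 then v.1 - v.2 else v.2 - v.1

/-- The sign with which an entry is counted. -/
def sgn (g : ℤ) : ℤ := if g = 1 ∨ g = 2 then 1 else if g = 3 ∨ g = 4 then -1 else 0

/-- The contribution of an entry `g` in the cell `v` to the partial sum before `(h, d)`. -/
def contrib (g : ℤ) (v : ℤ × ℤ) (h d : ℤ) : ℤ :=
  if Before (hookOf g v) (placeOf g v) h d then sgn g else 0

/-- The partial sum of the signs of the entries read before the position `(h, d)`. -/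
def partialSum (C : Finset (ℤ × ℤ)) (G : ℤ × ℤ → ℤ) (h d : ℤ) : ℤ :=
  ∑ v ∈ C, contrib (G v) v h d

/-- The finite set `C` of cells contains all cells with entries `1, 2, 3, 4`. -/
structure Supported (C : Finset (ℤ × ℤ)) (G : ℤ × ℤ → ℤ) : Prop where
  le : ∀ v ∈ C, v.1 ≤ v.2
  mem : ∀ v : ℤ × ℤ, v.1 ≤ v.2 → 1 ≤ G v → G v ≤ 4 → v ∈ C

/-- The cell `v` is read at or after `(h, d)` and before `(h', d')`. -/
def Within (G : ℤ × ℤ → ℤ) (h d h' d' : ℤ) (v : ℤ × ℤ) : Prop :=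
  ¬ Before (hookOf (G v) v) (placeOf (G v) v) h d ∧ Before (hookOf (G v) v) (placeOf (G v) v) h' d'

instance (G : ℤ × ℤ → ℤ) (h d h' d' : ℤ) (v : ℤ × ℤ) : Decidable (Within G h d h' d' v) := by
  unfold Within; infer_instance

variable {C : Finset (ℤ × ℤ)} {G : ℤ × ℤ → ℤ}

theorem partialSum_update {x : ℤ × ℤ} (hx : x ∈ C) (g h d : ℤ) :
    partialSum C (Function.update G x g) h d
      = partialSum C G h d - contrib (G x) x h d + contrib g x h d := by
  unfold partialSum
  rw [← Finset.add_sum_erase C _ hx, ← Finset.add_sum_erase C (fun v => contrib (G v) v h d) hx]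
  have : ∑ v ∈ C.erase x, contrib (Function.update G x g v) v h d
      = ∑ v ∈ C.erase x, contrib (G v) v h d := by
    refine Finset.sum_congr rfl fun v hv => ?_
    rw [Function.update_of_ne (Finset.ne_of_mem_erase hv)]
  rw [this, Function.update_self]
  ring

/-- The letters `1', 1` read in an interval. -/
def onesIn (C : Finset (ℤ × ℤ)) (G : ℤ × ℤ → ℤ) (h d h' d' : ℤ) : Finset (ℤ × ℤ) :=
  C.filter fun v => (G v = 1 ∨ G v = 2) ∧ Within G h d h' d' v

/-- The letters `2', 2` read in an interval. -/
def twosIn (C : Finset (ℤ × ℤ)) (G : ℤ × ℤ → ℤ) (h d h' d' : ℤ) : Finset (ℤ × ℤ) :=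
  C.filter fun v => (G v = 3 ∨ G v = 4) ∧ Within G h d h' d' v

theorem partialSum_eq_add {h d h' d' : ℤ} (hle : ¬ Before h' d' h d) :
    partialSum C G h' d' = partialSum C G h d + (onesIn C G h d h' d').card
      - (twosIn C G h d h' d').card := by
  unfold partialSum onesIn twosIn
  rw [Finset.card_filter, Finset.card_filter]
  push_cast
  rw [← Finset.sum_add_distrib, ← Finset.sum_sub_distrib]
  refine Finset.sum_congr rfl fun v _ => ?_
  unfold contrib Within sgn
  have hAB : Before (hookOf (G v) v) (placeOf (G v) v) h d →
      Before (hookOf (G v) v) (placeOf (G v) v) h' d' := by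
    unfold Before at *
    omega
  by_cases h1 : Before (hookOf (G v) v) (placeOf (G v) v) h d
  · simp [h1, hAB h1]
  · by_cases h2 : Before (hookOf (G v) v) (placeOf (G v) v) h' d'
    · simp only [h1, h2, if_true, if_false, not_false_eq_true, and_true]
      split_ifs <;> omega
    · simp [h1, h2]

/-- If every one in the interval has its own two in the same interval, the sum cannot increase
across it. All comparisons of sums at distant positions are instances of this or of its two strict
versions. -/
theorem partialSum_le_of_injOn {h d h' d' : ℤ} (hs : Supported C G) (hle : ¬ Before h' d' h d)
    (f : ℤ × ℤ → ℤ × ℤ)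
    (hf : ∀ v ∈ C, G v = 1 ∨ G v = 2 → Within G h d h' d' v →
      (f v).1 ≤ (f v).2 ∧ (G (f v) = 3 ∨ G (f v) = 4) ∧ Within G h d h' d' (f v))
    (hi : ∀ v ∈ C, G v = 1 ∨ G v = 2 → Within G h d h' d' v → ∀ v' ∈ C, G v' = 1 ∨ G v' = 2 →
      Within G h d h' d' v' → f v = f v' → v = v') :
    partialSum C G h' d' ≤ partialSum C G h d := by
  have : (onesIn C G h d h' d').card ≤ (twosIn C G h d h' d').card := by
    refine Finset.card_le_card_of_injOn f (fun v hv => ?_) (fun v hv v' hv' e => ?_)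
    · simp only [onesIn, Finset.coe_filter, Set.mem_ofPred_eq] at hv
      obtain ⟨h1, h2, h3⟩ := hf v hv.1 hv.2.1 hv.2.2
      simp only [twosIn, Finset.coe_filter, Set.mem_ofPred_eq]
      exact ⟨hs.mem _ h1 (by omega) (by omega), h2, h3⟩
    · simp only [onesIn, Finset.coe_filter, Set.mem_ofPred_eq] at hv hv'
      exact hi v hv.1 hv.2.1 hv.2.2 v' hv'.1 hv'.2.1 hv'.2.2 e
  have := partialSum_eq_add (C := C) (G := G) hle
  omega

/-- The two `e` that is not hit makes the inequality strict. Read contrapositively: if the sums at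
both ends agree, then every two in the interval is hit. -/
theorem partialSum_lt_of_injOn {h d h' d' : ℤ} (hs : Supported C G) (hle : ¬ Before h' d' h d)
    (f : ℤ × ℤ → ℤ × ℤ)
    (hf : ∀ v ∈ C, G v = 1 ∨ G v = 2 → Within G h d h' d' v →
      (f v).1 ≤ (f v).2 ∧ (G (f v) = 3 ∨ G (f v) = 4) ∧ Within G h d h' d' (f v))
    (hi : ∀ v ∈ C, G v = 1 ∨ G v = 2 → Within G h d h' d' v → ∀ v' ∈ C, G v' = 1 ∨ G v' = 2 →
      Within G h d h' d' v' → f v = f v' → v = v')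
    {e : ℤ × ℤ} (he : e.1 ≤ e.2) (he' : G e = 3 ∨ G e = 4) (hw : Within G h d h' d' e)
    (hne : ∀ v ∈ C, G v = 1 ∨ G v = 2 → Within G h d h' d' v → f v ≠ e) :
    partialSum C G h' d' < partialSum C G h d := by
  have hemem : e ∈ twosIn C G h d h' d' := by
    simp only [twosIn, Finset.mem_filter]
    exact ⟨hs.mem _ he (by omega) (by omega), he', hw⟩
  have : (onesIn C G h d h' d').card ≤ ((twosIn C G h d h' d').erase e).card := by
    refine Finset.card_le_card_of_injOn f (fun v hv => ?_) (fun v hv v' hv' e => ?_)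
    · simp only [onesIn, Finset.coe_filter, Set.mem_ofPred_eq] at hv
      obtain ⟨h1, h2, h3⟩ := hf v hv.1 hv.2.1 hv.2.2
      simp only [twosIn, Finset.coe_erase, Finset.coe_filter, Set.mem_sdiff, Set.mem_ofPred_eq,
        Set.mem_singleton_iff]
      exact ⟨⟨hs.mem _ h1 (by omega) (by omega), h2, h3⟩, hne v hv.1 hv.2.1 hv.2.2⟩
    · simp only [onesIn, Finset.coe_filter, Set.mem_ofPred_eq] at hv hv'
      exact hi v hv.1 hv.2.1 hv.2.2 v' hv'.1 hv'.2.1 hv'.2.2 e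
  rw [Finset.card_erase_of_mem hemem] at this
  have h0 := Finset.card_pos.mpr ⟨e, hemem⟩
  have := partialSum_eq_add (C := C) (G := G) hle
  omega

/-- A strict increase from an injection of the letters `2', 2` into the letters `1', 1`. -/
theorem partialSum_gt_of_injOn {h d h' d' : ℤ} (hs : Supported C G) (hle : ¬ Before h' d' h d)
    (f : ℤ × ℤ → ℤ × ℤ)
    (hf : ∀ v ∈ C, G v = 3 ∨ G v = 4 → Within G h d h' d' v →
      (f v).1 ≤ (f v).2 ∧ (G (f v) = 1 ∨ G (f v) = 2) ∧ Within G h d h' d' (f v))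
    (hi : Function.Injective f)
    {e : ℤ × ℤ} (he : e.1 ≤ e.2) (he' : G e = 1 ∨ G e = 2) (hw : Within G h d h' d' e)
    (hne : ∀ v ∈ C, G v = 3 ∨ G v = 4 → Within G h d h' d' v → f v ≠ e) :
    partialSum C G h d < partialSum C G h' d' := by
  have hemem : e ∈ onesIn C G h d h' d' := by
    simp only [onesIn, Finset.mem_filter]
    exact ⟨hs.mem _ he (by omega) (by omega), he', hw⟩
  have : (twosIn C G h d h' d').card ≤ ((onesIn C G h d h' d').erase e).card := by
    refine Finset.card_le_card_of_injOn f (fun v hv => ?_) (hi.injOn)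
    simp only [twosIn, Finset.coe_filter, Set.mem_ofPred_eq] at hv
    obtain ⟨h1, h2, h3⟩ := hf v hv.1 hv.2.1 hv.2.2
    simp only [onesIn, Finset.coe_erase, Finset.coe_filter, Set.mem_sdiff, Set.mem_ofPred_eq,
      Set.mem_singleton_iff]
    exact ⟨⟨hs.mem _ h1 (by omega) (by omega), h2, h3⟩, hne v hv.1 hv.2.1 hv.2.2⟩
  rw [Finset.card_erase_of_mem hemem] at this
  have h0 := Finset.card_pos.mpr ⟨e, hemem⟩
  have := partialSum_eq_add (C := C) (G := G) hle
  omega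

/-! ### Positions of marked and of unmarked entries -/

theorem hookOf_marked {g : ℤ} (hg : g = 1 ∨ g = 3) (v : ℤ × ℤ) : hookOf g v = -v.2 := by
  simp [hookOf, hg]

theorem placeOf_marked {g : ℤ} (hg : g = 1 ∨ g = 3) (v : ℤ × ℤ) : placeOf g v = v.1 - v.2 := by
  simp [placeOf, hg]

theorem hookOf_unmarked {g : ℤ} (hg : g = 2 ∨ g = 4) (v : ℤ × ℤ) : hookOf g v = -v.1 := by
  rcases hg with rfl | rfl <;> simp [hookOf]

theorem placeOf_unmarked {g : ℤ} (hg : g = 2 ∨ g = 4) (v : ℤ × ℤ) :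
    placeOf g v = v.2 - v.1 := by
  rcases hg with rfl | rfl <;> simp [placeOf]

theorem within_marked {v : ℤ × ℤ} (hg : G v = 1 ∨ G v = 3) {h d h' d' : ℤ} :
    Within G h d h' d' v ↔ ¬ (-v.2 < h ∨ -v.2 = h ∧ v.1 - v.2 < d) ∧
      (-v.2 < h' ∨ -v.2 = h' ∧ v.1 - v.2 < d') := by
  unfold Within Before
  rw [hookOf_marked hg, placeOf_marked hg]

theorem within_unmarked {v : ℤ × ℤ} (hg : G v = 2 ∨ G v = 4) {h d h' d' : ℤ} :
    Within G h d h' d' v ↔ ¬ (-v.1 < h ∨ -v.1 = h ∧ v.2 - v.1 < d) ∧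
      (-v.1 < h' ∨ -v.1 = h' ∧ v.2 - v.1 < d') := by
  unfold Within Before
  rw [hookOf_unmarked hg, placeOf_unmarked hg]

/-- Reading one more letter. -/
theorem partialSum_succ (hs : Supported C G) {x : ℤ × ℤ} (hx : x ∈ C) :
    partialSum C G (hookOf (G x) x) (placeOf (G x) x + 1)
      = partialSum C G (hookOf (G x) x) (placeOf (G x) x) + sgn (G x) := by
  unfold partialSum
  rw [← Finset.add_sum_erase C _ hx,
    ← Finset.add_sum_erase C (fun v => contrib (G v) v (hookOf (G x) x) (placeOf (G x) x)) hx]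
  have : ∑ v ∈ C.erase x, contrib (G v) v (hookOf (G x) x) (placeOf (G x) x + 1)
      = ∑ v ∈ C.erase x, contrib (G v) v (hookOf (G x) x) (placeOf (G x) x) := by
    refine Finset.sum_congr rfl fun v hv => ?_
    have hvx := Finset.ne_of_mem_erase hv
    have hv1 := hs.le v (Finset.mem_of_mem_erase hv)
    have hx1 := hs.le x hx
    -- Distinct cells have distinct positions. Marked entries have places at most 0 and unmarked
    -- ones at least 0, so a mixed tie has place 0 and both cells are the same diagonal cell.
    have : ¬ (hookOf (G v) v = hookOf (G x) x ∧ placeOf (G v) v = placeOf (G x) x) := by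
      rintro ⟨e1, e2⟩
      apply hvx
      unfold hookOf at e1
      unfold placeOf at e2
      ext <;> split_ifs at e1 e2 <;> omega
    unfold contrib Before
    split_ifs <;> first | rfl | omega
  rw [this]
  simp only [contrib, Before]
  simp
  ring

end TwoLetter

end Shifted

namespace Shifted

namespace TwoLetter

/-! ### Ribbons -/

/-- One step along the ribbon with the cells `S` towards the northwest. -/
def StepNW (S : ℤ × ℤ → Prop) (v v' : ℤ × ℤ) : Prop :=
  S v' ∧ v'.1 ≤ v'.2 ∧ (v' = (v.1 + 1, v.2) ∨ v' = (v.1, v.2 - 1))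

/-- The cell `u` is the northwestern end of the ribbon through `v`. -/
def IsHead (S : ℤ × ℤ → Prop) (v u : ℤ × ℤ) : Prop :=
  Relation.ReflTransGen (StepNW S) v u ∧ ∀ v', ¬ StepNW S u v'

/-- One step along the ribbon with the cells `S` towards the southeast, from a cell that is not in
`halt`. -/
def StepSE (S halt : ℤ × ℤ → Prop) (v v' : ℤ × ℤ) : Prop :=
  ¬ halt v ∧ S v' ∧ (v' = (v.1, v.2 + 1) ∨ v' = (v.1 - 1, v.2))

def IsOne (G : ℤ × ℤ → ℤ) (v : ℤ × ℤ) : Prop := G v = 1 ∨ G v = 2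

def IsTwo (G : ℤ × ℤ → ℤ) (v : ℤ × ℤ) : Prop := G v = 3 ∨ G v = 4

/-- The cells at which the lowering operator stops on its way southeast. -/
def LowerStop (G : ℤ × ℤ → ℤ) (v : ℤ × ℤ) : Prop :=
  G v = 2 ∧ G (v.1, v.2 + 1) ≠ 2 ∧ G (v.1, v.2 + 1) ≠ 3

/-- The cells at which the raising operator stops on its way southeast. -/
def RaiseStop (G : ℤ × ℤ → ℤ) (v : ℤ × ℤ) : Prop :=
  G v = 3 ∧ G (v.1 - 1, v.2) ≠ 2 ∧ G (v.1 - 1, v.2) ≠ 3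

/-- The partial sums have their maximum `m`, and it is first attained after reading `x`. -/
structure FirstMax (C : Finset (ℤ × ℤ)) (G : ℤ × ℤ → ℤ) (x : ℤ × ℤ) (m : ℤ) : Prop where
  mem : x ∈ C
  one : IsOne G x
  eq : partialSum C G (hookOf (G x) x) (placeOf (G x) x) = m - 1
  before : ∀ h d, ¬ Before (hookOf (G x) x) (placeOf (G x) x) h d → partialSum C G h d ≤ m - 1
  le : ∀ h d, partialSum C G h d ≤ m

/-- The partial sums have their maximum `m`, and it is last attained before reading `x`. -/
structure LastMax (C : Finset (ℤ × ℤ)) (G : ℤ × ℤ → ℤ) (x : ℤ × ℤ) (m : ℤ) : Prop where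
  mem : x ∈ C
  two : IsTwo G x
  eq : partialSum C G (hookOf (G x) x) (placeOf (G x) x) = m
  after : ∀ h d, Before (hookOf (G x) x) (placeOf (G x) x) h d → partialSum C G h d ≤ m - 1
  le : ∀ h d, partialSum C G h d ≤ m

/-- Each step northwest lowers the content l - k by one, and the content stays nonnegative. -/
theorem exists_isHead (S : ℤ × ℤ → Prop) (v : ℤ × ℤ) (hv : v.1 ≤ v.2) : ∃ u, IsHead S v u := by
  obtain ⟨n, hn⟩ := Int.le.dest hv
  induction n generalizing v with
  | zero =>
    refine ⟨v, .refl, ?_⟩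
    rintro v' ⟨-, h, rfl | rfl⟩ <;> simp at hn h <;> omega
  | succ n ih =>
    by_cases h : ∃ v', StepNW S v v'
    · obtain ⟨v', hv'⟩ := h
      obtain ⟨u, hu⟩ := ih v' hv'.2.1 (by
        push_cast at hn
        rcases hv'.2.2 with rfl | rfl <;> simp <;> omega)
      exact ⟨u, hu.1.head hv', hu.2⟩
    · push Not at h
      exact ⟨v, .refl, h⟩

/-- A path to the southeast inside a finite set stops, or ends. -/
theorem exists_stepSE_end {S halt : ℤ × ℤ → Prop} {B : ℤ}
    (hB : ∀ v : ℤ × ℤ, v.1 ≤ v.2 → S v → v.2 - v.1 ≤ B) (v : ℤ × ℤ) (hv : v.1 ≤ v.2) (hS : S v) :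
    ∃ u, Relation.ReflTransGen (StepSE S halt) v u ∧
      (halt u ∨ ∀ v', ¬ StepSE S halt u v' ∧ ¬ halt u) := by
  -- Each step southeast raises the content by one, so its distance to the bound `B` decreases.
  obtain ⟨n, hn⟩ := Int.le.dest (hB v hv hS)
  induction n generalizing v with
  | zero =>
    refine ⟨v, .refl, ?_⟩
    by_cases h : halt v
    · exact .inl h
    · right
      intro v'
      refine ⟨fun hst => ?_, h⟩
      obtain ⟨-, hs, rfl | rfl⟩ := hst
      · have := hB _ (by simp; omega) hs
        simp at this hn
        omega
      · have := hB _ (by simp; omega) hs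
        simp at this hn
        omega
  | succ n ih =>
    by_cases h : halt v
    · exact ⟨v, .refl, .inl h⟩
    by_cases h' : ∃ v', StepSE S halt v v'
    · obtain ⟨v', hv'⟩ := h'
      push_cast at hn
      obtain ⟨u, hu⟩ := ih v' (by rcases hv'.2.2 with rfl | rfl <;> simp <;> omega) hv'.2.1
        (by rcases hv'.2.2 with rfl | rfl <;> simp <;> omega)
      exact ⟨u, hu.1.head hv', hu.2⟩
    · push Not at h'
      exact ⟨v, .refl, .inr fun v' => ⟨h' v', h⟩⟩

variable {C : Finset (ℤ × ℤ)} {G : ℤ × ℤ → ℤ}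

theorem Supported.exists_content_bound (hs : Supported C G) :
    ∃ B : ℤ, ∀ v : ℤ × ℤ, v.1 ≤ v.2 → IsOne G v → v.2 - v.1 ≤ B := by
  obtain ⟨B, hB⟩ := (C.image fun v => v.2 - v.1).exists_le
  refine ⟨B, fun v hv h => hB _ (Finset.mem_image_of_mem _ (hs.mem v hv ?_ ?_))⟩ <;>
  · rcases h with h | h <;> omega

/-! ### The way from the lowered cell to the southeast -/

/-- What holds for the cells `v` on the way southeast from `(j, c)`. -/
structure PathInv (G : ℤ × ℤ → ℤ) (j c : ℤ) (v : ℤ × ℤ) : Prop where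
  row : v.1 ≤ j
  col : c ≤ v.2
  one : IsOne G v
  east : G v = 1 → G (v.1, v.2 + 1) = 2 ∨ G (v.1, v.2 + 1) = 3
  three : ∀ k, v.1 < k → k ≤ j →
    ∃ e, c + 1 ≤ e ∧ (e ≤ v.2 ∨ G v = 1 ∧ e ≤ v.2 + 1) ∧ G (k, e) = 3
  four : ∀ k l, v.1 < k → k ≤ j → k ≤ l → G (k, l) = 4 → G (k - 1, l - 1) = 2

/-- A step east passes no row. Before a step south from (k, l), the cell (k, l + 1) is at least 3,
because a one lies diagonally southwest of it; as the walk did not stop at (k, l), it is exactly 3.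
This is the 3 required in the row just passed. -/
theorem PathInv.step (hG : Valid G) {j c : ℤ} (hjc : j ≤ c) {v v' : ℤ × ℤ} (h : PathInv G j c v)
    (hst : StepSE (IsOne G) (LowerStop G) v v') : PathInv G j c v' := by
  obtain ⟨k, l⟩ := v
  obtain ⟨h1, h2, h3, h4, h5, h6⟩ := h
  obtain ⟨hns, ho, rfl | rfl⟩ := hst
  · unfold LowerStop at hns
    unfold IsOne at *
    simp only at *
    have r1 := hG.east_le k l (by omega)
    have r2 := hG.east_ne k l (by omega)
    refine ⟨h1, by omega, ho, fun h => by omega, fun k' hk' hk'' => ?_, h6⟩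
    obtain ⟨e, e1, e2, e3⟩ := h5 k' hk' hk''
    exact ⟨e, e1, by simp; omega, e3⟩
  · unfold LowerStop at hns
    unfold IsOne at *
    simp only at *
    have a0 : 3 ≤ G (k, l + 1) := hG.diag_one (k := k - 1) (l := l) (by omega) (by omega)
      (by omega) (by omega) (by omega)
    have a1 : G (k, l + 1) = 3 := by omega
    have b1 := hG.col_le (k := k - 1) (k' := k) (l := l) (by omega) (by omega)
    have b2 := hG.col_ne (k := k - 1) (k' := k) (l := l) (by omega) (by omega)
    have a2 : G (k - 1, l) = 1 := by omega
    have r1 := hG.east_le (k - 1) l (by omega)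
    have r2 := hG.east_ne (k - 1) l (by omega)
    have c1 := hG.col_le (k := k - 1) (k' := k) (l := l + 1) (by omega) (by omega)
    refine ⟨by simp; omega, by simp; omega, ho, fun _ => ?_, fun k' hk' hk'' => ?_,
      fun k' l' hk' hk'' hl' e => ?_⟩
    · simp only
      omega
    · simp only at hk'
      rcases eq_or_lt_of_le (show k ≤ k' by omega) with rfl | hlt
      · exact ⟨l + 1, by omega, .inr ⟨a2, by simp⟩, a1⟩
      · obtain ⟨e, e1, e2, e3⟩ := h5 k' hlt hk''
        exact ⟨e, e1, .inr ⟨a2, by simp; omega⟩, e3⟩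
    · simp only at hk'
      rcases eq_or_lt_of_le (show k ≤ k' by omega) with rfl | hlt
      -- The 4 lies to the right of the 3 at (k, l + 1). In row k - 1, the entry in column l' - 1
      -- exceeds the 1 in column l; the entry in column l' lies below a 4, so is at most 3; and two
      -- 3s cannot share a row. Only 2 remains for column l' - 1.
      · have d0 : l + 1 < l' := by
          by_contra hcon
          have := hG.row_le (k := k) (l := l') (l' := l + 1) hl' (by omega)
          omega
        have d1 := hG.row_le (k := k - 1) (l := l) (l' := l' - 1) (by omega) (by omega)
        have d2 := hG.row_ne (k := k - 1) (l := l) (l' := l' - 1) (by omega) (by omega)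
        have d3 := hG.row_le (k := k - 1) (l := l' - 1) (l' := l') (by omega) (by omega)
        have d4 := hG.row_ne (k := k - 1) (l := l' - 1) (l' := l') (by omega) (by omega)
        have d5 := hG.col_le (k := k - 1) (k' := k) (l := l') (by omega) (by omega)
        have d6 := hG.col_ne (k := k - 1) (k' := k) (l := l') (by omega) (by omega)
        omega
      · exact h6 k' l' hlt hk'' hl' e

theorem PathInv.of_path (hG : Valid G) {j c : ℤ} (hjc : j ≤ c) (hx : IsOne G (j, c))
    (hz : G (j, c + 1) = 2 ∨ G (j, c + 1) = 3) {v : ℤ × ℤ}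
    (hp : Relation.ReflTransGen (StepSE (IsOne G) (LowerStop G)) (j, c) v) : PathInv G j c v := by
  induction hp with
  | refl =>
    exact ⟨le_rfl, le_rfl, hx, fun _ => hz, fun k h1 h2 => by simp at h1; omega,
      fun k l h1 h2 => by simp at h1; omega⟩
  | tail _ hst ih => exact ih.step hG hjc hst

/-- The entries `2'` in the rows passed outnumber the entries `1'` in the columns passed. -/
theorem PathInv.partialSum_le (hG : Valid G) (hs : Supported C G) {j c a b : ℤ} (hjc : j ≤ c)
    (hx : IsOne G (j, c)) (h : PathInv G j c (a, b)) (hu : G (a, b) = 2) (hb : c < b) :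
    partialSum C G (-c) (j - c) ≤ partialSum C G (-b) (a - b) := by
  have h1 := h.row
  have h5 : ∀ k, ∃ e, a < k → k ≤ j → c + 1 ≤ e ∧ e ≤ b ∧ G (k, e) = 3 := by
    intro k
    by_cases hk : a < k ∧ k ≤ j
    · obtain ⟨e, e1, e2, e3⟩ := h.three k hk.1 hk.2
      exact ⟨e, fun _ _ => ⟨e1, by simp at e2; omega, e3⟩⟩
    · exact ⟨0, fun p q => absurd ⟨p, q⟩ hk⟩
  choose w hw using h5
  have key : ∀ v ∈ C, G v = 1 ∨ G v = 2 → Within G (-b) (a - b) (-c) (j - c) v →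
      G v = 1 ∧ a ≤ v.1 ∧ v.1 < j ∧ v.1 ≤ v.2 := by
    rintro ⟨k, l⟩ hv hg hin
    have hkl := hs.le _ hv
    simp only at hkl ⊢
    unfold IsOne at hx
    have hno : ¬ (j < k ∧ c < l) := fun hh => by
      have := hG.diag_one (k := j) (l := c) (k' := k) (l' := l) hjc hkl hh.1 hh.2 (by omega)
      omega
    have hno' : ¬ (k < a ∧ l < b) := fun hh => by
      have := hG.diag_one (k := k) (l := l) (k' := a) (l' := b) hkl (by omega) hh.1 hh.2 (by omega)
      omega
    have hno'' : G (k, l) = 1 → k = j → ¬ c < l := fun e hh hcl => by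
      subst hh
      have := hG.row_le (k := k) (l := c) (l' := l) hjc (by omega)
      have := hG.row_ne (k := k) (l := c) (l' := l) hjc (by omega)
      omega
    rcases hg with hg | hg
    · rw [within_marked (.inl hg)] at hin
      simp only at hin
      refine ⟨hg, ?_, ?_, hkl⟩
      · omega
      · by_contra hcon
        have := hno'' hg
        omega
    · rw [within_unmarked (.inl hg)] at hin
      simp only at hin
      omega
  -- The 1 in row k goes to the 3 in row k + 1: the ones occupy rows a to j - 1, whereas the
  -- invariant provides a 3 in rows a + 1 to j. A row holds only one 1, so the row determines the
  -- source.
  refine partialSum_le_of_injOn hs (by unfold Before; omega) (fun v => (v.1 + 1, w (v.1 + 1)))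
    (fun v hv hg hin => ?_) (fun v hv hg hin v' hv' hg' hin' e => ?_)
  · obtain ⟨p1, p2, p3, p4⟩ := key v hv hg hin
    obtain ⟨q1, q2, q3⟩ := hw (v.1 + 1) (by omega) (by omega)
    refine ⟨by simp; omega, .inl q3, ?_⟩
    rw [within_marked (.inr q3)]
    simp only
    omega
  · obtain ⟨p1, p2, p3, p4⟩ := key v hv hg hin
    obtain ⟨p1', p2', p3', p4'⟩ := key v' hv' hg' hin'
    simp only [Prod.mk.injEq, add_left_inj] at e
    obtain ⟨k, l⟩ := v
    obtain ⟨k', l'⟩ := v'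
    simp only at *
    obtain ⟨rfl, -⟩ := e
    rcases lt_trichotomy l l' with hl | rfl | hl
    · exact absurd p1 (hG.row_ne p4 hl (by omega)).1
    · rfl
    · exact absurd p1' (hG.row_ne p4' hl (by omega)).1

/-- The partial sum increases until the stopping cell is read. -/
theorem PathInv.partialSum_lt (hG : Valid G) (hs : Supported C G) {j c a b h d : ℤ} (hjc : j ≤ c)
    (hx : IsOne G (j, c)) (hp : PathInv G j c (a, b)) (hu : LowerStop G (a, b))
    (hκ : Before (-j) (c - j) h d) (hκ' : ¬ Before (-a) (b - a) h d) :
    partialSum C G h d < partialSum C G (-a) (b - a + 1) := by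
  obtain ⟨hu1, hu2, hu3⟩ := hu
  have h1 := hp.row
  have h2 := hp.col
  simp only at h1 h2 hu2 hu3
  unfold IsOne at hx
  unfold Before at hκ hκ'
  have r1 := hG.east_le a b (by omega)
  -- All twos read here are 4s, and each goes to the 2 diagonally southwest of it, which is read one
  -- row later. The stopping cell is not hit: a 4 northeast of it would make its east neighbour 2 or
  -- 3.
  refine partialSum_gt_of_injOn hs (by unfold Before; omega) (fun v => (v.1 - 1, v.2 - 1))
    (fun v hv hg hin => ?_) (fun v v' e => ?_) (e := (a, b)) (by simp; omega) (.inr hu1) ?_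
    (fun v hv hg hin e => ?_)
  · obtain ⟨k, l⟩ := v
    have hkl := hs.le _ hv
    simp only at hkl ⊢
    rcases hg with hg | hg
    · exfalso
      rw [within_marked (.inr hg)] at hin
      simp only at hin
      have := hG.mono (k := k) (l := l) (k' := j) (l' := c) hkl (by omega) (by omega) hjc
      omega
    · rw [within_unmarked (.inr hg)] at hin
      simp only at hin
      have hka : a < k := by
        by_contra hcon
        obtain rfl : k = a := by omega
        have := hG.row_le (k := k) (l := l) (l' := b) hkl (by omega)
        omega
      have e := hp.four k l hka (by omega) hkl hg
      refine ⟨by omega, .inr e, ?_⟩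
      rw [within_unmarked (.inl e)]
      simp only
      have : k - 1 = a → l - 1 ≤ b := fun hk => by
        by_contra hcon
        rw [hk] at e
        have := hG.row_le (k := a) (l := b + 1) (l' := l - 1) (by omega) (by omega)
        omega
      omega
  · simp only [Prod.mk.injEq, sub_left_inj] at e
    exact Prod.ext e.1 e.2
  · rw [within_unmarked (.inl hu1)]
    simp only [true_and]
    omega
  · obtain ⟨k, l⟩ := v
    simp only [Prod.mk.injEq] at e
    obtain ⟨e1, e2⟩ := e
    obtain rfl : k = a + 1 := by omega
    obtain rfl : l = b + 1 := by omega
    have hkl := hs.le _ hv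
    simp only at hkl
    have c1 := hG.north_le a (b + 1) hkl
    have c2 := hG.north_ne a (b + 1) hkl
    rcases hg with hg | hg
    · omega
    · omega

/-- If the way southeast ends without a stopping cell, the partial sum is not maximal. -/
theorem PathInv.partialSum_lt_of_end (hG : Valid G) (hs : Supported C G) {j c k r h d : ℤ}
    (hjc : j ≤ c) (hx : IsOne G (j, c)) (hp : PathInv G j c (k, r))
    (hend : ∀ v', ¬ StepSE (IsOne G) (LowerStop G) (k, r) v' ∧ ¬ LowerStop G (k, r))
    (hκ : Before (-(c + 1)) (j - c - 1) h d) (hκ' : ¬ Before (-c) (j - c) h d) :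
    partialSum C G h d < partialSum C G (-(r + 1)) (k - r - 1) := by
  have h1 := hp.row
  have h2 := hp.col
  have h3 := hp.one
  have h4 := hp.east
  have hE := (hend (k, r + 1)).1
  have hS := (hend (k - 1, r)).1
  have hns := (hend (k, r)).2
  have hE' : ¬ IsOne G (k, r + 1) := fun hh => hE ⟨hns, hh, .inl rfl⟩
  have hS' : ¬ IsOne G (k - 1, r) := fun hh => hS ⟨hns, hh, .inr rfl⟩
  unfold IsOne at *
  unfold LowerStop at hns
  simp only at *
  have hz : G (k, r + 1) = 3 := by omega
  have h5 : ∀ k', ∃ e, k ≤ k' → k' ≤ j → c + 1 ≤ e ∧ e ≤ r + 1 ∧ G (k', e) = 3 ∧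
      (e = r + 1 → k ≤ k') := by
    intro k'
    by_cases hk : k < k' ∧ k' ≤ j
    · obtain ⟨e, e1, e2, e3⟩ := hp.three k' hk.1 hk.2
      exact ⟨e, fun _ _ => ⟨e1, by simp at e2; omega, e3, by omega⟩⟩
    · exact ⟨r + 1, fun p q => by
        obtain rfl : k = k' := by omega
        exact ⟨by omega, by omega, hz, by omega⟩⟩
  choose w hw using h5
  unfold Before at hκ hκ'
  have key : ∀ v ∈ C, G v = 1 ∨ G v = 2 → Within G (-(r + 1)) (k - r - 1) h d v →
      G v = 1 ∧ k ≤ v.1 ∧ v.1 < j ∧ v.1 ≤ v.2 := by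
    rintro ⟨k', l⟩ hv hg hin
    have hkl := hs.le _ hv
    simp only at hkl ⊢
    have hno : ¬ (j < k' ∧ c < l) := fun hh => by
      have := hG.diag_one (k := j) (l := c) (k' := k') (l' := l) hjc hkl hh.1 hh.2 (by omega)
      omega
    have hno' : ¬ (k' < k ∧ l < r) := fun hh => by
      have := hG.diag_one (k := k') (l := l) (k' := k) (l' := r) hkl (by omega) hh.1 hh.2 (by omega)
      omega
    have hno3 : ¬ (k' < k ∧ l = r) := fun hh => by
      obtain ⟨hh, rfl⟩ := hh
      have := hG.col_le (k := k') (k' := k - 1) (l := l) (by omega) (by omega)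
      have := hG.col_le (k := k - 1) (k' := k) (l := l) (by omega) (by omega)
      omega
    have hno'' : G (k', l) = 1 → k' = j → ¬ c < l := fun e hh hcl => by
      subst hh
      have := hG.row_le (k := k') (l := c) (l' := l) hjc (by omega)
      have := hG.row_ne (k := k') (l := c) (l' := l) hjc (by omega)
      omega
    rcases hg with hg | hg
    · rw [within_marked (.inl hg)] at hin
      simp only at hin
      have := hno'' hg
      exact ⟨hg, by omega, by omega, hkl⟩
    · rw [within_unmarked (.inl hg)] at hin
      simp only at hin
      omega
  have wIn : ∀ k', k ≤ k' → k' ≤ j → G (k', w k') = 3 ∧ k' ≤ w k' ∧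
      Within G (-(r + 1)) (k - r - 1) h d (k', w k') := fun k' hk hk' => by
    obtain ⟨q1, q2, q3, q4⟩ := hw k' hk hk'
    refine ⟨q3, by omega, ?_⟩
    rw [within_marked (.inr q3)]
    simp only
    omega
  obtain ⟨t1, t2, t3⟩ := wIn j h1 le_rfl
  -- The walk ends to the west of a 3, so row k has its 3 as well and every 1 can go to the 3 of its
  -- own row. The ones lie below row j, which leaves the 3 of row j unused.
  refine partialSum_lt_of_injOn hs (by unfold Before; omega) (fun v => (v.1, w v.1))
    (fun v hv hg hin => ?_) (fun v hv hg hin v' hv' hg' hin' e => ?_) (e := (j, w j)) t2 (.inl t1)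
    t3 (fun v hv hg hin e => ?_)
  · obtain ⟨p1, p2, p3, p4⟩ := key v hv hg hin
    obtain ⟨q1, q2, q3⟩ := wIn v.1 (by omega) (by omega)
    exact ⟨q2, .inl q1, q3⟩
  · obtain ⟨p1, p2, p3, p4⟩ := key v hv hg hin
    obtain ⟨p1', p2', p3', p4'⟩ := key v' hv' hg' hin'
    simp only [Prod.mk.injEq] at e
    obtain ⟨k, l⟩ := v
    obtain ⟨k', l'⟩ := v'
    simp only at *
    obtain ⟨rfl, -⟩ := e
    rcases lt_trichotomy l l' with hl | rfl | hl
    · exact absurd p1 (hG.row_ne p4 hl (by omega)).1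
    · rfl
    · exact absurd p1' (hG.row_ne p4' hl (by omega)).1
  · obtain ⟨p1, p2, p3, p4⟩ := key v hv hg hin
    simp only [Prod.mk.injEq] at e
    omega

end TwoLetter

end Shifted

namespace Shifted

namespace TwoLetter

variable {C : Finset (ℤ × ℤ)} {G : ℤ × ℤ → ℤ}

/-! ### The ribbon above the lowered cell -/

/-- What holds for the cells `v` on the way northwest from `(j + 1, c)`. -/
structure HeadInv (G : ℤ × ℤ → ℤ) (j c : ℤ) (v : ℤ × ℤ) : Prop where
  row : j + 1 ≤ v.1
  col : v.2 ≤ c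
  le : v.1 ≤ v.2
  two : IsTwo G v
  four : ∀ l, v.2 < l → l ≤ c → ∃ k, j + 1 ≤ k ∧ k ≤ v.1 ∧ G (k, l) = 4
  content : ∀ d, v.2 - v.1 ≤ d → d ≤ c - j - 1 →
    ∃ k l, k ≤ l ∧ j + 1 ≤ k ∧ l ≤ c ∧ l - k = d ∧ IsTwo G (k, l)

/-- A step west leaves a cell with a two to its left. A row has no two 3s, so the cell left is a 4,
and it serves the column just passed. Every step lowers the content by exactly one, so no diagonal
is skipped. -/
theorem HeadInv.step (hG : Valid G) {j c : ℤ} {v v' : ℤ × ℤ} (h : HeadInv G j c v)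
    (hst : StepNW (IsTwo G) v v') : HeadInv G j c v' := by
  obtain ⟨k, l⟩ := v
  obtain ⟨h1, h2, h3, h4, h5, h6⟩ := h
  obtain ⟨ho, hle, rfl | rfl⟩ := hst
  · simp only at *
    refine ⟨by omega, h2, hle, ho, fun l' hl hl' => ?_, fun d hd hd' => ?_⟩
    · obtain ⟨k', e1, e2, e3⟩ := h5 l' hl hl'
      exact ⟨k', e1, by omega, e3⟩
    · rcases eq_or_lt_of_le hd with rfl | hlt
      · exact ⟨k + 1, l, hle, by omega, h2, rfl, ho⟩
      · exact h6 d (by omega) hd'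
  · simp only at *
    have r1 := hG.row_ne (k := k) (l := l - 1) (l' := l) hle (by omega)
    have r2 := hG.row_le (k := k) (l := l - 1) (l' := l) hle (by omega)
    have h4' : G (k, l) = 4 := by
      unfold IsTwo at *
      omega
    refine ⟨h1, by omega, hle, ho, fun l' hl hl' => ?_, fun d hd hd' => ?_⟩
    · rcases eq_or_lt_of_le (show l ≤ l' by omega) with rfl | hlt
      · exact ⟨k, h1, le_rfl, h4'⟩
      · exact h5 l' hlt hl'
    · rcases eq_or_lt_of_le hd with rfl | hlt
      · exact ⟨k, l - 1, hle, by omega, by omega, rfl, ho⟩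
      · exact h6 d (by omega) hd'

theorem HeadInv.of_path (hG : Valid G) {j c : ℤ} (hjc : j < c) (hy : IsTwo G (j + 1, c))
    {v : ℤ × ℤ} (hp : Relation.ReflTransGen (StepNW (IsTwo G)) (j + 1, c) v) :
    HeadInv G j c v := by
  induction hp with
  | refl =>
    exact ⟨le_rfl, le_rfl, by simp; omega, hy, fun l h1 h2 => by simp at h1; omega,
      fun d h1 h2 => ⟨j + 1, c, by omega, le_rfl, le_rfl, by simp at h1; omega, hy⟩⟩
  | tail _ hst ih => exact ih.step hG hst

/-- The ones read from the head (a, b), taken as unmarked, up to x are 2s in columns b to c - 1, at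
most one per column; send each to a 4 of the ribbon in the next column. Hence the sum at the head is
at least m - 1, and it is at most m - 1 because x gives the first maximum. Equality makes the
injection onto, which is the second claim. -/
theorem FirstMax.surj_of_head (hG : Valid G) (hs : Supported C G) {j c m a b : ℤ} (hjc : j < c)
    (hx : G (j, c) = 2) (hm : FirstMax C G (j, c) m) (hp : HeadInv G j c (a, b))
    (hend : ∀ v', ¬ StepNW (IsTwo G) (a, b) v') (hab : a < b) :
    partialSum C G (-a) (b - a) = m - 1 ∧
    ∀ k l, k ≤ l → IsTwo G (k, l) → Within G (-a) (b - a) (-j) (c - j) (k, l) →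
      l ≤ c ∧ ∃ k', k' ≤ l - 1 ∧ j ≤ k' ∧ k' < a ∧ b ≤ l - 1 ∧ G (k', l - 1) = 2 := by
  obtain ⟨h1, h2, h3, h4, h5, -⟩ := hp
  have hE := hend (a, b - 1)
  have hE' : ¬ IsTwo G (a, b - 1) := fun hh => hE ⟨hh, by simp; omega, .inr rfl⟩
  simp only at *
  have hy : 3 ≤ G (j + 1, c) := by
    have := hG.north_le j c (by omega)
    have := hG.north_ne j c (by omega)
    omega
  have hw' : ∀ l, ∃ k, b < l → l ≤ c → j + 1 ≤ k ∧ k ≤ a ∧ G (k, l) = 4 := fun l => by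
    by_cases h : b < l ∧ l ≤ c
    · obtain ⟨k, hk⟩ := h5 l h.1 h.2
      exact ⟨k, fun _ _ => hk⟩
    · exact ⟨0, fun p q => absurd ⟨p, q⟩ h⟩
  choose w hw using hw'
  -- The ribbon does not continue west of (a, b), so row a has no entry from 3 on further west. In
  -- lower rows such an entry would force at least 5 at (a, b).
  have huw : ¬ ∃ k l, k ≤ l ∧ k ≤ a ∧ l < b ∧ 3 ≤ G (k, l) := by
    rintro ⟨k, l, e1, e2, e3, e4⟩
    unfold IsTwo at *
    rcases eq_or_lt_of_le e2 with rfl | hlt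
    · have := hG.row_le (k := k) (l := l) (l' := b - 1) e1 (by omega)
      have := hG.row_le (k := k) (l := b - 1) (l' := b) (by omega) (by omega)
      omega
    · have := hG.diag_two (k := k) (l := l) (k' := a) (l' := b) e1 h3 hlt e3 e4
      omega
  have key : ∀ v ∈ C, G v = 1 ∨ G v = 2 → Within G (-a) (b - a) (-j) (c - j) v →
      G v = 2 ∧ j ≤ v.1 ∧ v.1 < a ∧ v.1 ≤ v.2 ∧ b ≤ v.2 ∧ v.2 < c := by
    rintro ⟨k, l⟩ hv hg hin
    have hkl := hs.le _ hv
    simp only at hkl ⊢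
    rcases hg with hg | hg
    · exfalso
      rw [within_marked (.inl hg)] at hin
      simp only at hin
      have hno : ¬ k < j := fun hh => by
        have := hG.diag_one (k := k) (l := l) (k' := j) (l' := c) hkl hjc.le hh (by omega)
          (by omega)
        omega
      have := hG.diag_one (k := k) (l := l) (k' := k + 1) (l' := l + 1) hkl (by omega) (by omega)
        (by omega) (by omega)
      exact huw ⟨k + 1, l + 1, by omega, by omega, by omega, this⟩
    · rw [within_unmarked (.inl hg)] at hin
      simp only at hin
      have hka : k < a := by
        by_contra hcon
        obtain rfl : k = a := by omega
        have := hG.row_le (k := k) (l := b) (l' := l) (by omega) (by omega)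
        unfold IsTwo at h4
        omega
      have hlc : l < c := by
        by_contra hcon
        have hjk : j < k := by omega
        have := hG.mono (k := j + 1) (l := c) (k' := k) (l' := l) (by omega) (by omega) (by omega)
          (by omega)
        omega
      refine ⟨hg, by omega, hka, hkl, ?_, hlc⟩
      by_contra hcon
      rcases eq_or_lt_of_le hkl with rfl | hlt
      · have := hG.diag_one (k := k) (l := k) (k' := k + 1) (l' := k + 1) hkl (by omega) (by omega)
          (by omega) (by omega)
        exact huw ⟨k + 1, k + 1, by omega, by omega, by omega, this⟩
      · have c1 := hG.north_le k l (by omega)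
        have c2 := hG.north_ne k l (by omega)
        exact huw ⟨k + 1, l, by omega, by omega, by omega, by omega⟩
  have hup : partialSum C G (-j) (c - j) = m - 1 := by
    have := hm.eq
    rwa [hookOf_unmarked (.inl hx), placeOf_unmarked (.inl hx)] at this
  have hlow : partialSum C G (-a) (b - a) ≤ m - 1 := by
    refine hm.before _ _ ?_
    rw [hookOf_unmarked (.inl hx), placeOf_unmarked (.inl hx)]
    unfold Before
    simp only
    omega
  have A1 : ∀ v ∈ C, G v = 1 ∨ G v = 2 → Within G (-a) (b - a) (-j) (c - j) v →
      ((w (v.2 + 1), v.2 + 1) : ℤ × ℤ).1 ≤ ((w (v.2 + 1), v.2 + 1) : ℤ × ℤ).2 ∧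
      (G (w (v.2 + 1), v.2 + 1) = 3 ∨ G (w (v.2 + 1), v.2 + 1) = 4) ∧
      Within G (-a) (b - a) (-j) (c - j) (w (v.2 + 1), v.2 + 1) := fun v hv hg hin => by
    obtain ⟨p1, p2, p3, p4, p5, p6⟩ := key v hv hg hin
    obtain ⟨q1, q2, q3⟩ := hw (v.2 + 1) (by omega) (by omega)
    refine ⟨by simp only; omega, .inr q3, ?_⟩
    rw [within_unmarked (.inr q3)]
    simp only
    omega
  have A2 : ∀ v ∈ C, G v = 1 ∨ G v = 2 → Within G (-a) (b - a) (-j) (c - j) v →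
      ∀ v' ∈ C, G v' = 1 ∨ G v' = 2 → Within G (-a) (b - a) (-j) (c - j) v' →
      ((w (v.2 + 1), v.2 + 1) : ℤ × ℤ) = (w (v'.2 + 1), v'.2 + 1) → v = v' :=
    fun v hv hg hin v' hv' hg' hin' e => by
      obtain ⟨p1, p2, p3, p4, p5, p6⟩ := key v hv hg hin
      obtain ⟨p1', p2', p3', p4', p5', p6'⟩ := key v' hv' hg' hin'
      obtain ⟨k, l⟩ := v
      obtain ⟨k', l'⟩ := v'
      simp only [Prod.mk.injEq, add_left_inj] at *
      obtain ⟨-, rfl⟩ := e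
      rcases lt_trichotomy k k' with hl | rfl | hl
      · exact absurd p1 (hG.col_ne p4' hl (by omega)).1
      · exact ⟨rfl, rfl⟩
      · exact absurd p1' (hG.col_ne p4 hl (by omega)).1
  have hBef : ¬ Before (-j) (c - j) (-a) (b - a) := by unfold Before; omega
  refine ⟨?_, fun k l hkl ht hin => ?_⟩
  · have := partialSum_le_of_injOn hs hBef _ A1 A2
    omega
  · by_contra hcon
    have := partialSum_lt_of_injOn hs hBef _ A1 A2 (e := (k, l)) hkl ht hin
      (fun v hv hg hin' e => hcon ?_)
    · omega
    · obtain ⟨p1, p2, p3, p4, p5, p6⟩ := key v hv hg hin'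
      simp only [Prod.mk.injEq] at e
      obtain ⟨-, rfl⟩ := e
      have : v.2 + 1 - 1 = v.2 := by ring
      rw [this]
      exact ⟨by omega, v.1, p4, p2, p3, p5, p1⟩

/-- A ribbon that reaches the diagonal meets every content from 0 to c - j - 1. The interval runs
from the position of x as a marked cell to its position as an unmarked one; a one read there goes to
a ribbon cell of the same content. This is injective because no two ones share a diagonal. Equality
of the sums again gives surjectivity. -/
theorem FirstMax.surj_of_head_diag (hG : Valid G) (hs : Supported C G) {j c m a : ℤ} (hjc : j < c)
    (hx : G (j, c) = 2) (hm : FirstMax C G (j, c) m) (hp : HeadInv G j c (a, a)) :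
    partialSum C G (-c) (j - c) = m - 1 ∧
    ∀ k l, k ≤ l → IsTwo G (k, l) → Within G (-c) (j - c) (-j) (c - j) (k, l) →
      l - k ≤ c - j - 1 ∧
      ∃ k' l', k' ≤ l' ∧ j ≤ k' ∧ l' ≤ c ∧ l' - k' = l - k ∧ IsOne G (k', l') := by
  obtain ⟨h1, h2, h3, h4, -, h6⟩ := hp
  simp only at *
  have hy : 3 ≤ G (j + 1, c) := by
    have := hG.north_le j c (by omega)
    have := hG.north_ne j c (by omega)
    omega
  have hw' : ∀ d, ∃ v : ℤ × ℤ, 0 ≤ d → d ≤ c - j - 1 →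
      v.1 ≤ v.2 ∧ j + 1 ≤ v.1 ∧ v.2 ≤ c ∧ v.2 - v.1 = d ∧ IsTwo G v := fun d => by
    by_cases h : 0 ≤ d ∧ d ≤ c - j - 1
    · obtain ⟨k, l, hk⟩ := h6 d (by omega) h.2
      exact ⟨(k, l), fun _ _ => hk⟩
    · exact ⟨0, fun p q => absurd ⟨p, q⟩ h⟩
  choose w hw using hw'
  have key : ∀ v ∈ C, G v = 1 ∨ G v = 2 → Within G (-c) (j - c) (-j) (c - j) v →
      j ≤ v.1 ∧ v.1 ≤ v.2 ∧ v.2 < c := by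
    rintro ⟨k, l⟩ hv hg hin
    have hkl := hs.le _ hv
    simp only at hkl ⊢
    have hlc : c ≤ l → j < k → False := fun e1 e2 => by
      have := hG.mono (k := j + 1) (l := c) (k' := k) (l' := l) (by omega) (by omega) (by omega)
        (by omega)
      omega
    rcases hg with hg | hg
    · rw [within_marked (.inl hg)] at hin
      simp only at hin
      have hl : l < c := by
        by_contra hcon
        obtain rfl : l = c := by omega
        rcases eq_or_lt_of_le (show j ≤ k by omega) with rfl | hlt
        · omega
        · exact hlc le_rfl hlt
      have hno : ¬ k < j := fun hh => by
        have := hG.diag_one (k := k) (l := l) (k' := j) (l' := c) hkl hjc.le hh (by omega)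
          (by omega)
        omega
      omega
    · rw [within_unmarked (.inl hg)] at hin
      simp only at hin
      have : ¬ (c ≤ l ∧ j < k) := fun hh => hlc hh.1 hh.2
      omega
  have hup : partialSum C G (-j) (c - j) = m - 1 := by
    have := hm.eq
    rwa [hookOf_unmarked (.inl hx), placeOf_unmarked (.inl hx)] at this
  have hlow : partialSum C G (-c) (j - c) ≤ m - 1 := by
    refine hm.before _ _ ?_
    rw [hookOf_unmarked (.inl hx), placeOf_unmarked (.inl hx)]
    unfold Before
    simp only
    omega
  have A1 : ∀ v ∈ C, G v = 1 ∨ G v = 2 → Within G (-c) (j - c) (-j) (c - j) v →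
      (w (v.2 - v.1)).1 ≤ (w (v.2 - v.1)).2 ∧
      (G (w (v.2 - v.1)) = 3 ∨ G (w (v.2 - v.1)) = 4) ∧
      Within G (-c) (j - c) (-j) (c - j) (w (v.2 - v.1)) := fun v hv hg hin => by
    obtain ⟨p1, p2, p3⟩ := key v hv hg hin
    obtain ⟨q1, q2, q3, q4, q5⟩ := hw (v.2 - v.1) (by omega) (by omega)
    refine ⟨q1, q5, ?_⟩
    rcases q5 with q5 | q5
    · rw [within_marked (.inr q5)]
      omega
    · rw [within_unmarked (.inr q5)]
      omega
  have A2 : ∀ v ∈ C, G v = 1 ∨ G v = 2 → Within G (-c) (j - c) (-j) (c - j) v →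
      ∀ v' ∈ C, G v' = 1 ∨ G v' = 2 → Within G (-c) (j - c) (-j) (c - j) v' →
      w (v.2 - v.1) = w (v'.2 - v'.1) → v = v' :=
    fun v hv hg hin v' hv' hg' hin' e => by
      obtain ⟨p1, p2, p3⟩ := key v hv hg hin
      obtain ⟨p1', p2', p3'⟩ := key v' hv' hg' hin'
      obtain ⟨q1, q2, q3, q4, q5⟩ := hw (v.2 - v.1) (by omega) (by omega)
      obtain ⟨q1', q2', q3', q4', q5'⟩ := hw (v'.2 - v'.1) (by omega) (by omega)
      rw [← e] at q4'
      obtain ⟨k, l⟩ := v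
      obtain ⟨k', l'⟩ := v'
      simp only [Prod.mk.injEq] at *
      rcases lt_trichotomy k k' with hl | rfl | hl
      · have := hG.diag_one (k := k) (l := l) (k' := k') (l' := l') p2 p2' hl (by omega) (by omega)
        omega
      · omega
      · have := hG.diag_one (k := k') (l := l') (k' := k) (l' := l) p2' p2 hl (by omega) (by omega)
        omega
  have hBef : ¬ Before (-j) (c - j) (-c) (j - c) := by unfold Before; omega
  refine ⟨?_, fun k l hkl ht hin => ?_⟩
  · have := partialSum_le_of_injOn hs hBef _ A1 A2
    omega
  · by_contra hcon
    have := partialSum_lt_of_injOn hs hBef _ A1 A2 (e := (k, l)) hkl ht hin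
      (fun v hv hg hin' e => hcon ?_)
    · omega
    · obtain ⟨p1, p2, p3⟩ := key v hv hg hin'
      obtain ⟨q1, q2, q3, q4, q5⟩ := hw (v.2 - v.1) (by omega) (by omega)
      rw [e] at q4
      simp only at q4
      exact ⟨by omega, v.1, v.2, p2, p1, by omega, by omega, hg⟩

end TwoLetter

end Shifted

namespace Shifted

namespace TwoLetter

open Function Relation

variable {C : Finset (ℤ × ℤ)} {G : ℤ × ℤ → ℤ}

/-! ### The two operators -/

/-- The rules by which lowering at the cell `x` turns `G` into `G'`. -/
inductive LowerRel (G : ℤ × ℤ → ℤ) (x : ℤ × ℤ) (G' : ℤ × ℤ → ℤ) : Prop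
  | east (h : G x = 2) (hz : G (x.1, x.2 + 1) = 3)
      (e : G' = update (update G x 3) (x.1, x.2 + 1) 4)
  | single (h : G x = 2) (hz : G (x.1, x.2 + 1) ≠ 3)
      (hy : x.1 + 1 ≤ x.2 → 4 < G (x.1 + 1, x.2)) (e : G' = update G x 4)
  | head (h : G x = 2) (hz : G (x.1, x.2 + 1) ≠ 3) (hxy : x.1 + 1 ≤ x.2)
      (hy : G (x.1 + 1, x.2) ≤ 4) (u : ℤ × ℤ) (hu : IsHead (IsTwo G) (x.1 + 1, x.2) u)
      (hd : u.1 ≠ u.2) (hgu : G u = 3) (e : G' = update (update G x 3) u 4)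
  | headDiag (h : G x = 2) (hz : G (x.1, x.2 + 1) ≠ 3) (hxy : x.1 + 1 ≤ x.2)
      (hy : G (x.1 + 1, x.2) ≤ 4) (u : ℤ × ℤ) (hu : IsHead (IsTwo G) (x.1 + 1, x.2) u)
      (hd : u.1 = u.2) (e : G' = update G x 3)
  | markedNorth (h : G x = 1) (hxy : x.1 + 1 ≤ x.2) (hy : G (x.1 + 1, x.2) = 2)
      (e : G' = update (update G x 2) (x.1 + 1, x.2) 3)
  | markedSingle (h : G x = 1) (hy : x.1 + 1 ≤ x.2 → G (x.1 + 1, x.2) ≠ 2)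
      (hz : 3 < G (x.1, x.2 + 1)) (e : G' = update G x 3)
  | markedPath (h : G x = 1) (hy : x.1 + 1 ≤ x.2 → G (x.1 + 1, x.2) ≠ 2)
      (hz : G (x.1, x.2 + 1) ≤ 3) (u : ℤ × ℤ)
      (hp : ReflTransGen (StepSE (IsOne G) (LowerStop G)) x u) (hu : LowerStop G u)
      (e : G' = update (update G x 2) u 3)

/-- The rules by which raising at the cell `x` turns `G` into `G'`. -/
inductive RaiseRel (G : ℤ × ℤ → ℤ) (x : ℤ × ℤ) (G' : ℤ × ℤ → ℤ) : Prop
  | south (h : G x = 3) (hz : G (x.1 - 1, x.2) = 2)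
      (e : G' = update (update G x 2) (x.1 - 1, x.2) 1)
  | single (h : G x = 3) (hz : G (x.1 - 1, x.2) ≠ 2)
      (hy : x.1 ≤ x.2 - 1 → G (x.1, x.2 - 1) < 1) (e : G' = update G x 1)
  | head (h : G x = 3) (hz : G (x.1 - 1, x.2) ≠ 2) (hxy : x.1 ≤ x.2 - 1)
      (hy : 1 ≤ G (x.1, x.2 - 1)) (u : ℤ × ℤ) (hu : IsHead (IsOne G) (x.1, x.2 - 1) u)
      (hd : u.1 ≠ u.2) (hgu : G u = 2) (e : G' = update (update G x 2) u 1)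
  | headDiag (h : G x = 3) (hz : G (x.1 - 1, x.2) ≠ 2) (hxy : x.1 ≤ x.2 - 1)
      (hy : 1 ≤ G (x.1, x.2 - 1)) (u : ℤ × ℤ) (hu : IsHead (IsOne G) (x.1, x.2 - 1) u)
      (hd : u.1 = u.2) (e : G' = update G x 2)
  | unmarkedWest (h : G x = 4) (hxy : x.1 ≤ x.2 - 1) (hy : G (x.1, x.2 - 1) = 3)
      (e : G' = update (update G x 3) (x.1, x.2 - 1) 2)
  | unmarkedSingle (h : G x = 4) (hy : x.1 ≤ x.2 - 1 → G (x.1, x.2 - 1) ≠ 3)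
      (hz : G (x.1 - 1, x.2) < 2) (e : G' = update G x 2)
  | unmarkedPath (h : G x = 4) (hy : x.1 ≤ x.2 - 1 → G (x.1, x.2 - 1) ≠ 3)
      (hz : 2 ≤ G (x.1 - 1, x.2)) (u : ℤ × ℤ)
      (hp : ReflTransGen (StepSE (IsTwo G) (RaiseStop G)) x u) (hu : RaiseStop G u)
      (e : G' = update (update G x 3) u 2)

/-- The sum of all signs. -/
def totalSum (C : Finset (ℤ × ℤ)) (G : ℤ × ℤ → ℤ) : ℤ := ∑ v ∈ C, sgn (G v)

theorem totalSum_update {x : ℤ × ℤ} (hx : x ∈ C) (g : ℤ) :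
    totalSum C (update G x g) = totalSum C G - sgn (G x) + sgn g := by
  unfold totalSum
  rw [← Finset.add_sum_erase C _ hx, ← Finset.add_sum_erase C (fun v => sgn (G v)) hx]
  have : ∑ v ∈ C.erase x, sgn (update G x g v) = ∑ v ∈ C.erase x, sgn (G v) := by
    refine Finset.sum_congr rfl fun v hv => ?_
    rw [update_of_ne (Finset.ne_of_mem_erase hv)]
  rw [this, update_self]
  ring

/-- The entries `1, 2, 3, 4` may change among themselves, without a change of marking on the
diagonal. -/
def Similar (G G' : ℤ × ℤ → ℤ) : Prop :=
  ∀ v, G v = G' v ∨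
    (1 ≤ G v ∧ G v ≤ 4 ∧ 1 ≤ G' v ∧ G' v ≤ 4 ∧ (v.1 = v.2 → G v % 2 = G' v % 2))

theorem Similar.trans {G G' G'' : ℤ × ℤ → ℤ} (h : Similar G G') (h' : Similar G' G'') :
    Similar G G'' := fun v => by
  rcases h v with h | ⟨h1, h2, h3, h4, h5⟩ <;> rcases h' v with h' | ⟨h1', h2', h3', h4', h5'⟩
  · exact .inl (h.trans h')
  · rw [h]
    exact .inr ⟨h1', h2', h3', h4', h5'⟩
  · rw [← h']
    exact .inr ⟨h1, h2, h3, h4, h5⟩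
  · exact .inr ⟨h1, h2, h3', h4', fun e => (h5 e).trans (h5' e)⟩

theorem Similar.update_cell {x : ℤ × ℤ} {g : ℤ} (h1 : 1 ≤ G x) (h2 : G x ≤ 4) (h3 : 1 ≤ g) (h4 : g ≤ 4)
    (h5 : x.1 = x.2 → G x % 2 = g % 2) : Similar G (update G x g) := fun v => by
  by_cases hv : v = x
  · subst hv
    rw [update_self]
    exact .inr ⟨h1, h2, h3, h4, h5⟩
  · rw [update_of_ne hv]
    exact .inl rfl

/-- Lowering at `x` turns `G` into `G'`, and raising at `x'` turns `G'` into `G`. -/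
structure IsLowering (C : Finset (ℤ × ℤ)) (G : ℤ × ℤ → ℤ) (x : ℤ × ℤ) (m : ℤ) (G' : ℤ × ℤ → ℤ)
    (x' : ℤ × ℤ) : Prop where
  valid : Valid G'
  lastMax : LastMax C G' x' (m - 1)
  lower : LowerRel G x G'
  raise : RaiseRel G' x' G
  similar : Similar G G'
  total : totalSum C G' = totalSum C G - 2

theorem Valid.update_cell (hG : Valid G) {j c g : ℤ} (hjc : j ≤ c) (hE : g ≤ G (j, c + 1))
    (hE' : g = G (j, c + 1) → g ≠ 1 ∧ g ≠ 3) (hW : j ≤ c - 1 → G (j, c - 1) ≤ g)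
    (hW' : j ≤ c - 1 → G (j, c - 1) = g → g ≠ 1 ∧ g ≠ 3) (hN : j + 1 ≤ c → g ≤ G (j + 1, c))
    (hN' : j + 1 ≤ c → g = G (j + 1, c) → g ≠ 2 ∧ g ≠ 4) (hS : G (j - 1, c) ≤ g)
    (hS' : G (j - 1, c) = g → g ≠ 2 ∧ g ≠ 4) : Valid (update G (j, c) g) := by
  have aux : ∀ k l, (k, l) = (j, c) ∨ update G (j, c) g (k, l) = G (k, l) := fun k l => by
    by_cases h : (k, l) = (j, c)
    · exact .inl h
    · exact .inr (update_of_ne h _ _)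
  have self : Function.update G (j, c) g (j, c) = g := update_self _ _ _
  have east : Function.update G (j, c) g (j, c + 1) = G (j, c + 1) :=
    update_of_ne (by simp) _ _
  have north : Function.update G (j, c) g (j + 1, c) = G (j + 1, c) :=
    update_of_ne (by simp) _ _
  refine ⟨fun k l h => ?_, fun k l h => ?_, fun k l h => ?_, fun k l h => ?_⟩
  · rcases aux k l with e | e
    · simp only [Prod.mk.injEq] at e
      obtain ⟨rfl, rfl⟩ := e
      rw [self, east]
      exact hE
    · rw [e]
      rcases aux k (l + 1) with e' | e'
      · simp only [Prod.mk.injEq] at e'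
        obtain ⟨rfl, rfl⟩ := e'
        rw [self]
        simpa using hW (by omega)
      · rw [e']
        exact hG.east_le k l h
  · rcases aux k l with e | e
    · simp only [Prod.mk.injEq] at e
      obtain ⟨rfl, rfl⟩ := e
      rw [self, east]
      exact hE'
    · rw [e]
      rcases aux k (l + 1) with e' | e'
      · simp only [Prod.mk.injEq] at e'
        obtain ⟨rfl, rfl⟩ := e'
        rw [self]
        intro h'
        rw [h']
        exact hW' (by omega) (by simpa using h')
      · rw [e']
        exact hG.east_ne k l h
  · rcases aux k l with e | e
    · simp only [Prod.mk.injEq] at e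
      obtain ⟨rfl, rfl⟩ := e
      rw [self, north]
      exact hN h
    · rw [e]
      rcases aux (k + 1) l with e' | e'
      · simp only [Prod.mk.injEq] at e'
        obtain ⟨rfl, rfl⟩ := e'
        rw [self]
        simpa using hS
      · rw [e']
        exact hG.north_le k l h
  · rcases aux k l with e | e
    · simp only [Prod.mk.injEq] at e
      obtain ⟨rfl, rfl⟩ := e
      rw [self, north]
      exact hN' h
    · rw [e]
      rcases aux (k + 1) l with e' | e'
      · simp only [Prod.mk.injEq] at e'
        obtain ⟨rfl, rfl⟩ := e'
        rw [self]
        intro h'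
        rw [h']
        exact hS' (by simpa using h')
      · rw [e']
        exact hG.north_ne k l h

/-! ### Partial sums around a lowered cell -/

theorem contrib_marked {g : ℤ} (hg : g = 1 ∨ g = 3) (k l h d : ℤ) :
    contrib g (k, l) h d = if -l < h ∨ -l = h ∧ k - l < d then 2 - g else 0 := by
  unfold contrib
  rw [hookOf_marked hg, placeOf_marked hg]
  rcases hg with rfl | rfl <;> simp [Before, sgn]

theorem contrib_unmarked {g : ℤ} (hg : g = 2 ∨ g = 4) (k l h d : ℤ) :
    contrib g (k, l) h d = if -k < h ∨ -k = h ∧ l - k < d then 3 - g else 0 := by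
  unfold contrib
  rw [hookOf_unmarked hg, placeOf_unmarked hg]
  rcases hg with rfl | rfl <;> simp [Before, sgn]

theorem FirstMax.before_marked {j c m : ℤ} (hm : FirstMax C G (j, c) m) (hx : G (j, c) = 1)
    (h d : ℤ) (hb : ¬ (-c < h ∨ -c = h ∧ j - c < d)) : partialSum C G h d ≤ m - 1 := by
  refine hm.before h d ?_
  rw [hookOf_marked (.inl hx), placeOf_marked (.inl hx)]
  exact hb

theorem FirstMax.before_unmarked {j c m : ℤ} (hm : FirstMax C G (j, c) m) (hx : G (j, c) = 2)
    (h d : ℤ) (hb : ¬ (-j < h ∨ -j = h ∧ c - j < d)) : partialSum C G h d ≤ m - 1 := by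
  refine hm.before h d ?_
  rw [hookOf_unmarked (.inl hx), placeOf_unmarked (.inl hx)]
  exact hb

theorem FirstMax.eq_marked {j c m : ℤ} (hm : FirstMax C G (j, c) m) (hx : G (j, c) = 1) :
    partialSum C G (-c) (j - c) = m - 1 := by
  have := hm.eq
  rwa [hookOf_marked (.inl hx), placeOf_marked (.inl hx)] at this

theorem FirstMax.eq_unmarked {j c m : ℤ} (hm : FirstMax C G (j, c) m) (hx : G (j, c) = 2) :
    partialSum C G (-j) (c - j) = m - 1 := by
  have := hm.eq
  rwa [hookOf_unmarked (.inl hx), placeOf_unmarked (.inl hx)] at this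

theorem partialSum_succ_marked (hs : Supported C G) {j c : ℤ} (hjc : j ≤ c)
    (hx : G (j, c) = 1 ∨ G (j, c) = 3) :
    partialSum C G (-c) (j - c + 1) = partialSum C G (-c) (j - c) + (2 - G (j, c)) := by
  have := partialSum_succ hs (hs.mem (j, c) hjc (by omega) (by omega))
  rw [hookOf_marked hx, placeOf_marked hx] at this
  simp only at this
  rw [this]
  rcases hx with hx | hx <;> simp [hx, sgn]

theorem partialSum_succ_unmarked (hs : Supported C G) {j c : ℤ} (hjc : j ≤ c)
    (hx : G (j, c) = 2 ∨ G (j, c) = 4) :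
    partialSum C G (-j) (c - j + 1) = partialSum C G (-j) (c - j) + (3 - G (j, c)) := by
  have := partialSum_succ hs (hs.mem (j, c) hjc (by omega) (by omega))
  rw [hookOf_unmarked hx, placeOf_unmarked hx] at this
  simp only at this
  rw [this]
  rcases hx with hx | hx <;> simp [hx, sgn]

/-- The letter after the first maximum is not `1`. -/
theorem FirstMax.east_ne_two (hs : Supported C G) {j c m : ℤ} (hjc : j ≤ c)
    (hm : FirstMax C G (j, c) m) (hx : G (j, c) = 2) : G (j, c + 1) ≠ 2 := fun hz => by
  have h1 := partialSum_succ_unmarked hs hjc (.inl hx)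
  have h2 := partialSum_succ_unmarked hs (j := j) (c := c + 1) (by omega) (.inl hz)
  have h3 := hm.eq_unmarked hx
  have h4 := hm.le (-j) (c + 1 - j + 1)
  rw [show c + 1 - j = c - j + 1 by ring] at h2 h4
  omega

/-- Marked entries of a column are read upwards, so a 1 above x would be the next one read and would
push the sum beyond its maximum. -/
theorem FirstMax.north_ne_one (hs : Supported C G) {j c m : ℤ} (hjc : j + 1 ≤ c)
    (hm : FirstMax C G (j, c) m) (hx : G (j, c) = 1) : G (j + 1, c) ≠ 1 := fun hz => by
  have h1 := partialSum_succ_marked hs (j := j) (c := c) (by omega) (.inl hx)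
  have h2 := partialSum_succ_marked hs (j := j + 1) (c := c) (by omega) (.inl hz)
  have h3 := hm.eq_marked hx
  have h4 := hm.le (-c) (j + 1 - c + 1)
  rw [show j + 1 - c = j - c + 1 by ring] at h2 h4
  omega

theorem LastMax.of_marked {j c m : ℤ} (hmem : (j, c) ∈ C) (hx : G (j, c) = 3)
    (heq : partialSum C G (-c) (j - c) = m)
    (h : ∀ h d, partialSum C G h d ≤ m ∧
      (-c < h ∨ -c = h ∧ j - c < d → partialSum C G h d ≤ m - 1)) : LastMax C G (j, c) m := by
  refine ⟨hmem, .inl hx, ?_, fun h' d hb => ?_, fun h' d => (h h' d).1⟩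
  · rw [hookOf_marked (.inr hx), placeOf_marked (.inr hx)]
    exact heq
  · rw [hookOf_marked (.inr hx), placeOf_marked (.inr hx)] at hb
    exact (h h' d).2 hb

theorem LastMax.of_unmarked {j c m : ℤ} (hmem : (j, c) ∈ C) (hx : G (j, c) = 4)
    (heq : partialSum C G (-j) (c - j) = m)
    (h : ∀ h d, partialSum C G h d ≤ m ∧
      (-j < h ∨ -j = h ∧ c - j < d → partialSum C G h d ≤ m - 1)) : LastMax C G (j, c) m := by
  refine ⟨hmem, .inr hx, ?_, fun h' d hb => ?_, fun h' d => (h h' d).1⟩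
  · rw [hookOf_unmarked (.inr hx), placeOf_unmarked (.inr hx)]
    exact heq
  · rw [hookOf_unmarked (.inr hx), placeOf_unmarked (.inr hx)] at hb
    exact (h h' d).2 hb

/-- At a lowered cell with an entry `2'` to its east, the partial sums are not maximal. -/
theorem FirstMax.partialSum_lt_of_east (hG : Valid G) (hs : Supported C G) {j c m : ℤ}
    (hjc : j ≤ c) (hm : FirstMax C G (j, c) m) (hx : G (j, c) = 2) (hz : G (j, c + 1) = 3)
    {h d : ℤ} (hκ : Before (-(c + 1)) (j - c - 1) h d) (hκ' : ¬ Before (-c) (j - c) h d) :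
    partialSum C G h d ≤ m - 2 := by
  obtain ⟨B, hB⟩ := hs.exists_content_bound
  obtain ⟨⟨a, b⟩, hp, hu⟩ := exists_stepSE_end (halt := LowerStop G) hB (j, c) hjc hm.one
  have hinv := PathInv.of_path hG hjc hm.one (.inr hz) hp
  have h1 := hinv.row
  have h2 := hinv.col
  simp only at h1 h2
  rcases hu with hu | hu
  -- A stopping cell differs from x, whose east neighbour is 3. The sum after the stopping cell
  -- would then exceed the sum after x, which is already the maximum.
  · exfalso
    have hab : ¬ (a < j ∧ b = c) := fun ⟨e1, e2⟩ => by
      subst e2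
      have := hG.col_ne (k := a) (k' := j) (l := b) hjc e1 (by rw [hx, hu.1])
      exact this.1 hu.1
    have hab' : ¬ (a = j ∧ b = c) := fun ⟨e1, e2⟩ => by
      subst e1 e2
      exact hu.2.2 hz
    have e1 := hinv.partialSum_lt hG hs hjc hm.one hu (h := -j) (d := c - j + 1)
      (by unfold Before; omega) (by unfold Before; omega)
    have e2 := partialSum_succ_unmarked hs hjc (.inl hx)
    have e3 := hm.eq_unmarked hx
    have e4 := hm.le (-a) (b - a + 1)
    omega
  · have e1 := hinv.partialSum_lt_of_end hG hs hjc hm.one hu hκ hκ'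
    have e2 := hm.before_unmarked hx (-(b + 1)) (a - b - 1) (by omega)
    omega

/-- Such an entry would be a 4 read in row j + 1, inside the interval of the surjectivity
statements. These confine the twos there to columns at most c, respectively to contents less than c
- j. -/
theorem FirstMax.north_east_not_two (hG : Valid G) (hs : Supported C G) {j c m : ℤ} (hjc : j < c)
    (hx : G (j, c) = 2) (hm : FirstMax C G (j, c) m) (hy : IsTwo G (j + 1, c)) :
    ¬ IsTwo G (j + 1, c + 1) := fun ht => by
  obtain ⟨⟨a, b⟩, hp, hend⟩ := exists_isHead (IsTwo G) (j + 1, c) (by simp; omega)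
  have hinv := HeadInv.of_path hG hjc hy hp
  have h1 := hinv.row
  have h2 := hinv.col
  have h3 := hinv.le
  simp only at h1 h2 h3
  have h4 : G (j + 1, c + 1) = 4 := by
    have := hG.east_le (j + 1) c (by omega)
    have := hG.east_ne (j + 1) c (by omega)
    unfold IsTwo at *
    omega
  rcases eq_or_lt_of_le h3 with rfl | hlt
  · have := ((hm.surj_of_head_diag hG hs hjc hx hinv).2 (j + 1) (c + 1) (by omega) ht (by
      rw [within_unmarked (.inr h4)]
      simp only
      omega)).1
    omega
  · have := ((hm.surj_of_head hG hs hjc hx hinv hend hlt).2 (j + 1) (c + 1) (by omega) ht (by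
      rw [within_unmarked (.inr h4)]
      simp only
      omega)).1
    omega

/-! ### Lowering an unmarked entry -/

/-- 2 and 4 are read at the same position: the sums up to x stay, at most m - 1, and all later ones
fall by 2. So the last maximum of the new filling is directly before x. -/
theorem FirstMax.isLowering_single (hG : Valid G) (hs : Supported C G) {j c m : ℤ} (hjc : j ≤ c)
    (hm : FirstMax C G (j, c) m) (hx : G (j, c) = 2) (hz : G (j, c + 1) ≠ 3)
    (hy : j + 1 ≤ c → 4 < G (j + 1, c)) :
    IsLowering C G (j, c) m (update G (j, c) 4) (j, c) := by
  have hz' := hm.east_ne_two hs hjc hx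
  have r1 := hG.east_le j c hjc
  have c1 := hG.north_le (j - 1) c (by omega)
  have c2 := hG.north_ne (j - 1) c (by omega)
  have r2 : j ≤ c - 1 → G (j, c - 1) ≤ G (j, c) := fun h => hG.row_le h (by omega)
  rw [sub_add_cancel] at c1 c2
  have hP : ∀ h d, partialSum C (update G (j, c) 4) h d = partialSum C G h d
      - (if -j < h ∨ -j = h ∧ c - j < d then 1 else 0)
      + (if -j < h ∨ -j = h ∧ c - j < d then -1 else 0) := fun h d => by
    rw [partialSum_update hm.mem, hx, contrib_unmarked (.inl rfl), contrib_unmarked (.inr rfl)]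
    norm_num
  refine ⟨hG.update_cell hjc (by omega) (by omega) (by omega) (by omega) (by omega) (by omega)
    (by omega) (by omega), LastMax.of_unmarked hm.mem (update_self _ _ _) ?_ fun h d => ?_,
    .single hx hz hy rfl, .unmarkedSingle (update_self _ _ _) ?_ ?_ ?_,
    Similar.update_cell (by omega) (by omega) (by omega) (by omega) (by simp [hx]), ?_⟩
  · rw [hP, hm.eq_unmarked hx]
    simp
  · rw [hP]
    have := hm.le h d
    have := hm.before_unmarked hx h d
    split_ifs <;> omega
  · rw [update_of_ne (by simp)]
    intro h
    have := r2 h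
    simp only
    omega
  · rw [update_of_ne (by simp)]
    simp only
    omega
  · rw [update_idem, ← hx, update_eq_self]
  · rw [totalSum_update hm.mem, hx]
    simp [sgn]
    ring

/-- The 3 moves from column c + 1 to column c, so the sums between these two reading positions rise
by one. `FirstMax.partialSum_lt_of_east` bounds them by m - 2 and thus leaves room for this. -/
theorem FirstMax.isLowering_east (hG : Valid G) (hs : Supported C G) {j c m : ℤ} (hjc : j ≤ c)
    (hm : FirstMax C G (j, c) m) (hx : G (j, c) = 2) (hz : G (j, c + 1) = 3) :
    IsLowering C G (j, c) m (update (update G (j, c) 3) (j, c + 1) 4) (j, c + 1) := by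
  have hlt := fun h d => hm.partialSum_lt_of_east hG hs hjc hx hz (h := h) (d := d)
  unfold Before at hlt
  -- The cell x receives a mark, so it must not be on the diagonal. There its marked and its
  -- unmarked position would coincide, and the bound m - 2 would contradict the sum m - 1 before x.
  have hjc' : j < c := by
    by_contra hcon
    obtain rfl : j = c := by omega
    have := hlt (-j) (j - j) (by omega) (by omega)
    have := hm.eq_unmarked hx
    omega
  have hzC : (j, c + 1) ∈ C := hs.mem _ (by simp; omega) (by omega) (by omega)
  have n1 := hG.north_le j (c + 1) (by omega)
  have n2 := hG.north_ne j c (by omega)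
  have n3 := hG.north_le j c (by omega)
  have e1 := hG.east_le (j + 1) c (by omega)
  have hN : 4 < G (j + 1, c + 1) := by
    by_contra hcon
    exact hm.north_east_not_two hG hs hjc' hx (by unfold IsTwo; omega) (by unfold IsTwo; omega)
  have hP1 : partialSum C G (-c) (j - c) ≤ m - 2 := hlt _ _ (by omega) (by omega)
  have r1 := hG.east_le j (c + 1) (by omega)
  have r2 := hG.east_ne j (c + 1) (by omega)
  have r3 := hG.row_le (k := j) (l := c - 1) (l' := c) (by omega) (by omega)
  have c1 := hG.north_le (j - 1) c (by omega)
  have c2 := hG.north_ne (j - 1) c (by omega)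
  have c3 := hG.north_le (j - 1) (c + 1) (by omega)
  rw [sub_add_cancel] at c1 c2 c3
  have hne : ((j, c + 1) : ℤ × ℤ) ≠ (j, c) := by simp
  have hP : ∀ h d, partialSum C (update (update G (j, c) 3) (j, c + 1) 4) h d = partialSum C G h d
      - (if -j < h ∨ -j = h ∧ c - j < d then 1 else 0)
      + (if -c < h ∨ -c = h ∧ j - c < d then -1 else 0)
      - (if -(c + 1) < h ∨ -(c + 1) = h ∧ j - (c + 1) < d then -1 else 0)
      + (if -j < h ∨ -j = h ∧ c + 1 - j < d then -1 else 0) := fun h d => by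
    rw [partialSum_update hzC, partialSum_update hm.mem, update_of_ne hne, hx, hz,
      contrib_unmarked (.inl rfl), contrib_marked (.inr rfl), contrib_unmarked (.inr rfl),
      contrib_marked (.inr rfl)]
    norm_num
  refine ⟨?_, LastMax.of_unmarked hzC (update_self _ _ _) ?_ fun h d => ?_,
    .east hx hz rfl, .unmarkedWest (update_self _ _ _) ?_ ?_ ?_, ?_, ?_⟩
  · rw [update_comm hne.symm]
    have hG1 : Valid (update G (j, c + 1) 4) := hG.update_cell (by omega) (by omega) (by omega)
      (by simp [hx]) (by simp [hx]) (by omega) (by omega) (by omega) (by omega)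
    refine hG1.update_cell hjc ?_ ?_ ?_ ?_ ?_ ?_ ?_ ?_ <;>
    simp [update_apply] <;> omega
  · rw [hP]
    have e1 := hm.eq_unmarked hx
    have e2 := partialSum_succ_unmarked hs hjc (.inl hx)
    rw [show c + 1 - j = c - j + 1 by ring]
    rw [e2, e1, hx]
    split_ifs <;> omega
  · rw [hP]
    have := hm.le h d
    have := hm.before_unmarked hx h d
    have := hlt h d
    have e2 := partialSum_succ_unmarked hs hjc (.inl hx)
    split_ifs <;> omega
  · simp only
    omega
  · simp
  · simp only
    rw [update_idem]
    funext v
    by_cases h1 : v = (j, c)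
    · subst h1
      simp [hx]
    · by_cases h2 : v = (j, c + 1)
      · subst h2
        simp [hz]
      · simp [h1, h2]
  · refine (Similar.update_cell (x := (j, c)) (g := 3) (by omega) (by omega) (by omega) (by omega)
      (by simp; omega)).trans (Similar.update_cell ?_ ?_ (by omega) (by omega) ?_)
    · rw [update_of_ne hne]
      omega
    · rw [update_of_ne hne]
      omega
    · simp
      omega
  · rw [totalSum_update hzC, totalSum_update hm.mem, update_of_ne hne, hx, hz]
    simp [sgn]
    ring

end TwoLetter

end Shifted

namespace Shifted

namespace TwoLetter

open Function Relation

variable {C : Finset (ℤ × ℤ)} {G : ℤ × ℤ → ℤ}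

/-! ### Lowering with a ribbon to the north -/

theorem StepNW.path_le {S : ℤ × ℤ → Prop} {v u : ℤ × ℤ} (h : ReflTransGen (StepNW S) v u) :
    v.1 ≤ u.1 ∧ u.2 ≤ v.2 := by
  induction h with
  | refl => simp
  | tail _ hst ih => rcases hst.2.2 with rfl | rfl <;> simp <;> omega

/-- Undoing a change of two cells. -/
theorem eq_update_update {x u : ℤ × ℤ} {p q a b : ℤ} (hx : G x = p) (hu : G u = q) :
    G = update (update (update (update G x a) u b) u q) x p := by
  rw [update_idem]
  funext v
  by_cases h1 : v = x
  · subst h1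
    simp [hx]
  · by_cases h2 : v = u
    · subst h2
      simp [h1, hu]
    · simp [h1, h2]

/-- The entry of x is now read in column c and not in row j, that of the head (a, b) in row a and
not in column b. Since c ≥ b > a > j, the sums first fall by one, then are restored, then fall by
one and finally by two; so the last maximum m - 1 is before the head. Surjectivity serves to show
that the raising walk from the head does not stop before x. -/
theorem FirstMax.isLowering_head (hG : Valid G) (hs : Supported C G) {j c m : ℤ}
    (hm : FirstMax C G (j, c) m) (hx : G (j, c) = 2) (hz : G (j, c + 1) ≠ 3)
    (hjc : j + 1 ≤ c) (hy : G (j + 1, c) ≤ 4) {u : ℤ × ℤ} (hu : IsHead (IsTwo G) (j + 1, c) u)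
    (hd : u.1 ≠ u.2) :
    IsLowering C G (j, c) m (update (update G (j, c) 3) u 4) u := by
  obtain ⟨a, b⟩ := u
  obtain ⟨hp, hend⟩ := hu
  have n1 := hG.north_le j c (by omega)
  have n2 := hG.north_ne j c (by omega)
  have hy' : IsTwo G (j + 1, c) := by unfold IsTwo; omega
  have hinv := HeadInv.of_path hG (by omega) hy' hp
  obtain ⟨h1, h2, h3, h4, h5, -⟩ := hinv
  simp only at h1 h2 h3 h4 h5 hd
  have hab : a < b := by omega
  obtain ⟨hP1, hsurj⟩ := hm.surj_of_head hG hs (by omega) hx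
    (HeadInv.of_path hG (by omega) hy' hp) hend hab
  -- A 4 at the head would have to be hit from column b - 1, but all sources lie in columns from b
  -- on. So a head off the diagonal is always marked.
  have hgu : G (a, b) = 3 := by
    rcases h4 with h4 | h4
    · exact h4
    · exfalso
      obtain ⟨-, k, q1, q2, q3, q4, -⟩ := hsurj a b h3 (.inr h4) (by
        rw [within_unmarked (.inr h4)]
        simp only
        omega)
      omega
  -- The ribbon has a 4 in column l + 1, and by surjectivity it comes from a 2 in column l.
  have hcol : ∀ l, b ≤ l → l < c → ∃ k, k ≤ l ∧ j ≤ k ∧ G (k, l) = 2 := fun l hl hl' => by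
    obtain ⟨k, k1, k2, k3⟩ := h5 (l + 1) (by omega) (by omega)
    obtain ⟨-, k', q1, q2, q3, q4, q5⟩ := hsurj k (l + 1) (by omega) (.inr k3) (by
      rw [within_unmarked (.inr k3)]
      simp only
      omega)
    rw [add_sub_cancel_right] at q1 q5
    exact ⟨k', q1, q2, q5⟩
  have hW' : ¬ IsTwo G (a, b - 1) := fun hh => hend (a, b - 1) ⟨hh, by simp; omega, .inr rfl⟩
  have hN' : a + 1 ≤ b → ¬ IsTwo G (a + 1, b) := fun hab hh =>
    hend (a + 1, b) ⟨hh, by simpa using hab, .inl rfl⟩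
  have hz' := hm.east_ne_two hs (by omega) hx
  have r1 := hG.east_le j c (by omega)
  have r3 := hG.row_le (k := j) (l := c - 1) (l' := c) (by omega) (by omega)
  have c1 := hG.north_le (j - 1) c (by omega)
  have c2 := hG.north_ne (j - 1) c (by omega)
  have r1' := hG.east_le a b (by omega)
  have r2' := hG.east_ne a b (by omega)
  have r3' := hG.row_le (k := a) (l := b - 1) (l' := b) (by omega) (by omega)
  have c1' := hG.north_le (a - 1) b (by omega)
  have c3' := hG.north_le a b (by omega)
  rw [sub_add_cancel] at c1 c2 c1'
  have huC : (a, b) ∈ C := hs.mem _ h3 (by omega) (by omega)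
  have hne : ((a, b) : ℤ × ℤ) ≠ (j, c) := by
    simp only [ne_eq, Prod.mk.injEq]
    omega
  have hP : ∀ h d, partialSum C (update (update G (j, c) 3) (a, b) 4) h d = partialSum C G h d
      - (if -j < h ∨ -j = h ∧ c - j < d then 1 else 0)
      + (if -c < h ∨ -c = h ∧ j - c < d then -1 else 0)
      - (if -b < h ∨ -b = h ∧ a - b < d then -1 else 0)
      + (if -a < h ∨ -a = h ∧ b - a < d then -1 else 0) := fun h d => by
    rw [partialSum_update huC, partialSum_update hm.mem, update_of_ne hne, hx, hgu,
      contrib_unmarked (.inl rfl), contrib_marked (.inr rfl), contrib_unmarked (.inr rfl),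
      contrib_marked (.inr rfl)]
    norm_num
  have hG'x : update (update G (j, c) 3) (a, b) 4 (j, c) = 3 := by
    rw [update_of_ne hne.symm, update_self]
  have hG'u : update (update G (j, c) 3) (a, b) 4 (a, b) = 4 := update_self _ _ _
  have hG'o : ∀ v, v ≠ (j, c) → v ≠ (a, b) → update (update G (j, c) 3) (a, b) 4 v = G v :=
    fun v e1 e2 => by rw [update_of_ne e2, update_of_ne e1]
  have hvalid : Valid (update (update G (j, c) 3) (a, b) 4) := by
    have hG1 : Valid (update G (j, c) 3) := hG.update_cell (by omega) (by omega) (by omega)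
      (by omega) (by omega) (by omega) (by omega) (by omega) (by omega)
    unfold IsTwo at hW' hN'
    refine hG1.update_cell h3 ?_ ?_ ?_ ?_ ?_ ?_ ?_ ?_ <;>
    simp only [update_apply, Prod.mk.injEq] <;> split_ifs <;> omega
  have hsim : Similar G (update (update G (j, c) 3) (a, b) 4) := by
    refine (Similar.update_cell (x := (j, c)) (g := 3) (by omega) (by omega) (by omega) (by omega)
      (by simp; omega)).trans (Similar.update_cell ?_ ?_ (by omega) (by omega) ?_)
    · rw [update_of_ne hne]
      omega
    · rw [update_of_ne hne]
      omega
    · simp only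
      omega
  have htot : totalSum C (update (update G (j, c) 3) (a, b) 4) = totalSum C G - 2 := by
    rw [totalSum_update huC, totalSum_update hm.mem, update_of_ne hne, hx, hgu]
    simp [sgn]
    ring
  have hback : G = update (update (update (update G (j, c) 3) (a, b) 4) (a, b) 3) (j, c) 2 :=
    eq_update_update hx hgu
  have hlow : LowerRel G (j, c) (update (update G (j, c) 3) (a, b) 4) :=
    .head hx hz hjc hy (a, b) ⟨hp, hend⟩ hd hgu rfl
  generalize update (update G (j, c) 3) (a, b) 4 = G' at *
  have hpath : ∀ v, ReflTransGen (StepNW (IsTwo G)) (j + 1, c) v →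
      ReflTransGen (StepNW (IsTwo G)) v (a, b) →
      ReflTransGen (StepSE (IsTwo G') (RaiseStop G')) v (j, c) := fun v hv => by
    induction hv with
    | refl =>
      intro _
      refine .single ⟨fun hst => ?_, .inl hG'x, .inr (by simp)⟩
      exact hst.2.2 (by simpa using hG'x)
    | @tail v v' hv hst ih =>
      intro hvu
      refine .head ?_ (ih (hvu.head hst))
      have i1 := HeadInv.of_path hG (by omega) hy' hv
      have i2 := HeadInv.of_path hG (by omega) hy' (hv.tail hst)
      have i3 := StepNW.path_le hvu
      have hvne : v ≠ (j, c) := fun h => by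
        have := i1.row
        rw [h] at this
        simp only at this
        omega
      have hvne' : v ≠ (a, b) := fun h => hend v' (h ▸ hst)
      have hv'ne : v' ≠ (j, c) := fun h => by
        have := i2.row
        rw [h] at this
        simp only at this
        omega
      have hgv := hG'o v hvne hvne'
      have htv : IsTwo G' v := by
        unfold IsTwo
        rw [hgv]
        exact i1.two
      have t1 := i1.two
      have t2 := i2.two
      have q1 := i1.row
      have q2 := i1.col
      have q3 := i1.le
      have q4 := i2.le
      obtain ⟨k, l⟩ := v
      unfold IsTwo at t1 t2
      rcases hst.2.2 with rfl | rfl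
      · refine ⟨fun hs' => ?_, htv, .inr (by simp)⟩
        simp only at *
        have c4 := hG.north_le k l q4
        have c5 := hG.north_ne k l q4
        refine hs'.2.2 ?_
        simp only [add_sub_cancel_right]
        omega
      · refine ⟨fun hs' => ?_, htv, .inl (by simp)⟩
        simp only at *
        -- The 2 of this column lies below the cell reached. If that cell is a 3, its south
        -- neighbour is therefore 2 or 3, and the raising walk does not stop here.
        obtain ⟨k', w1, w2, w3⟩ := hcol (l - 1) (by omega) (by omega)
        have hlt : k' < k := by
          by_contra hcon
          have := hG.col_le (k := k) (k' := k') (l := l - 1) w1 (by omega)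
          omega
        have c4 := hG.col_le (k := k') (k' := k - 1) (l := l - 1) (by omega) (by omega)
        have c5 := hG.north_le (k - 1) (l - 1) (by omega)
        have c6 := hG.north_ne (k - 1) (l - 1) (by omega)
        rw [sub_add_cancel] at c5 c6
        have c7 := hG'o (k - 1, l - 1) (by simp only [ne_eq, Prod.mk.injEq]; omega)
          (by simp only [ne_eq, Prod.mk.injEq]; omega)
        have s2 := hs'.2
        simp only at s2
        omega
  refine ⟨hvalid, LastMax.of_unmarked huC hG'u ?_ fun h d => ?_, hlow, .unmarkedPath hG'u ?_ ?_ (j, c) ?_ ?_ hback,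
    hsim, htot⟩
  · rw [hP, hP1]
    split_ifs <;> omega
  · rw [hP]
    have := hm.le h d
    have := hm.before_unmarked hx h d
    split_ifs <;> omega
  · intro _
    simp only
    unfold IsTwo at hW'
    rw [hG'o (a, b - 1) (by simp only [ne_eq, Prod.mk.injEq]; omega) (by simp)]
    omega
  · simp only
    by_cases hbc : b = c
    · subst hbc
      by_cases haj : a - 1 = j
      · rw [haj, hG'x]
        omega
      · rw [hG'o (a - 1, b) (by simp only [ne_eq, Prod.mk.injEq]; omega) (by simp)]
        have := hG.col_le (k := j) (k' := a - 1) (l := b) (by omega) (by omega)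
        omega
    · obtain ⟨k', w1, w2, w3⟩ := hcol b le_rfl (by omega)
      have hlt : k' < a := by
        by_contra hcon
        have := hG.col_le (k := a) (k' := k') (l := b) w1 (by omega)
        omega
      rw [hG'o (a - 1, b) (by simp only [ne_eq, Prod.mk.injEq]; omega) (by simp)]
      have := hG.col_le (k := k') (k' := a - 1) (l := b) (by omega) (by omega)
      omega
  · exact hpath _ hp .refl
  · refine ⟨hG'x, ?_, ?_⟩ <;> simp only <;>
    rw [hG'o (j - 1, c) (by simp) (by simp only [ne_eq, Prod.mk.injEq]; omega)] <;> omega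

/-- The entry of x moves from row j to column c, so the sums fall by one in between and by two
afterwards. Surjectivity gives a one of every content from 0 to c - j - 1; therefore the ribbon of
ones to the west of x also reaches the diagonal, and raising is in its diagonal case. -/
theorem FirstMax.isLowering_headDiag (hG : Valid G) (hs : Supported C G) {j c m : ℤ}
    (hm : FirstMax C G (j, c) m) (hx : G (j, c) = 2) (hz : G (j, c + 1) ≠ 3)
    (hjc : j + 1 ≤ c) (hy : G (j + 1, c) ≤ 4) {u : ℤ × ℤ} (hu : IsHead (IsTwo G) (j + 1, c) u)
    (hd : u.1 = u.2) :
    IsLowering C G (j, c) m (update G (j, c) 3) (j, c) := by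
  obtain ⟨a, b⟩ := u
  simp only at hd
  subst hd
  obtain ⟨hp, hend⟩ := hu
  have n1 := hG.north_le j c (by omega)
  have n2 := hG.north_ne j c (by omega)
  have hy' : IsTwo G (j + 1, c) := by unfold IsTwo; omega
  have hinv := HeadInv.of_path hG (by omega) hy' hp
  obtain ⟨hP1, hsurj⟩ := hm.surj_of_head_diag hG hs (by omega) hx hinv
  have hcont : ∀ d, 0 ≤ d → d ≤ c - j - 1 →
      ∃ k l, k ≤ l ∧ j ≤ k ∧ l ≤ c ∧ l - k = d ∧ IsOne G (k, l) := fun d hd hd' => by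
    obtain ⟨k, l, e1, e2, e3, e4, e5⟩ := hinv.content d (by simpa using hd) hd'
    rw [← e4]
    refine (hsurj k l e1 e5 ?_).2
    rcases e5 with e5 | e5
    · rw [within_marked (.inr e5)]
      simp only
      omega
    · rw [within_unmarked (.inr e5)]
      simp only
      omega
  have hz' := hm.east_ne_two hs (by omega) hx
  have r1 := hG.east_le j c (by omega)
  have r3 := hG.row_le (k := j) (l := c - 1) (l' := c) (by omega) (by omega)
  have c1 := hG.north_le (j - 1) c (by omega)
  have c2 := hG.north_ne (j - 1) c (by omega)
  rw [sub_add_cancel] at c1 c2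
  have hP : ∀ h d, partialSum C (update G (j, c) 3) h d = partialSum C G h d
      - (if -j < h ∨ -j = h ∧ c - j < d then 1 else 0)
      + (if -c < h ∨ -c = h ∧ j - c < d then -1 else 0) := fun h d => by
    rw [partialSum_update hm.mem, hx, contrib_unmarked (.inl rfl), contrib_marked (.inr rfl)]
    norm_num
  have hW : IsOne G (j, c - 1) := by
    obtain ⟨k, l, e1, e2, e3, e4, e5⟩ := hcont (c - j - 1) (by omega) le_rfl
    by_cases hkj : k = j
    · subst hkj
      obtain rfl : l = c - 1 := by omega
      exact e5
    · obtain rfl : k = j + 1 := by omega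
      obtain rfl : l = c := by omega
      unfold IsOne at e5
      omega
  have hG'W : update G (j, c) 3 (j, c - 1) = G (j, c - 1) := update_of_ne (by simp) _ _
  obtain ⟨v, hv⟩ := exists_isHead (IsOne (update G (j, c) 3)) (j, c - 1) (by simp; omega)
  have hdiag : v.1 = v.2 := by
    have hinv' : ∀ w, ReflTransGen (StepNW (IsOne (update G (j, c) 3))) (j, c - 1) w →
        w.1 ≤ w.2 ∧ IsOne (update G (j, c) 3) w := fun w hw => by
      cases hw with
      | refl =>
        refine ⟨by simp; omega, ?_⟩
        unfold IsOne
        rw [hG'W]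
        exact hW
      | tail _ hst => exact ⟨hst.2.1, hst.1⟩
    obtain ⟨q1, q2⟩ := hinv' v hv.1
    obtain ⟨q3, q4⟩ := StepNW.path_le hv.1
    have hend' := hv.2
    obtain ⟨k, l⟩ := v
    simp only at q1 q3 q4 ⊢
    by_contra hcon
    -- If the ribbon ended off the diagonal, there would be a one of the next smaller content. By
    -- monotonicity it makes the north or the west neighbour of the end a one.
    obtain ⟨k', l', e1, e2, e3, e4, e5⟩ := hcont (l - k - 1) (by omega) (by omega)
    have hnex : ∀ p q : ℤ, q < c → ((p, q) : ℤ × ℤ) ≠ (j, c) := fun p q h => by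
      simp only [ne_eq, Prod.mk.injEq]
      omega
    unfold IsOne at q2 e5
    rw [update_of_ne (hnex _ _ (by omega))] at q2
    rcases le_or_gt (k + 1) k' with hk | hk
    · refine hend' (k + 1, l) ⟨?_, by simp only; omega, .inl rfl⟩
      unfold IsOne
      rw [update_of_ne (hnex _ _ (by omega))]
      have := hG.mono (k := k + 1) (l := l) (k' := k') (l' := l') (by omega) hk (by omega) e1
      have := hG.north_le k l (by omega)
      omega
    · refine hend' (k, l - 1) ⟨?_, by simp only; omega, .inr rfl⟩
      unfold IsOne
      rw [update_of_ne (hnex _ _ (by omega))]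
      have := hG.mono (k := k') (l := l') (k' := k) (l' := l - 1) e1 (by omega) (by omega)
        (by omega)
      have := hG.row_le (k := k) (l := l - 1) (l' := l) (by omega) (by omega)
      omega
  refine ⟨hG.update_cell (by omega) (by omega) (by omega) (by omega) (by omega) (by omega)
    (by omega) (by omega) (by omega), LastMax.of_marked hm.mem (update_self _ _ _) ?_ fun h d => ?_,
    .headDiag hx hz hjc hy (a, a) ⟨hp, hend⟩ rfl rfl,
    .headDiag (update_self _ _ _) ?_ (by simp only; omega) ?_ v hv hdiag ?_,
    Similar.update_cell (by omega) (by omega) (by omega) (by omega) (by simp only; omega), ?_⟩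
  · rw [hP, hP1]
    split_ifs <;> omega
  · rw [hP]
    have := hm.le h d
    have := hm.before_unmarked hx h d
    split_ifs <;> omega
  · rw [update_of_ne (by simp)]
    simp only
    omega
  · simp only
    rw [hG'W]
    unfold IsOne at hW
    omega
  · rw [update_idem, ← hx, update_eq_self]
  · rw [totalSum_update hm.mem, hx]
    simp [sgn]
    ring

/-! ### Lowering a marked entry -/

theorem FirstMax.isLowering_markedSingle (hG : Valid G) (hs : Supported C G) {j c m : ℤ}
    (hjc : j ≤ c) (hm : FirstMax C G (j, c) m) (hx : G (j, c) = 1)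
    (hy : j + 1 ≤ c → G (j + 1, c) ≠ 2) (hz : 3 < G (j, c + 1)) :
    IsLowering C G (j, c) m (update G (j, c) 3) (j, c) := by
  have hy' := fun h => hm.north_ne_one hs h hx
  have n1 := hG.north_le j c
  have c1 := hG.north_le (j - 1) c (by omega)
  have r2 : j ≤ c - 1 → G (j, c - 1) ≤ G (j, c) := fun h => hG.row_le h (by omega)
  have r3 : j ≤ c - 1 → G (j, c - 1) = G (j, c) → _ := fun h => hG.row_ne h (by omega)
  rw [sub_add_cancel] at c1
  have hP : ∀ h d, partialSum C (update G (j, c) 3) h d = partialSum C G h d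
      - (if -c < h ∨ -c = h ∧ j - c < d then 1 else 0)
      + (if -c < h ∨ -c = h ∧ j - c < d then -1 else 0) := fun h d => by
    rw [partialSum_update hm.mem, hx, contrib_marked (.inl rfl), contrib_marked (.inr rfl)]
    norm_num
  refine ⟨hG.update_cell hjc (by omega) (by omega) (by omega) (by omega) (by omega) (by omega)
    (by omega) (by omega), LastMax.of_marked hm.mem (update_self _ _ _) ?_ fun h d => ?_,
    .markedSingle hx hy hz rfl, .single (update_self _ _ _) ?_ ?_ ?_,
    Similar.update_cell (by omega) (by omega) (by omega) (by omega) (by simp [hx]), ?_⟩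
  · rw [hP, hm.eq_marked hx]
    simp
  · rw [hP]
    have := hm.le h d
    have := hm.before_marked hx h d
    split_ifs <;> omega
  · rw [update_of_ne (by simp)]
    simp only
    omega
  · rw [update_of_ne (by simp)]
    intro h
    have := r2 h
    have := r3 h
    simp only
    omega
  · rw [update_idem, ← hx, update_eq_self]
  · rw [totalSum_update hm.mem, hx]
    simp [sgn]
    ring

/-- Two situations must be excluded. If the cell above x were on the diagonal, its entry would be
read right after x and exceed the maximum. If it had a 3 to its east, the walk southeast from it
would exhibit a sum of at least m before x is read. -/
theorem FirstMax.isLowering_markedNorth (hG : Valid G) (hs : Supported C G) {j c m : ℤ}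
    (hm : FirstMax C G (j, c) m) (hx : G (j, c) = 1) (hjc : j + 1 ≤ c) (hy : G (j + 1, c) = 2) :
    IsLowering C G (j, c) m (update (update G (j, c) 2) (j + 1, c) 3) (j + 1, c) := by
  have hyC : (j + 1, c) ∈ C := hs.mem _ (by simpa using hjc) (by omega) (by omega)
  have e1 := hm.eq_marked hx
  have e2 := partialSum_succ_marked hs (j := j) (c := c) (by omega) (.inl hx)
  have hjc' : j + 1 < c := by
    by_contra hcon
    obtain rfl : c = j + 1 := by omega
    have e3 := partialSum_succ_unmarked hs hjc (.inl hy)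
    have e4 := hm.le (-(j + 1)) (j + 1 - (j + 1) + 1)
    rw [show j - (j + 1) + 1 = j + 1 - (j + 1) by ring] at e2
    omega
  have hE3 : G (j + 1, c + 1) ≠ 3 := fun hE => by
    have ho : IsOne G (j + 1, c) := .inr hy
    obtain ⟨B, hB⟩ := hs.exists_content_bound
    obtain ⟨⟨a, b⟩, hp, hu⟩ := exists_stepSE_end (halt := LowerStop G) hB (j + 1, c)
      (by simpa using hjc) ho
    have hinv := PathInv.of_path hG hjc ho (.inr hE) hp
    have h1 := hinv.row
    have h2 := hinv.col
    simp only at h1 h2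
    rw [show j - c + 1 = j + 1 - c by ring] at e2
    rcases hu with hu | hu
    · have hab' : ¬ (a = j + 1 ∧ b = c) := fun ⟨e1, e2⟩ => by
        subst e1 e2
        exact hu.2.2 hE
      have hab : ¬ (a < j + 1 ∧ b = c) := fun ⟨w1, w2⟩ => by
        subst w2
        have := hG.col_ne (k := a) (k' := j + 1) (l := b) hjc w1 (by rw [hy, hu.1])
        exact this.1 hu.1
      have e3 := hinv.partialSum_le hG hs hjc ho hu.1 (by omega)
      have e4 := hm.before_marked hx (-b) (a - b) (by omega)
      omega
    · have e3 := hinv.partialSum_lt_of_end hG hs hjc ho hu (h := -c) (d := j + 1 - c)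
        (by unfold Before; omega) (by unfold Before; omega)
      have e4 := hm.before_marked hx (-(b + 1)) (a - b - 1) (by omega)
      omega
  have hE := hG.diag_one (k := j) (l := c) (k' := j + 1) (l' := c + 1) (by omega) (by omega)
    (by omega) (by omega) (by omega)
  have r1 := hG.east_le j c (by omega)
  have r2 := hG.east_ne j c (by omega)
  have r3 := hG.row_le (k := j) (l := c - 1) (l' := c) (by omega) (by omega)
  have r4 := hG.row_ne (k := j) (l := c - 1) (l' := c) (by omega) (by omega)
  have r5 := hG.row_le (k := j + 1) (l := c - 1) (l' := c) (by omega) (by omega)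
  have n1 := hG.north_le (j + 1) c (by omega)
  have n2 := hG.north_ne (j + 1) c (by omega)
  have c1 := hG.north_le (j - 1) c (by omega)
  rw [sub_add_cancel] at c1
  have hne : ((j + 1, c) : ℤ × ℤ) ≠ (j, c) := by simp
  have hP : ∀ h d, partialSum C (update (update G (j, c) 2) (j + 1, c) 3) h d = partialSum C G h d
      - (if -c < h ∨ -c = h ∧ j - c < d then 1 else 0)
      + (if -j < h ∨ -j = h ∧ c - j < d then 1 else 0)
      - (if -(j + 1) < h ∨ -(j + 1) = h ∧ c - (j + 1) < d then 1 else 0)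
      + (if -c < h ∨ -c = h ∧ j + 1 - c < d then -1 else 0) := fun h d => by
    rw [partialSum_update hyC, partialSum_update hm.mem, update_of_ne hne, hx, hy,
      contrib_marked (.inl rfl), contrib_unmarked (.inl rfl), contrib_unmarked (.inl rfl),
      contrib_marked (.inr rfl)]
    norm_num
  refine ⟨?_, LastMax.of_marked hyC (update_self _ _ _) ?_ fun h d => ?_,
    .markedNorth hx hjc hy rfl, .south (update_self _ _ _) ?_ ?_, ?_, ?_⟩
  · rw [update_comm hne.symm]
    have hG1 : Valid (update G (j + 1, c) 3) := hG.update_cell (by omega) (by omega) (by omega)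
      (by omega) (by omega) (by omega) (by omega) (by simp; omega) (by simp)
    refine hG1.update_cell (by omega) ?_ ?_ ?_ ?_ ?_ ?_ ?_ ?_ <;>
    simp only [update_apply, Prod.mk.injEq] <;> split_ifs <;> omega
  · rw [hP]
    rw [show j - c + 1 = j + 1 - c by ring] at e2
    rw [e2, e1, hx]
    split_ifs <;> omega
  · rw [hP]
    have := hm.le h d
    have := hm.before_marked hx h d
    rw [show j - c + 1 = j + 1 - c by ring] at e2
    have : h = -c → d = j + 1 - c → partialSum C G h d = m := by
      rintro rfl rfl
      rw [e2, e1, hx]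
      ring
    split_ifs <;> omega
  · simp
  · simp only [add_sub_cancel_right]
    exact eq_update_update hx hy
  · refine (Similar.update_cell (x := (j, c)) (g := 2) (by omega) (by omega) (by omega) (by omega)
      (by simp; omega)).trans (Similar.update_cell ?_ ?_ (by omega) (by omega) ?_)
    · rw [update_of_ne hne]
      omega
    · rw [update_of_ne hne]
      omega
    · simp only
      omega
  · rw [totalSum_update hyC, totalSum_update hm.mem, update_of_ne hne, hx, hy]
    simp [sgn]
    ring

/-- A walk without a stopping cell would give a sum greater than m - 1 before x. At the stopping
cell (a, b), the sum before its marked position is squeezed to m - 1. After the change the sums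
between row j and row a fall only by one; `PathInv.partialSum_lt` leaves room for that. Raising at
(a, b) follows the ribbon from its west neighbour back to x. -/
theorem FirstMax.isLowering_markedPath (hG : Valid G) (hs : Supported C G) {j c m : ℤ}
    (hjc : j ≤ c) (hm : FirstMax C G (j, c) m) (hx : G (j, c) = 1)
    (hy : j + 1 ≤ c → G (j + 1, c) ≠ 2) (hz : G (j, c + 1) ≤ 3) :
    ∃ u, IsLowering C G (j, c) m (update (update G (j, c) 2) u 3) u := by
  have hy' := fun h => hm.north_ne_one hs h hx
  have r1 := hG.east_le j c hjc
  have r2 := hG.east_ne j c hjc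
  obtain ⟨B, hB⟩ := hs.exists_content_bound
  obtain ⟨⟨a, b⟩, hp, hu⟩ := exists_stepSE_end (halt := LowerStop G) hB (j, c) hjc hm.one
  have hinv := PathInv.of_path hG hjc hm.one (by omega) hp
  have h1 := hinv.row
  have h2 := hinv.col
  simp only at h1 h2
  have e1 := hm.eq_marked hx
  have e2 := partialSum_succ_marked hs (j := j) (c := c) hjc (.inl hx)
  rcases hu with hu | hu
  swap
  · exfalso
    have e3 := hinv.partialSum_lt_of_end hG hs hjc hm.one hu (h := -c) (d := j - c)
      (by unfold Before; omega) (by unfold Before; omega)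
    have e4 := hm.before_marked hx (-(b + 1)) (a - b - 1) (by omega)
    omega
  have hgu := hu.1
  have hu2 := hu.2
  simp only at hu2
  have hbc : c < b := by
    by_contra hcon
    obtain rfl : b = c := by omega
    have := hG.col_le (k := a) (k' := j) (l := b) (by omega) (by omega)
    omega
  have hlt := fun h d => hinv.partialSum_lt hG hs hjc hm.one hu (h := h) (d := d)
  unfold Before at hlt
  have hle1 := hm.le (-a) (b - a + 1)
  -- Half-plane fillings may have marks on the diagonal, so this needs the maximum: if x were
  -- diagonal, the sum directly after x would be m, and the sum after the stopping cell would be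
  -- larger.
  have hjc' : j < c := by
    by_contra hcon
    obtain rfl : j = c := by omega
    have := hlt (-j) (j - j + 1) (by omega) (by omega)
    omega
  have hP1 : partialSum C G (-b) (a - b) = m - 1 := by
    have e3 := hinv.partialSum_le hG hs hjc hm.one hgu hbc
    have e4 := hm.before_marked hx (-b) (a - b) (by omega)
    omega
  -- The walk enters the stopping cell from the west: coming from the north it would meet two 2s in
  -- one column.
  have hrow : G (a, b - 1) = 1 ∨ G (a, b - 1) = 2 := by
    cases hp with
    | refl => omega
    | @tail w _ hw hst =>
      have i1 := (PathInv.of_path hG hjc hm.one (by omega) hw).one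
      rcases hst.2.2 with e | e
      · obtain rfl : w = (a, b - 1) := by
          simp only [Prod.mk.injEq] at e
          exact Prod.ext e.1.symm (by simp only; omega)
        exact i1
      · obtain rfl : w = (a + 1, b) := by
          simp only [Prod.mk.injEq] at e
          exact Prod.ext (by simp only; omega) e.2.symm
        have := hG.north_le a b (by omega)
        have := hG.north_ne a b (by omega)
        unfold IsOne at i1
        omega
  have huC : (a, b) ∈ C := hs.mem _ (by simp only; omega) (by omega) (by omega)
  have hne : ((a, b) : ℤ × ℤ) ≠ (j, c) := by
    simp only [ne_eq, Prod.mk.injEq]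
    omega
  have r3 := hG.row_le (k := j) (l := c - 1) (l' := c) (by omega) (by omega)
  have r4 := hG.row_ne (k := j) (l := c - 1) (l' := c) (by omega) (by omega)
  have c1 := hG.north_le (j - 1) c (by omega)
  have n1 := hG.north_le j c
  have r1' := hG.east_le a b (by omega)
  have r3' := hG.row_le (k := a) (l := b - 1) (l' := b) (by omega) (by omega)
  have n1' := hG.north_le a b (by omega)
  have n2' := hG.north_ne a b (by omega)
  have c1' := hG.north_le (a - 1) b (by omega)
  have c2' := hG.north_ne (a - 1) b (by omega)
  rw [sub_add_cancel] at c1 c1' c2'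
  have hP : ∀ h d, partialSum C (update (update G (j, c) 2) (a, b) 3) h d = partialSum C G h d
      - (if -c < h ∨ -c = h ∧ j - c < d then 1 else 0)
      + (if -j < h ∨ -j = h ∧ c - j < d then 1 else 0)
      - (if -a < h ∨ -a = h ∧ b - a < d then 1 else 0)
      + (if -b < h ∨ -b = h ∧ a - b < d then -1 else 0) := fun h d => by
    rw [partialSum_update huC, partialSum_update hm.mem, update_of_ne hne, hx, hgu,
      contrib_marked (.inl rfl), contrib_unmarked (.inl rfl), contrib_unmarked (.inl rfl),
      contrib_marked (.inr rfl)]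
    norm_num
  have hG'x : update (update G (j, c) 2) (a, b) 3 (j, c) = 2 := by
    rw [update_of_ne hne.symm, update_self]
  have hG'u : update (update G (j, c) 2) (a, b) 3 (a, b) = 3 := update_self _ _ _
  have hG'o : ∀ v, v ≠ (j, c) → v ≠ (a, b) → update (update G (j, c) 2) (a, b) 3 v = G v :=
    fun v e1 e2 => by rw [update_of_ne e2, update_of_ne e1]
  have hvalid : Valid (update (update G (j, c) 2) (a, b) 3) := by
    have hG1 : Valid (update G (j, c) 2) := hG.update_cell hjc (by omega) (by omega)
      (by omega) (by omega) (by omega) (by omega) (by omega) (by omega)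
    refine hG1.update_cell (by omega) ?_ ?_ ?_ ?_ ?_ ?_ ?_ ?_ <;>
    simp only [update_apply, Prod.mk.injEq] <;> split_ifs <;> omega
  have hsim : Similar G (update (update G (j, c) 2) (a, b) 3) := by
    refine (Similar.update_cell (x := (j, c)) (g := 2) (by omega) (by omega) (by omega) (by omega)
      (by simp; omega)).trans (Similar.update_cell ?_ ?_ (by omega) (by omega) ?_)
    · rw [update_of_ne hne]
      omega
    · rw [update_of_ne hne]
      omega
    · simp only
      omega
  have htot : totalSum C (update (update G (j, c) 2) (a, b) 3) = totalSum C G - 2 := by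
    rw [totalSum_update huC, totalSum_update hm.mem, update_of_ne hne, hx, hgu]
    simp [sgn]
    ring
  have hback : G = update (update (update (update G (j, c) 2) (a, b) 3) (a, b) 2) (j, c) 1 :=
    eq_update_update hx hgu
  have hlow : LowerRel G (j, c) (update (update G (j, c) 2) (a, b) 3) :=
    .markedPath hx hy hz (a, b) hp hu rfl
  refine ⟨(a, b), ?_⟩
  generalize update (update G (j, c) 2) (a, b) 3 = G' at *
  have hpath : ∀ v, ReflTransGen (StepSE (IsOne G) (LowerStop G)) (j, c) v →
      ReflTransGen (StepNW (IsOne G')) v (j, c) := fun v hv => by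
    induction hv with
    | refl => exact .refl
    | @tail v v' hv hst ih =>
      refine .head ?_ ih
      have i1 := PathInv.of_path hG hjc hm.one (by omega) hv
      have i2 := i1.row
      have i3 := i1.col
      refine ⟨?_, by omega, ?_⟩
      · by_cases hvx : v = (j, c)
        · rw [hvx]
          exact .inr hG'x
        · unfold IsOne
          rw [hG'o v hvx (fun h => hst.1 (h ▸ hu))]
          exact i1.one
      · rcases hst.2.2 with rfl | rfl
        · right
          ext <;> simp
        · left
          ext <;> simp
  have hpathW : ReflTransGen (StepNW (IsOne G')) (a, b - 1) (j, c) := by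
    cases hp with
    | refl => omega
    | @tail w _ hw hst =>
      have i1 := (PathInv.of_path hG hjc hm.one (by omega) hw).one
      have := hpath w hw
      rcases hst.2.2 with e | e
      · obtain rfl : w = (a, b - 1) := by
          simp only [Prod.mk.injEq] at e
          exact Prod.ext e.1.symm (by simp only; omega)
        exact this
      · obtain rfl : w = (a + 1, b) := by
          simp only [Prod.mk.injEq] at e
          exact Prod.ext (by simp only; omega) e.2.symm
        unfold IsOne at i1
        omega
  refine ⟨hvalid, LastMax.of_marked huC hG'u ?_ fun h d => ?_, hlow,
    .head hG'u ?_ (by simp only; omega) ?_ (j, c) ⟨hpathW, ?_⟩ (by simp only; omega) hG'x hback,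
    hsim, htot⟩
  · rw [hP, hP1]
    split_ifs <;> omega
  · rw [hP]
    have := hm.le h d
    have := hm.before_marked hx h d
    have := hlt h d
    split_ifs <;> omega
  · simp only
    by_cases he : ((a - 1, b) : ℤ × ℤ) = (j, c)
    · simp only [Prod.mk.injEq] at he
      omega
    · rw [hG'o _ he (by simp)]
      omega
  · simp only
    by_cases he : ((a, b - 1) : ℤ × ℤ) = (j, c)
    · rw [he, hG'x]
      omega
    · rw [hG'o _ he (by simp)]
      omega
  · rintro v ⟨hv1, hv2, rfl | rfl⟩
    · simp only at hv1 hv2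
      unfold IsOne at hv1
      rw [hG'o (j + 1, c) (by simp) (by simp only [ne_eq, Prod.mk.injEq]; omega)] at hv1
      have := hy hv2
      have := hy' hv2
      omega
    · simp only at hv1 hv2
      unfold IsOne at hv1
      rw [hG'o (j, c - 1) (by simp) (by simp only [ne_eq, Prod.mk.injEq]; omega)] at hv1
      omega

/-- Lowering at the first maximum is possible, and raising undoes it. -/
theorem FirstMax.exists_isLowering (hG : Valid G) (hs : Supported C G) {x : ℤ × ℤ} {m : ℤ}
    (hm : FirstMax C G x m) : ∃ G' x', IsLowering C G x m G' x' := by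
  have hjc := hs.le x hm.mem
  have ho := hm.one
  obtain ⟨j, c⟩ := x
  simp only at hjc
  rcases ho with hx | hx
  · by_cases hy : j + 1 ≤ c ∧ G (j + 1, c) = 2
    · exact ⟨_, _, hm.isLowering_markedNorth hG hs hx hy.1 hy.2⟩
    · by_cases hz : 3 < G (j, c + 1)
      · exact ⟨_, _, hm.isLowering_markedSingle hG hs hjc hx (fun h h' => hy ⟨h, h'⟩) hz⟩
      · obtain ⟨u, hu⟩ := hm.isLowering_markedPath hG hs hjc hx (fun h h' => hy ⟨h, h'⟩)
          (by omega)
        exact ⟨_, _, hu⟩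
  · by_cases hz : G (j, c + 1) = 3
    · exact ⟨_, _, hm.isLowering_east hG hs hjc hx hz⟩
    · by_cases hy : j + 1 ≤ c → 4 < G (j + 1, c)
      · exact ⟨_, _, hm.isLowering_single hG hs hjc hx hz hy⟩
      · push Not at hy
        obtain ⟨u, hu⟩ := exists_isHead (IsTwo G) (j + 1, c) hy.1
        by_cases hd : u.1 = u.2
        · exact ⟨_, _, hm.isLowering_headDiag hG hs hx hz hy.1 hy.2 hu hd⟩
        · exact ⟨_, _, hm.isLowering_head hG hs hx hz hy.1 hy.2 hu hd⟩

end TwoLetter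

end Shifted

namespace Shifted

namespace TwoLetter

open Function Relation

variable {C : Finset (ℤ × ℤ)} {G G' : ℤ × ℤ → ℤ}

/-! ### Duality

Reflection in the antidiagonal, together with a reversal of the alphabet, reverses the reading word
and exchanges lowering and raising. -/

/-- The reflection in the antidiagonal. -/
def flip (v : ℤ × ℤ) : ℤ × ℤ := (-v.2, -v.1)

@[simp] theorem flip_mk (k l : ℤ) : flip (k, l) = (-l, -k) := rfl

@[simp] theorem flip_flip (v : ℤ × ℤ) : flip (flip v) = v := by simp [flip]

theorem flip_injective : Injective flip :=
  LeftInverse.injective flip_flip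

/-- The reflected filling in the reversed alphabet. -/
def dual (G : ℤ × ℤ → ℤ) (v : ℤ × ℤ) : ℤ := 5 - G (flip v)

@[simp] theorem dual_dual (G : ℤ × ℤ → ℤ) : dual (dual G) = G := by
  funext v
  simp [dual]

theorem dual_flip (G : ℤ × ℤ → ℤ) (v : ℤ × ℤ) : dual G (flip v) = 5 - G v := by simp [dual]

theorem dual_update (G : ℤ × ℤ → ℤ) (x : ℤ × ℤ) (g : ℤ) :
    dual (update G x g) = update (dual G) (flip x) (5 - g) := by
  funext v
  by_cases h : v = flip x
  · subst h
    simp [dual]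
  · have : flip v ≠ x := fun e => h (by rw [← e, flip_flip])
    simp [dual, h, this]

/-- Rows and columns are exchanged, and so are 1 with 4 and 2 with 3: the row condition on 1 and 3
becomes the column condition on 4 and 2. -/
theorem Valid.dual (hG : Valid G) : Valid (dual G) := by
  refine ⟨fun k l h => ?_, fun k l h => ?_, fun k l h => ?_, fun k l h => ?_⟩ <;>
  simp only [TwoLetter.dual, flip_mk]
  · have := hG.north_le (-(l + 1)) (-k) (by omega)
    rw [show -(l + 1) + 1 = -l by ring] at this
    omega
  · have := hG.north_ne (-(l + 1)) (-k) (by omega)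
    rw [show -(l + 1) + 1 = -l by ring] at this
    omega
  · have := hG.east_le (-l) (-(k + 1)) (by omega)
    rw [show -(k + 1) + 1 = -k by ring] at this
    omega
  · have := hG.east_ne (-l) (-(k + 1)) (by omega)
    rw [show -(k + 1) + 1 = -k by ring] at this
    omega

theorem mem_image_flip {v : ℤ × ℤ} : v ∈ C.image flip ↔ flip v ∈ C := by
  rw [Finset.mem_image]
  constructor
  · rintro ⟨w, hw, rfl⟩
    rwa [flip_flip]
  · exact fun h => ⟨_, h, flip_flip v⟩

theorem Supported.dual (hs : Supported C G) : Supported (C.image flip) (dual G) := by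
  refine ⟨fun v hv => ?_, fun v h1 h2 h3 => ?_⟩
  · have := hs.le _ (mem_image_flip.1 hv)
    simp only [flip] at this
    omega
  · rw [mem_image_flip]
    unfold TwoLetter.dual at h2 h3
    exact hs.mem _ (by simp only [flip]; omega) (by omega) (by omega)

theorem image_image_flip (C : Finset (ℤ × ℤ)) : (C.image flip).image flip = C := by
  ext v
  rw [mem_image_flip, mem_image_flip, flip_flip]

theorem sgn_dual (g : ℤ) : sgn (5 - g) = -sgn g := by
  unfold sgn
  split_ifs <;> omega

theorem hookOf_dual {g : ℤ} (h1 : 1 ≤ g) (h2 : g ≤ 4) (v : ℤ × ℤ) :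
    hookOf (5 - g) (flip v) = -hookOf g v := by
  unfold hookOf flip
  split_ifs <;> simp only <;> omega

theorem placeOf_dual {g : ℤ} (h1 : 1 ≤ g) (h2 : g ≤ 4) (v : ℤ × ℤ) :
    placeOf (5 - g) (flip v) = -placeOf g v := by
  unfold placeOf flip
  split_ifs <;> simp only <;> omega

theorem totalSum_dual : totalSum (C.image flip) (dual G) = -totalSum C G := by
  unfold totalSum
  rw [Finset.sum_image flip_injective.injOn, ← Finset.sum_neg_distrib]
  exact Finset.sum_congr rfl fun v _ => by rw [dual_flip, sgn_dual]

/-- Positions are negated, so the dual cells read before (h, d) come from the cells read after (-h,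
-d), that is, not before (-h, -d + 1). Their signs are reversed. -/
theorem partialSum_dual (h d : ℤ) :
    partialSum (C.image flip) (dual G) h d = partialSum C G (-h) (-d + 1) - totalSum C G := by
  unfold partialSum totalSum
  rw [Finset.sum_image flip_injective.injOn, ← Finset.sum_sub_distrib]
  refine Finset.sum_congr rfl fun v _ => ?_
  rw [dual_flip]
  unfold contrib
  rw [sgn_dual]
  by_cases hg : 1 ≤ G v ∧ G v ≤ 4
  · rw [hookOf_dual hg.1 hg.2, placeOf_dual hg.1 hg.2]
    unfold Before
    split_ifs <;> omega
  · have : sgn (G v) = 0 := by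
      unfold sgn
      split_ifs <;> omega
    simp [this]

theorem LastMax.dual (hs : Supported C G) {x : ℤ × ℤ} {m : ℤ} (hm : LastMax C G x m) :
    FirstMax (C.image flip) (dual G) (flip x) (m - totalSum C G) := by
  obtain ⟨h1, h2, h3, h4, h5⟩ := hm
  have e := partialSum_succ hs h1
  have hx : 1 ≤ G x ∧ G x ≤ 4 := by unfold IsTwo at h2; omega
  have hsgn : sgn (G x) = -1 := by rcases h2 with h2 | h2 <;> simp [sgn, h2]
  refine ⟨by rwa [mem_image_flip, flip_flip], ?_, ?_, fun h d hb => ?_, fun h d => ?_⟩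
  · unfold IsOne
    unfold IsTwo at h2
    rw [dual_flip]
    omega
  · rw [dual_flip, hookOf_dual hx.1 hx.2, placeOf_dual hx.1 hx.2, partialSum_dual, neg_neg, neg_neg,
      e]
    omega
  · rw [dual_flip, hookOf_dual hx.1 hx.2, placeOf_dual hx.1 hx.2] at hb
    rw [partialSum_dual]
    have := h4 (-h) (-d + 1) (by unfold Before at *; omega)
    omega
  · rw [partialSum_dual]
    have := h5 (-h) (-d + 1)
    omega

theorem isOne_dual_flip (v : ℤ × ℤ) : IsOne (dual G) (flip v) ↔ IsTwo G v := by
  unfold IsOne IsTwo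
  rw [dual_flip]
  omega

theorem isTwo_dual_flip (v : ℤ × ℤ) : IsTwo (dual G) (flip v) ↔ IsOne G v := by
  unfold IsOne IsTwo
  rw [dual_flip]
  omega

theorem lowerStop_dual_flip (v : ℤ × ℤ) : LowerStop (dual G) (flip v) ↔ RaiseStop G v := by
  unfold LowerStop RaiseStop
  have : ((flip v).1, (flip v).2 + 1) = flip (v.1 - 1, v.2) := by
    simp only [flip, Prod.mk.injEq, true_and]
    ring
  rw [this, dual_flip, dual_flip]
  omega

theorem raiseStop_dual_flip (v : ℤ × ℤ) : RaiseStop (dual G) (flip v) ↔ LowerStop G v := by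
  unfold LowerStop RaiseStop
  have : ((flip v).1 - 1, (flip v).2) = flip (v.1, v.2 + 1) := by
    simp only [flip, Prod.mk.injEq, and_true]
    ring
  rw [this, dual_flip, dual_flip]
  omega

/-- North and west are exchanged, as are east and south, so the directions northwest and southeast
are kept. -/
theorem StepNW.flip {S S' : ℤ × ℤ → Prop} (hS : ∀ v, S v → S' (flip v)) {v v' : ℤ × ℤ}
    (h : StepNW S v v') : StepNW S' (TwoLetter.flip v) (TwoLetter.flip v') := by
  obtain ⟨h1, h2, h3⟩ := h
  refine ⟨hS _ h1, by simp only [TwoLetter.flip]; omega, ?_⟩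
  rcases h3 with rfl | rfl
  · right
    simp only [TwoLetter.flip, Prod.mk.injEq, true_and]
    ring
  · left
    simp only [TwoLetter.flip, Prod.mk.injEq, and_true]
    ring

theorem IsHead.flip {S S' : ℤ × ℤ → Prop} (hS : ∀ v, S' (flip v) ↔ S v) {v u : ℤ × ℤ}
    (h : IsHead S v u) : IsHead S' (TwoLetter.flip v) (TwoLetter.flip u) := by
  refine ⟨h.1.lift TwoLetter.flip fun _ _ => StepNW.flip fun v => (hS v).2, fun v' hv' => ?_⟩
  have := StepNW.flip (S' := S) (fun v hv => (hS _).1 (by rwa [flip_flip])) hv'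
  rw [flip_flip] at this
  exact h.2 _ this

theorem StepSE.flip {S S' halt halt' : ℤ × ℤ → Prop} (hS : ∀ v, S v → S' (flip v))
    (ht : ∀ v, halt' (flip v) → halt v) {v v' : ℤ × ℤ}
    (h : StepSE S halt v v') : StepSE S' halt' (TwoLetter.flip v) (TwoLetter.flip v') := by
  obtain ⟨h1, h2, h3⟩ := h
  refine ⟨fun h => h1 (ht _ h), hS _ h2, ?_⟩
  rcases h3 with rfl | rfl
  · right
    simp only [TwoLetter.flip, Prod.mk.injEq, and_true]
    ring
  · left
    simp only [TwoLetter.flip, Prod.mk.injEq, true_and]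
    ring

theorem dual_east (k l : ℤ) : dual G (-l, -k + 1) = 5 - G (k - 1, l) := by
  simp only [dual, flip, neg_neg]
  rw [show -(-k + 1) = k - 1 by ring]

theorem dual_north (k l : ℤ) : dual G (-l + 1, -k) = 5 - G (k, l - 1) := by
  simp only [dual, flip, neg_neg]
  rw [show -(-l + 1) = l - 1 by ring]

theorem dual_south (k l : ℤ) : dual G (-l - 1, -k) = 5 - G (k, l + 1) := by
  simp only [dual, flip, neg_neg]
  rw [show -(-l - 1) = l + 1 by ring]

theorem dual_west (k l : ℤ) : dual G (-l, -k - 1) = 5 - G (k + 1, l) := by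
  simp only [dual, flip, neg_neg]
  rw [show -(-k - 1) = k + 1 by ring]

theorem dual_mk (k l : ℤ) : dual G (-l, -k) = 5 - G (k, l) := by
  simp [dual]

/-- The constructors of the two relations correspond in their order. For the two head rules it
matters that being on the diagonal is invariant under the reflection, whereas being marked is not.
-/
theorem LowerRel.dual {x : ℤ × ℤ} (h : LowerRel G x G') :
    RaiseRel (dual G) (flip x) (dual G') := by
  obtain ⟨k, l⟩ := x
  have hnorth : flip (k + 1, l) = (-l, -k - 1) := by
    simp only [flip_mk, Prod.mk.injEq, true_and]
    ring
  have heast : flip (k, l + 1) = (-l - 1, -k) := by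
    simp only [flip_mk, Prod.mk.injEq, and_true]
    ring
  rcases h with ⟨h, hz, rfl⟩ | ⟨h, hz, hy, rfl⟩ | ⟨h, hz, hxy, hy, u, hu, hd, hgu, rfl⟩ |
    ⟨h, hz, hxy, hy, u, hu, hd, rfl⟩ | ⟨h, hxy, hy, rfl⟩ | ⟨h, hy, hz, rfl⟩ |
    ⟨h, hy, hz, u, hp, hu, rfl⟩ <;> simp only at *
  · refine .south ?_ ?_ ?_ <;> simp only [flip_mk, dual_mk, dual_south]
    · omega
    · omega
    · rw [dual_update, dual_update, heast]
      norm_num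
  · refine .single ?_ ?_ (fun hxy => ?_) ?_ <;>
    simp only [flip_mk, dual_mk, dual_south, dual_west] at *
    · omega
    · omega
    · have := hy (by omega)
      omega
    · rw [dual_update]
      norm_num
  · have := hu.flip (S' := IsOne (TwoLetter.dual G)) isOne_dual_flip
    rw [hnorth] at this
    refine .head ?_ ?_ ?_ ?_ (flip u) this ?_ ?_ ?_ <;>
    simp only [flip_mk, dual_mk, dual_south, dual_west, dual_flip] at *
    · omega
    · omega
    · omega
    · omega
    · simp only [TwoLetter.flip]
      omega
    · omega
    · rw [dual_update, dual_update]
      norm_num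
  · have := hu.flip (S' := IsOne (TwoLetter.dual G)) isOne_dual_flip
    rw [hnorth] at this
    refine .headDiag ?_ ?_ ?_ ?_ (flip u) this ?_ ?_ <;>
    simp only [flip_mk, dual_mk, dual_south, dual_west] at *
    · omega
    · omega
    · omega
    · omega
    · simp only [TwoLetter.flip]
      omega
    · rw [dual_update]
      norm_num
  · refine .unmarkedWest ?_ ?_ ?_ ?_ <;> simp only [flip_mk, dual_mk, dual_west]
    · omega
    · omega
    · omega
    · rw [dual_update, dual_update, hnorth]
      norm_num
  · refine .unmarkedSingle ?_ (fun hxy => ?_) ?_ ?_ <;>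
    simp only [flip_mk, dual_mk, dual_south, dual_west] at *
    · omega
    · have := hy (by omega)
      omega
    · omega
    · rw [dual_update]
      norm_num
  · have := hp.lift (p := StepSE (IsTwo (TwoLetter.dual G)) (RaiseStop (TwoLetter.dual G))) flip
      fun _ _ => StepSE.flip (fun v => (isTwo_dual_flip v).2) fun v => (raiseStop_dual_flip v).1
    refine .unmarkedPath ?_ (fun hxy => ?_) ?_ (flip u) this ((raiseStop_dual_flip u).2 hu) ?_ <;>
    simp only [flip_mk, dual_mk, dual_south, dual_west] at *
    · omega
    · have := hy (by omega)
      omega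
    · omega
    · rw [dual_update, dual_update]
      norm_num

theorem RaiseRel.dual {x : ℤ × ℤ} (h : RaiseRel G x G') :
    LowerRel (dual G) (flip x) (dual G') := by
  obtain ⟨k, l⟩ := x
  have hsouth : flip (k - 1, l) = (-l, -k + 1) := by
    simp only [flip_mk, Prod.mk.injEq, true_and]
    ring
  have hwest : flip (k, l - 1) = (-l + 1, -k) := by
    simp only [flip_mk, Prod.mk.injEq, and_true]
    ring
  rcases h with ⟨h, hz, rfl⟩ | ⟨h, hz, hy, rfl⟩ | ⟨h, hz, hxy, hy, u, hu, hd, hgu, rfl⟩ |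
    ⟨h, hz, hxy, hy, u, hu, hd, rfl⟩ | ⟨h, hxy, hy, rfl⟩ | ⟨h, hy, hz, rfl⟩ |
    ⟨h, hy, hz, u, hp, hu, rfl⟩ <;> simp only at *
  · refine .east ?_ ?_ ?_ <;> simp only [flip_mk, dual_mk, dual_east]
    · omega
    · omega
    · rw [dual_update, dual_update, hsouth]
      norm_num
  · refine .single ?_ ?_ (fun hxy => ?_) ?_ <;>
    simp only [flip_mk, dual_mk, dual_east, dual_north] at *
    · omega
    · omega
    · have := hy (by omega)
      omega
    · rw [dual_update]
      norm_num
  · have := hu.flip (S' := IsTwo (TwoLetter.dual G)) isTwo_dual_flip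
    rw [hwest] at this
    refine .head ?_ ?_ ?_ ?_ (flip u) this ?_ ?_ ?_ <;>
    simp only [flip_mk, dual_mk, dual_east, dual_north, dual_flip] at *
    · omega
    · omega
    · omega
    · omega
    · simp only [TwoLetter.flip]
      omega
    · omega
    · rw [dual_update, dual_update]
      norm_num
  · have := hu.flip (S' := IsTwo (TwoLetter.dual G)) isTwo_dual_flip
    rw [hwest] at this
    refine .headDiag ?_ ?_ ?_ ?_ (flip u) this ?_ ?_ <;>
    simp only [flip_mk, dual_mk, dual_east, dual_north] at *
    · omega
    · omega
    · omega
    · omega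
    · simp only [TwoLetter.flip]
      omega
    · rw [dual_update]
      norm_num
  · refine .markedNorth ?_ ?_ ?_ ?_ <;> simp only [flip_mk, dual_mk, dual_north]
    · omega
    · omega
    · omega
    · rw [dual_update, dual_update, hwest]
      norm_num
  · refine .markedSingle ?_ (fun hxy => ?_) ?_ ?_ <;>
    simp only [flip_mk, dual_mk, dual_east, dual_north] at *
    · omega
    · have := hy (by omega)
      omega
    · omega
    · rw [dual_update]
      norm_num
  · have := hp.lift (p := StepSE (IsOne (TwoLetter.dual G)) (LowerStop (TwoLetter.dual G))) flip
      fun _ _ => StepSE.flip (fun v => (isOne_dual_flip v).2) fun v => (lowerStop_dual_flip v).1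
    refine .markedPath ?_ (fun hxy => ?_) ?_ (flip u) this ((lowerStop_dual_flip u).2 hu) ?_ <;>
    simp only [flip_mk, dual_mk, dual_east, dual_north] at *
    · omega
    · have := hy (by omega)
      omega
    · omega
    · rw [dual_update, dual_update]
      norm_num

theorem Similar.dual (h : Similar G G') : Similar (dual G) (dual G') := fun v => by
  have hv := h (flip v)
  simp only [flip] at hv
  simp only [TwoLetter.dual, flip]
  omega

theorem Supported.similar (hs : Supported C G) (h : Similar G G') : Supported C G' := by
  refine ⟨hs.le, fun v h1 h2 h3 => hs.mem v h1 ?_ ?_⟩ <;> have := h v <;> omega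

/-- Raising at `x` turns `G` into `G'`, and lowering at `x'` turns `G'` into `G`. -/
structure IsRaising (C : Finset (ℤ × ℤ)) (G : ℤ × ℤ → ℤ) (x : ℤ × ℤ) (m : ℤ) (G' : ℤ × ℤ → ℤ)
    (x' : ℤ × ℤ) : Prop where
  valid : Valid G'
  firstMax : FirstMax C G' x' (m + 1)
  raise : RaiseRel G x G'
  lower : LowerRel G' x' G
  similar : Similar G G'
  total : totalSum C G' = totalSum C G + 2

/-- Raising at the last maximum is possible, and lowering undoes it. -/
theorem LastMax.exists_isRaising (hG : Valid G) (hs : Supported C G) {x : ℤ × ℤ} {m : ℤ}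
    (hm : LastMax C G x m) : ∃ G' x', IsRaising C G x m G' x' := by
  obtain ⟨H, y, h⟩ := (hm.dual hs).exists_isLowering hG.dual hs.dual
  have hsH := hs.dual.similar h.similar
  have ht := h.total
  rw [totalSum_dual] at ht
  have hr := h.lower.dual
  have hl := h.raise.dual
  have hsim := h.similar.dual
  have hf := h.lastMax.dual hsH
  rw [image_image_flip] at hf
  rw [dual_dual, flip_flip] at hr
  rw [dual_dual] at hl hsim
  have ht' : totalSum C (TwoLetter.dual H) = totalSum C G + 2 := by
    have := totalSum_dual (C := C.image flip) (G := H)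
    rw [image_image_flip] at this
    omega
  refine ⟨TwoLetter.dual H, flip y, h.valid.dual, ?_, hr, hl, hsim, ht'⟩
  convert hf using 1
  omega

end TwoLetter

end Shifted

namespace Shifted

/-! ## Partial sums of words -/

section Words

variable {i : ℕ} {w : List ℕ}

@[simp] theorem prefixDiff_zero (i : ℕ) (w : List ℕ) : prefixDiff i w 0 = 0 := by
  simp [prefixDiff]

theorem prefixDiff_succ (i : ℕ) (w : List ℕ) (p : ℕ) :
    prefixDiff i w (p + 1) = prefixDiff i w p
      + (if w[p]? = some i then 1 else if w[p]? = some (i + 1) then -1 else 0) := by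
  unfold prefixDiff
  rw [List.take_add_one]
  rcases h : w[p]? with _ | a
  · simp
  · simp only [Option.toList_some, List.count_append, List.count_singleton, Option.some.injEq,
      beq_iff_eq]
    push_cast
    split_ifs <;> omega

theorem prefixDiff_of_length_le {p : ℕ} (h : w.length ≤ p) :
    prefixDiff i w p = prefixDiff i w w.length := by
  unfold prefixDiff
  rw [List.take_of_length_le h, List.take_length]

theorem prefixDiff_le_maxDiff (i : ℕ) (w : List ℕ) (p : ℕ) : prefixDiff i w p ≤ maxDiff i w := by
  rcases le_or_gt p w.length with h | h
  · exact Finset.le_sup' (prefixDiff i w) (Finset.mem_range.2 (by omega))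
  · rw [prefixDiff_of_length_le h.le]
    exact Finset.le_sup' (prefixDiff i w) (Finset.mem_range.2 (by omega))

theorem exists_prefixDiff_eq_maxDiff (i : ℕ) (w : List ℕ) :
    ∃ p ≤ w.length, prefixDiff i w p = maxDiff i w := by
  obtain ⟨p, hp, h⟩ := Finset.exists_mem_eq_sup' (s := Finset.range (w.length + 1)) ⟨0, by simp⟩
    (prefixDiff i w)
  exact ⟨p, by simpa [Nat.lt_succ_iff] using hp, h.symm⟩

theorem maxDiff_nonneg (i : ℕ) (w : List ℕ) : 0 ≤ maxDiff i w := by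
  simpa using prefixDiff_le_maxDiff i w 0

theorem maxDiff_eq {m : ℤ} {p : ℕ} (hp : prefixDiff i w p = m) (h : ∀ q, prefixDiff i w q ≤ m) :
    maxDiff i w = m := by
  obtain ⟨q, -, hq⟩ := exists_prefixDiff_eq_maxDiff i w
  have := prefixDiff_le_maxDiff i w p
  have := h q
  omega

/-- Think of the prefix difference as a height: i+1 steps down, i steps up, and a pair is a descent
with its first return. One direction jumps over inner pairs; the other finds the partner of an inner
i+1 as its first return and that of an inner i as the last descent from the height it returns to. -/
theorem isPaired_iff {a b : ℕ} : IsPaired i w a b ↔ a < b ∧ w[a]? = some (i + 1) ∧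
    w[b]? = some i ∧ prefixDiff i w (b + 1) = prefixDiff i w a ∧
    ∀ c, a < c → c ≤ b → prefixDiff i w c < prefixDiff i w a := by
  constructor
  · intro h
    induction h with
    | intro a b hab ha hb g hg hup hlow ihup ihlow =>
      have sa := prefixDiff_succ i w a
      have sb := prefixDiff_succ i w b
      simp only [ha, hb] at sa sb
      simp at sa sb
      -- If the letter just before is an i, jump back to its partner, where the height is the same;
      -- otherwise the last step did not go up. The bound from the right end jumps forward in the
      -- same way.
      have hle : ∀ c, a + 1 ≤ c → c ≤ b → prefixDiff i w c ≤ prefixDiff i w (a + 1) := by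
        intro c
        induction c using Nat.strong_induction_on with
        | _ c ih =>
          intro h1 h2
          rcases eq_or_lt_of_le h1 with rfl | hlt
          · exact le_rfl
          · obtain ⟨c, rfl⟩ : ∃ c', c = c' + 1 := ⟨c - 1, by omega⟩
            by_cases hc : w[c]? = some i
            · obtain ⟨q1, q2, q3, q4, q5⟩ := ihlow c (by omega) (by omega) hc
              have := hg c (by omega) (by omega) (.inl hc)
              rw [q4]
              exact ih (g c) (by omega) (by omega) (by omega)
            · have sc := prefixDiff_succ i w c
              have := ih c (by omega) (by omega) (by omega)
              rw [if_neg hc] at sc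
              split_ifs at sc <;> omega
      have hge : ∀ n c, b - c = n → a + 1 ≤ c → c ≤ b →
          prefixDiff i w c ≤ prefixDiff i w b := by
        intro n
        induction n using Nat.strong_induction_on with
        | _ n ih =>
          intro c hn h1 h2
          rcases eq_or_lt_of_le h2 with rfl | hlt
          · exact le_rfl
          · by_cases hc : w[c]? = some (i + 1)
            · obtain ⟨q1, q2, q3, q4, q5⟩ := ihup c (by omega) (by omega) hc
              have := hg c (by omega) (by omega) (.inr hc)
              rw [← q4]
              exact ih (b - (g c + 1)) (by omega) (g c + 1) rfl (by omega) (by omega)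
            · have sc := prefixDiff_succ i w c
              have := ih (b - (c + 1)) (by omega) (c + 1) rfl (by omega) (by omega)
              rw [if_neg hc] at sc
              split_ifs at sc <;> omega
      have h1 := hle b (by omega) le_rfl
      have h2 := hge _ (a + 1) rfl le_rfl (by omega)
      refine ⟨hab, ha, hb, by omega, fun c hc hc' => ?_⟩
      have := hle c (by omega) hc'
      omega
  · suffices H : ∀ n a b, b - a = n → (a < b ∧ w[a]? = some (i + 1) ∧
        w[b]? = some i ∧ prefixDiff i w (b + 1) = prefixDiff i w a ∧
        ∀ c, a < c → c ≤ b → prefixDiff i w c < prefixDiff i w a) → IsPaired i w a b from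
      H _ a b rfl
    intro n
    induction n using Nat.strong_induction_on with
    | _ n ih =>
      rintro a b hn ⟨hab, ha, hb, heq, hlt⟩
      have sb := prefixDiff_succ i w b
      simp only [hb] at sb
      simp at sb
      have key : ∀ c, ∃ e, a < c → c < b →
          (w[c]? = some (i + 1) → c < e ∧ e < b ∧ IsPaired i w c e) ∧
          (w[c]? = some i → a < e ∧ e < c ∧ IsPaired i w e c) := by
        intro c
        by_cases hc : a < c ∧ c < b
        swap
        · exact ⟨0, fun h h' => absurd ⟨h, h'⟩ hc⟩
        obtain ⟨hac, hcb⟩ := hc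
        have hDc := hlt c hac hcb.le
        by_cases hu : w[c]? = some (i + 1)
        · have sc := prefixDiff_succ i w c
          simp only [hu] at sc
          simp at sc
          -- The return happens by position b: the height there is one below that at a, and all
          -- inner heights are lower than that at a.
          have hex : ∃ e, c < e ∧ prefixDiff i w c ≤ prefixDiff i w e := ⟨b, hcb, by omega⟩
          classical
          obtain ⟨f1, f2⟩ := Nat.find_spec hex
          have f3 : Nat.find hex ≤ b := Nat.find_min' hex ⟨hcb, by omega⟩
          have f4 : ∀ t, c < t → t < Nat.find hex → prefixDiff i w t < prefixDiff i w c :=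
            fun t h1 h2 => by
              have := Nat.find_min hex h2
              simp only [not_and, not_le] at this
              exact this h1
          generalize Nat.find hex = e at f1 f2 f3 f4
          have hne : e ≠ c + 1 := fun h => by rw [h] at f2; omega
          obtain ⟨e, rfl⟩ : ∃ e', e = e' + 1 := ⟨e - 1, by omega⟩
          have he := f4 e (by omega) (by omega)
          have se := prefixDiff_succ i w e
          have hwe : w[e]? = some i := by
            by_contra hcon
            rw [if_neg hcon] at se
            split_ifs at se <;> omega
          rw [if_pos hwe] at se
          refine ⟨e, fun _ _ => ⟨fun _ => ⟨by omega, by omega, ?_⟩, fun h => ?_⟩⟩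
          · refine ih (e - c) (by omega) c e rfl ⟨by omega, hu, hwe, by omega, fun t h1 h2 => ?_⟩
            exact f4 t h1 (by omega)
          · rw [hu] at h
            simp at h
        · by_cases hl : w[c]? = some i
          swap
          · exact ⟨0, fun _ _ => ⟨fun h => absurd h hu, fun h => absurd h hl⟩⟩
          have sc := prefixDiff_succ i w c
          rw [if_pos hl] at sc
          have hc1 := hlt (c + 1) (by omega) (by omega)
          classical
          have f1 := Nat.findGreatest_spec (P := fun t => prefixDiff i w (c + 1) ≤ prefixDiff i w t)
            hac.le hc1.le
          have f2 := Nat.le_findGreatest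
            (P := fun t => prefixDiff i w (c + 1) ≤ prefixDiff i w t) hac.le hc1.le
          have f3 := Nat.findGreatest_le
            (P := fun t => prefixDiff i w (c + 1) ≤ prefixDiff i w t) c
          have f4 : ∀ t, Nat.findGreatest
              (fun t => prefixDiff i w (c + 1) ≤ prefixDiff i w t) c < t → t ≤ c →
              prefixDiff i w t < prefixDiff i w (c + 1) := fun t h1 h2 => by
            have := Nat.findGreatest_is_greatest h1 h2
            omega
          generalize Nat.findGreatest
            (fun t => prefixDiff i w (c + 1) ≤ prefixDiff i w t) c = t at f1 f2 f3 f4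
          have htc : t ≠ c := fun h => by rw [h] at f1; omega
          have ht1 := f4 (t + 1) (by omega) (by omega)
          have st := prefixDiff_succ i w t
          have hwt : w[t]? = some (i + 1) := by
            by_contra hcon
            rw [if_neg hcon] at st
            split_ifs at st <;> omega
          simp only [hwt] at st
          simp at st
          have hta : t ≠ a := fun h => by rw [h] at st ht1; omega
          refine ⟨t, fun _ _ => ⟨fun h => absurd h hu, fun _ => ⟨by omega, by omega, ?_⟩⟩⟩
          refine ih (c - t) (by omega) t c rfl ⟨by omega, hwt, hl, by omega, fun s h1 h2 => ?_⟩
          have := f4 s h1 h2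
          omega
      choose g hg using key
      refine IsPaired.intro a b hab ha hb g (fun c h1 h2 h3 => ?_) (fun c h1 h2 h3 => ?_)
        fun c h1 h2 h3 => ?_
      · rcases h3 with h3 | h3
        · have := (hg c h1 h2).2 h3
          omega
        · have := (hg c h1 h2).1 h3
          omega
      · exact ((hg c h1 h2).1 h3).2.2
      · exact ((hg c h1 h2).2 h3).2.2

/-- A free i is a record of the height. If it is not, the last earlier position that is at least as
high carries the i+1 with which it is paired. -/
theorem isFree_lower_iff {b : ℕ} (hb : w[b]? = some i) :
    (∀ a, ¬ IsPaired i w b a ∧ ¬ IsPaired i w a b) ↔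
      ∀ t ≤ b, prefixDiff i w t < prefixDiff i w (b + 1) := by
  have sb := prefixDiff_succ i w b
  rw [if_pos hb] at sb
  constructor
  · intro h
    by_contra! hcon
    obtain ⟨a, hab, ha⟩ := hcon
    classical
    have f1 := Nat.findGreatest_spec (P := fun t => prefixDiff i w (b + 1) ≤ prefixDiff i w t)
      hab ha
    have f3 := Nat.findGreatest_le (P := fun t => prefixDiff i w (b + 1) ≤ prefixDiff i w t) b
    have f4 : ∀ t, Nat.findGreatest
        (fun t => prefixDiff i w (b + 1) ≤ prefixDiff i w t) b < t → t ≤ b →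
        prefixDiff i w t < prefixDiff i w (b + 1) := fun t h1 h2 => by
      have := Nat.findGreatest_is_greatest h1 h2
      omega
    generalize Nat.findGreatest
      (fun t => prefixDiff i w (b + 1) ≤ prefixDiff i w t) b = t at f1 f3 f4
    have htb : t ≠ b := fun h => by rw [h] at f1; omega
    have ht1 := f4 (t + 1) (by omega) (by omega)
    have st := prefixDiff_succ i w t
    have hwt : w[t]? = some (i + 1) := by
      by_contra hcon
      rw [if_neg hcon] at st
      split_ifs at st <;> omega
    simp only [hwt] at st
    simp at st
    refine (h t).2 (isPaired_iff.2 ⟨by omega, hwt, hb, by omega, fun s h1 h2 => ?_⟩)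
    have := f4 s h1 h2
    omega
  · intro h a
    constructor
    · intro hp
      have := (isPaired_iff.1 hp).2.1
      rw [hb] at this
      simp at this
    · intro hp
      obtain ⟨h1, h2, h3, h4, h5⟩ := isPaired_iff.1 hp
      have := h a h1.le
      omega

/-- A free i+1 leaves its height for good. If the height returns, the letter at the first return is
its partner. -/
theorem isFree_upper_iff {a : ℕ} (ha : w[a]? = some (i + 1)) :
    (∀ b, ¬ IsPaired i w a b ∧ ¬ IsPaired i w b a) ↔
      ∀ t, a < t → prefixDiff i w t < prefixDiff i w a := by
  have sa := prefixDiff_succ i w a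
  simp only [ha] at sa
  simp at sa
  constructor
  · intro h
    by_contra! hcon
    classical
    obtain ⟨f1, f2⟩ := Nat.find_spec hcon
    have f4 : ∀ t, a < t → t < Nat.find hcon → prefixDiff i w t < prefixDiff i w a :=
      fun t h1 h2 => by
        have := Nat.find_min hcon h2
        simp only [not_and, not_le] at this
        exact this h1
    generalize Nat.find hcon = e at f1 f2 f4
    have hne : e ≠ a + 1 := fun h => by rw [h] at f2; omega
    obtain ⟨e, rfl⟩ : ∃ e', e = e' + 1 := ⟨e - 1, by omega⟩
    have he := f4 e (by omega) (by omega)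
    have se := prefixDiff_succ i w e
    have hwe : w[e]? = some i := by
      by_contra hcon
      rw [if_neg hcon] at se
      split_ifs at se <;> omega
    rw [if_pos hwe] at se
    exact (h e).1 (isPaired_iff.2 ⟨by omega, ha, hwe, by omega, fun t h1 h2 => f4 t h1 (by omega)⟩)
  · intro h b
    constructor
    · intro hp
      obtain ⟨h1, h2, h3, h4, h5⟩ := isPaired_iff.1 hp
      have := h (b + 1) (by omega)
      omega
    · intro hp
      have := (isPaired_iff.1 hp).2.2.1
      rw [ha] at this
      simp at this

/-- Heights start at 0 and rise by at most one at a time, so every height from 1 to the maximum is a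
record exactly once. -/
theorem numFree_lower (i : ℕ) (w : List ℕ) : (numFree i w i : ℤ) = maxDiff i w := by
  have hset : {a : ℕ | w[a]? = some i ∧ ∀ b, ¬ IsPaired i w a b ∧ ¬ IsPaired i w b a}
      = {b : ℕ | w[b]? = some i ∧ ∀ t ≤ b, prefixDiff i w t < prefixDiff i w (b + 1)} := by
    ext b
    exact and_congr_right isFree_lower_iff
  unfold numFree
  rw [hset]
  have hinj : Set.InjOn (fun b => prefixDiff i w (b + 1))
      {b : ℕ | w[b]? = some i ∧ ∀ t ≤ b, prefixDiff i w t < prefixDiff i w (b + 1)} := by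
    rintro b ⟨-, hb⟩ b' ⟨-, hb'⟩ e
    simp only at e
    rcases lt_trichotomy b b' with h | h | h
    · have := hb' (b + 1) (by omega)
      omega
    · exact h
    · have := hb (b' + 1) (by omega)
      omega
  have himg : (fun b => prefixDiff i w (b + 1)) ''
      {b : ℕ | w[b]? = some i ∧ ∀ t ≤ b, prefixDiff i w t < prefixDiff i w (b + 1)}
      = (Finset.Icc 1 (maxDiff i w) : Finset ℤ) := by
    ext v
    simp only [Set.mem_image, Finset.coe_Icc, Set.mem_Icc]
    constructor
    · rintro ⟨b, ⟨-, hb⟩, rfl⟩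
      have := hb 0 (by omega)
      rw [prefixDiff_zero] at this
      exact ⟨by omega, prefixDiff_le_maxDiff _ _ _⟩
    · rintro ⟨h1, h2⟩
      obtain ⟨p, -, hp⟩ := exists_prefixDiff_eq_maxDiff i w
      have hex : ∃ p, v ≤ prefixDiff i w p := ⟨p, by omega⟩
      classical
      have f1 := Nat.find_spec hex
      have f2 : ∀ t, t < Nat.find hex → prefixDiff i w t < v := fun t ht => by
        have := Nat.find_min hex ht
        omega
      generalize Nat.find hex = e at f1 f2
      have hne : e ≠ 0 := fun h => by
        rw [h, prefixDiff_zero] at f1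
        omega
      obtain ⟨e, rfl⟩ : ∃ e', e = e' + 1 := ⟨e - 1, by omega⟩
      have se := prefixDiff_succ i w e
      have := f2 e (by omega)
      have hwe : w[e]? = some i := by
        by_contra hcon
        rw [if_neg hcon] at se
        split_ifs at se <;> omega
      rw [if_pos hwe] at se
      refine ⟨e, ⟨hwe, fun t ht => ?_⟩, by omega⟩
      have := f2 t (by omega)
      omega
  rw [← hinj.ncard_image, himg, Set.ncard_coe_finset, Int.card_Icc]
  have := maxDiff_nonneg i w
  omega

/-- Every height above the final one and up to the maximum is left for the last time exactly once,
and by an i+1. -/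
theorem numFree_upper (i : ℕ) (w : List ℕ) :
    (numFree i w (i + 1) : ℤ) = maxDiff i w - prefixDiff i w w.length := by
  have hset : {a : ℕ | w[a]? = some (i + 1) ∧ ∀ b, ¬ IsPaired i w a b ∧ ¬ IsPaired i w b a}
      = {a : ℕ | w[a]? = some (i + 1) ∧ ∀ t, a < t → prefixDiff i w t < prefixDiff i w a} := by
    ext b
    exact and_congr_right isFree_upper_iff
  unfold numFree
  rw [hset]
  have hinj : Set.InjOn (fun b => prefixDiff i w b)
      {a : ℕ | w[a]? = some (i + 1) ∧ ∀ t, a < t → prefixDiff i w t < prefixDiff i w a} := by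
    rintro b ⟨-, hb⟩ b' ⟨-, hb'⟩ e
    simp only at e
    rcases lt_trichotomy b b' with h | h | h
    · have := hb b' (by omega)
      omega
    · exact h
    · have := hb' b (by omega)
      omega
  have himg : (fun b => prefixDiff i w b) ''
      {a : ℕ | w[a]? = some (i + 1) ∧ ∀ t, a < t → prefixDiff i w t < prefixDiff i w a}
      = (Finset.Ioc (prefixDiff i w w.length) (maxDiff i w) : Finset ℤ) := by
    ext v
    simp only [Set.mem_image, Finset.coe_Ioc, Set.mem_Ioc]
    constructor
    · rintro ⟨b, ⟨hwb, hb⟩, rfl⟩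
      have hlen : b < w.length := (List.getElem?_eq_some_iff.1 hwb).1
      exact ⟨hb _ hlen, prefixDiff_le_maxDiff _ _ _⟩
    · rintro ⟨h1, h2⟩
      obtain ⟨p, hpl, hp⟩ := exists_prefixDiff_eq_maxDiff i w
      classical
      have f1 := Nat.findGreatest_spec (P := fun t => v ≤ prefixDiff i w t) hpl
        (by rw [hp]; exact h2)
      have f3 := Nat.findGreatest_le (P := fun t => v ≤ prefixDiff i w t) w.length
      have f4 : ∀ t, Nat.findGreatest (fun t => v ≤ prefixDiff i w t) w.length < t →
          t ≤ w.length → prefixDiff i w t < v := fun t h1 h2 => by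
        have := Nat.findGreatest_is_greatest h1 h2
        omega
      generalize Nat.findGreatest (fun t => v ≤ prefixDiff i w t) w.length = e at f1 f3 f4
      have hne : e ≠ w.length := fun h => by
        rw [h] at f1
        omega
      have se := prefixDiff_succ i w e
      have := f4 (e + 1) (by omega) (by omega)
      have hwe : w[e]? = some (i + 1) := by
        by_contra hcon
        rw [if_neg hcon] at se
        split_ifs at se <;> omega
      simp only [hwe] at se
      simp at se
      refine ⟨e, ⟨hwe, fun t ht => ?_⟩, by omega⟩
      rcases le_or_gt t w.length with hl | hl
      · have := f4 t ht hl
        omega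
      · rw [prefixDiff_of_length_le hl.le]
        omega
  rw [← hinj.ncard_image, himg, Set.ncard_coe_finset, Int.card_Ioc]
  have := prefixDiff_le_maxDiff i w w.length
  omega

end Words

end Shifted

namespace Shifted

open TwoLetter

/-! ## Tableaux through two adjacent letters -/

theorem Entry.le_iff {a b : Entry} :
    a ≤ b ↔ a.val < b.val ∨ a.val = b.val ∧ (a.marked = true ∨ b.marked = false) := by
  rw [Prod.Lex.le_iff]
  unfold Entry.val Entry.marked
  rcases (ofLex a).2 <;> rcases (ofLex b).2 <;> simp

theorem Entry.ext_iff' {a b : Entry} : a = b ↔ a.val = b.val ∧ a.marked = b.marked := by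
  constructor
  · rintro rfl
    exact ⟨rfl, rfl⟩
  · rintro ⟨h1, h2⟩
    unfold Entry.val at h1
    unfold Entry.marked at h2
    apply ofLex.injective
    ext1
    · exact h1
    · simpa using h2

theorem Entry.lt_iff {a b : Entry} :
    a < b ↔ a.val < b.val ∨ a.val = b.val ∧ (a.marked = true ∧ b.marked = false) := by
  rw [lt_iff_le_and_ne, Entry.le_iff, Ne, Entry.ext_iff']
  rcases a.marked <;> rcases b.marked <;> simp <;> omega

@[simp] theorem val_mk (v : ℕ) : (mk v).val = v := rfl
@[simp] theorem val_un (v : ℕ) : (un v).val = v := rfl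
@[simp] theorem marked_mk (v : ℕ) : (mk v).marked = true := rfl
@[simp] theorem marked_un (v : ℕ) : (un v).marked = false := rfl

/-- The entries `i', i, (i+1)', i+1` are coded by `1, 2, 3, 4`. -/
def code (i : ℕ) (a : Entry) : ℤ :=
  if a.val < i then 0
  else if a.val = i then (if a.marked then 1 else 2)
  else if a.val = i + 1 then (if a.marked then 3 else 4)
  else 5

theorem code_cases (i : ℕ) (a : Entry) :
    (a.val < i ∧ code i a = 0) ∨ (a.val = i ∧ a.marked = true ∧ code i a = 1) ∨
    (a.val = i ∧ a.marked = false ∧ code i a = 2) ∨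
    (a.val = i + 1 ∧ a.marked = true ∧ code i a = 3) ∨
    (a.val = i + 1 ∧ a.marked = false ∧ code i a = 4) ∨ (i + 1 < a.val ∧ code i a = 5) := by
  unfold code
  rcases lt_trichotomy a.val i with h | h | h
  · simp [h]
  · cases hm : a.marked <;> simp [h]
  · by_cases h' : a.val = i + 1
    · cases hm : a.marked <;> simp [h']
    · simp only [h.ne', h.not_gt, h', if_false]
      simp
      omega

theorem code_mono (i : ℕ) {a b : Entry} (h : a ≤ b) : code i a ≤ code i b := by
  rw [Entry.le_iff] at h
  rcases code_cases i a with h1 | h1 | h1 | h1 | h1 | h1 <;>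
  rcases code_cases i b with h2 | h2 | h2 | h2 | h2 | h2 <;>
  first
  | omega
  | (exfalso
     simp only [h1.1, h1.2.1, h2.1, h2.2.1] at h
     simp at h)

theorem le_of_code_lt {i : ℕ} {a b : Entry} (h : code i a < code i b) : a ≤ b := by
  by_contra hcon
  have := code_mono i (not_le.1 hcon).le
  omega

theorem code_eq_one {i : ℕ} {a : Entry} : code i a = 1 ↔ a = mk i := by
  rw [Entry.ext_iff', val_mk, marked_mk]
  rcases code_cases i a with h1 | h1 | h1 | h1 | h1 | h1 <;> simp [h1] <;> omega

theorem code_eq_two {i : ℕ} {a : Entry} : code i a = 2 ↔ a = un i := by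
  rw [Entry.ext_iff', val_un, marked_un]
  rcases code_cases i a with h1 | h1 | h1 | h1 | h1 | h1 <;> simp [h1] <;> omega

theorem code_eq_three {i : ℕ} {a : Entry} : code i a = 3 ↔ a = mk (i + 1) := by
  rw [Entry.ext_iff', val_mk, marked_mk]
  rcases code_cases i a with h1 | h1 | h1 | h1 | h1 | h1 <;> simp [h1] <;> omega

theorem code_eq_four {i : ℕ} {a : Entry} : code i a = 4 ↔ a = un (i + 1) := by
  rw [Entry.ext_iff', val_un, marked_un]
  rcases code_cases i a with h1 | h1 | h1 | h1 | h1 | h1 <;> simp [h1] <;> omega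

theorem code_nonneg (i : ℕ) (a : Entry) : 0 ≤ code i a := by
  rcases code_cases i a with h1 | h1 | h1 | h1 | h1 | h1 <;> omega

theorem code_le_five (i : ℕ) (a : Entry) : code i a ≤ 5 := by
  rcases code_cases i a with h1 | h1 | h1 | h1 | h1 | h1 <;> omega

/-! ### Shapes -/

theorem StrictPartition.mem_cells {γ : StrictPartition} {k l : ℕ} :
    (k, l) ∈ γ.cells ↔ 1 ≤ k ∧ k ≤ γ.length ∧ k ≤ l ∧ l < k + γ.part k := by
  unfold StrictPartition.cells
  simp only [Finset.mem_biUnion, Finset.mem_Icc, Finset.mem_image, Finset.mem_Ico, Prod.mk.injEq]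
  constructor
  · rintro ⟨k', h1, c, h2, rfl, rfl⟩
    exact ⟨h1.1, h1.2, h2.1, h2.2⟩
  · rintro ⟨h1, h2, h3, h4⟩
    exact ⟨k, ⟨h1, h2⟩, l, ⟨h3, h4⟩, rfl, rfl⟩

theorem StrictPartition.part_succ_lt (γ : StrictPartition) {k : ℕ} (hk : 1 ≤ k)
    (h : k + 1 ≤ γ.length) : γ.part (k + 1) < γ.part k := by
  unfold StrictPartition.part StrictPartition.length at *
  rw [List.getD_eq_getElem _ _ (by omega), List.getD_eq_getElem _ _ (by omega)]
  exact List.pairwise_iff_getElem.1 γ.sorted (k - 1) (k + 1 - 1) _ _ (by omega)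

theorem StrictPartition.part_add_le (γ : StrictPartition) {k k' : ℕ} (hk : 1 ≤ k) (hkk' : k ≤ k')
    (h : k' ≤ γ.length) : k' + γ.part k' ≤ k + γ.part k := by
  induction k', hkk' using Nat.le_induction with
  | base => exact le_rfl
  | succ n hn ih =>
    have := ih (by omega)
    have := γ.part_succ_lt (k := n) (by omega) h
    omega

theorem StrictPartition.mem_cells_of_row {γ : StrictPartition} {k l l' : ℕ} (h : (k, l) ∈ γ.cells)
    (h1 : k ≤ l') (h2 : l' ≤ l) : (k, l') ∈ γ.cells := by
  rw [StrictPartition.mem_cells] at *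
  omega

theorem StrictPartition.mem_cells_of_col {γ : StrictPartition} {k k' l : ℕ} (h : (k, l) ∈ γ.cells)
    (h1 : 1 ≤ k') (h2 : k' ≤ k) : (k', l) ∈ γ.cells := by
  rw [StrictPartition.mem_cells] at *
  have := γ.part_add_le h1 h2 h.2.1
  omega

/-- Row k alone has the l - k + 1 cells from the diagonal up to (k, l). This bounds the number of
steps along a ribbon by the size of the diagram. -/
theorem StrictPartition.content_lt_card {γ : StrictPartition} {k l : ℕ} (h : (k, l) ∈ γ.cells) :
    l - k < γ.cells.card := by
  have : (Finset.Icc k l).card ≤ γ.cells.card := by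
    refine Finset.card_le_card_of_injOn (fun l' => (k, l')) (fun l' hl' => ?_) fun _ _ _ _ e => ?_
    · rw [Finset.mem_coe, Finset.mem_Icc] at hl'
      exact StrictPartition.mem_cells_of_row h hl'.1 hl'.2
    · simpa using e
  rw [Nat.card_Icc] at this
  rw [StrictPartition.mem_cells] at h
  omega

/-! ### The filling on the half plane -/

/-- Cells as pairs of integers. -/
def toInt (v : ℕ × ℕ) : ℤ × ℤ := (v.1, v.2)

theorem toInt_injective : Function.Injective toInt := fun v w h => by
  simp only [toInt, Prod.mk.injEq, Nat.cast_inj] at h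
  exact Prod.ext h.1 h.2

/-- A filling through the letters `i', i, (i+1)', i+1`. -/
def twoLetter (i : ℕ) (T : Filling) (v : ℤ × ℤ) : ℤ :=
  if v.1 ≤ 0 then 0 else (T (v.1.toNat, v.2.toNat)).elim 5 (code i)

/-- The set of cells. -/
def intCells (γ : StrictPartition) : Finset (ℤ × ℤ) := γ.cells.image toInt

variable {i n : ℕ} {γ : StrictPartition} {T T' : Filling}

theorem twoLetter_of_nonpos {k l : ℤ} (h : k ≤ 0) : twoLetter i T (k, l) = 0 := by
  simp [twoLetter, h]

theorem twoLetter_natCast {k l : ℕ} (h : 1 ≤ k) :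
    twoLetter i T ((k : ℤ), (l : ℤ)) = (T (k, l)).elim 5 (code i) := by
  have : ¬ (k : ℤ) ≤ 0 := by omega
  simp [twoLetter]
  omega

theorem IsSemistandard.isSome_row (hT : IsSemistandard n γ T) {k l l' : ℕ} (h1 : k ≤ l)
    (h2 : l ≤ l') (h : (T (k, l')).isSome) : (T (k, l)).isSome := by
  rw [hT.shape] at *
  exact StrictPartition.mem_cells_of_row h h1 h2

theorem IsSemistandard.isSome_col (hT : IsSemistandard n γ T) {k k' l : ℕ} (h1 : 1 ≤ k)
    (h2 : k ≤ k') (h : (T (k', l)).isSome) : (T (k, l)).isSome := by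
  rw [hT.shape] at *
  exact StrictPartition.mem_cells_of_col h h1 h2

theorem IsSemistandard.eq_none (hT : IsSemistandard n γ T) {v : ℕ × ℕ} (h : v ∉ γ.cells) :
    T v = none := by
  rw [← hT.shape] at h
  simpa using h

/-- The conventions for missing cells fit: what is below row 1 gets 0, what is beyond the diagram to
the north or east gets 5, and neither value is subject to the conditions on repetitions. -/
theorem IsSemistandard.valid (hT : IsSemistandard n γ T) (i : ℕ) : Valid (twoLetter i T) := by
  refine ⟨fun k l h => ?_, fun k l h => ?_, fun k l h => ?_, fun k l h => ?_⟩
  · rcases le_or_gt k 0 with hk | hk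
    · rw [twoLetter_of_nonpos hk, twoLetter_of_nonpos hk]
    lift k to ℕ using hk.le
    lift l to ℕ using by omega
    have hs := hT.isSome_row (k := k) (l := l) (l' := l + 1) (by omega) (by omega)
    have hw := hT.row_weak k l (l + 1) (by omega)
    rw [show (l : ℤ) + 1 = ((l + 1 : ℕ) : ℤ) by simp, twoLetter_natCast (by omega),
      twoLetter_natCast (by omega)]
    rcases ha : T (k, l) with _ | a <;> rcases hb : T (k, l + 1) with _ | b
    · simp
    · simp [ha, hb] at hs
    · simpa using code_le_five i a
    · exact code_mono i (hw a ha b hb)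
  · rcases le_or_gt k 0 with hk | hk
    · rw [twoLetter_of_nonpos hk, twoLetter_of_nonpos hk]
      simp
    lift k to ℕ using hk.le
    lift l to ℕ using by omega
    have hw := fun v => hT.row_marked k l (l + 1) v
    rw [show (l : ℤ) + 1 = ((l + 1 : ℕ) : ℤ) by simp, twoLetter_natCast (by omega),
      twoLetter_natCast (by omega)]
    rcases ha : T (k, l) with _ | a <;> rcases hb : T (k, l + 1) with _ | b
    · simp
    · simp only [Option.elim]
      omega
    · simp only [Option.elim]
      omega
    · simp only [Option.elim]
      intro e
      refine ⟨fun e1 => ?_, fun e1 => ?_⟩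
      · rw [e1] at e
        rw [code_eq_one.1 e1] at ha
        rw [code_eq_one.1 e.symm] at hb
        have := hw _ ha hb
        omega
      · rw [e1] at e
        rw [code_eq_three.1 e1] at ha
        rw [code_eq_three.1 e.symm] at hb
        have := hw _ ha hb
        omega
  · rcases le_or_gt k 0 with hk | hk
    · rw [twoLetter_of_nonpos hk]
      unfold twoLetter
      split_ifs
      · simp
      · rcases T _ with _ | a
        · simp
        · exact code_nonneg i a
    lift k to ℕ using hk.le
    lift l to ℕ using by omega
    have hs := hT.isSome_col (k := k) (l := l) (k' := k + 1) (by omega) (by omega)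
    have hw := hT.col_weak k (k + 1) l (by omega)
    rw [show (k : ℤ) + 1 = ((k + 1 : ℕ) : ℤ) by simp, twoLetter_natCast (by omega),
      twoLetter_natCast (by omega)]
    rcases ha : T (k, l) with _ | a <;> rcases hb : T (k + 1, l) with _ | b
    · simp
    · simp [ha, hb] at hs
    · simpa using code_le_five i a
    · exact code_mono i (hw a ha b hb)
  · rcases le_or_gt k 0 with hk | hk
    · rw [twoLetter_of_nonpos hk]
      simp
    lift k to ℕ using hk.le
    lift l to ℕ using by omega
    have hw := fun v => hT.col_unmarked k (k + 1) l v
    rw [show (k : ℤ) + 1 = ((k + 1 : ℕ) : ℤ) by simp, twoLetter_natCast (by omega),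
      twoLetter_natCast (by omega)]
    rcases ha : T (k, l) with _ | a <;> rcases hb : T (k + 1, l) with _ | b
    · simp
    · simp only [Option.elim]
      omega
    · simp only [Option.elim]
      omega
    · simp only [Option.elim]
      intro e
      refine ⟨fun e1 => ?_, fun e1 => ?_⟩
      · rw [e1] at e
        rw [code_eq_two.1 e1] at ha
        rw [code_eq_two.1 e.symm] at hb
        have := hw _ ha hb
        omega
      · rw [e1] at e
        rw [code_eq_four.1 e1] at ha
        rw [code_eq_four.1 e.symm] at hb
        have := hw _ ha hb
        omega

theorem IsSemistandard.supported (hT : IsSemistandard n γ T) (i : ℕ) :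
    Supported (intCells γ) (twoLetter i T) := by
  refine ⟨fun v hv => ?_, fun v h1 h2 h3 => ?_⟩
  · obtain ⟨⟨k, l⟩, hw, rfl⟩ := Finset.mem_image.1 hv
    rw [StrictPartition.mem_cells] at hw
    simp only [toInt]
    omega
  · obtain ⟨k, l⟩ := v
    simp only at h1
    have hk : ¬ k ≤ 0 := fun h => by
      rw [twoLetter_of_nonpos h] at h2
      omega
    lift k to ℕ using by omega
    lift l to ℕ using by omega
    refine Finset.mem_image.2 ⟨(k, l), ?_, rfl⟩
    rw [twoLetter_natCast (by omega)] at h2 h3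
    rw [← hT.shape]
    rcases h : T (k, l) with _ | a
    · simp [h] at h3
    · simp

/-- The two fillings agree, except for changes of the letters `i', i, (i+1)', i+1` among
themselves. -/
def Agree (i : ℕ) (T T' : Filling) : Prop :=
  ∀ v, T v = T' v ∨ ∃ a b, T v = some a ∧ T' v = some b ∧
    (a.val = i ∨ a.val = i + 1) ∧ (b.val = i ∨ b.val = i + 1)

theorem Agree.refl (i : ℕ) (T : Filling) : Agree i T T := fun _ => .inl rfl

theorem Agree.trans {T'' : Filling} (h : Agree i T T') (h' : Agree i T' T'') : Agree i T T'' :=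
  fun v => by
    rcases h v with h | ⟨a, b, h1, h2, h3, h4⟩ <;> rcases h' v with h' | ⟨a', b', h1', h2', h3', h4'⟩
    · exact .inl (h.trans h')
    · exact .inr ⟨a', b', h.trans h1', h2', h3', h4'⟩
    · exact .inr ⟨a, b, h1, h' ▸ h2, h3, h4⟩
    · exact .inr ⟨a, b', h1, h2', h3, h4'⟩

theorem Agree.setEntry {x : ℕ × ℕ} {a b : Entry} (h : Agree i T T') (hx : T' x = some a)
    (ha : a.val = i ∨ a.val = i + 1) (hb : b.val = i ∨ b.val = i + 1) :
    Agree i T (setEntry T' x b) := h.trans fun v => by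
  unfold Shifted.setEntry
  by_cases hv : v = x
  · subst hv
    exact .inr ⟨a, b, hx, by simp, ha, hb⟩
  · exact .inl (by simp [hv])

theorem Agree.isSome_iff (h : Agree i T T') (v : ℕ × ℕ) : (T' v).isSome ↔ (T v).isSome := by
  rcases h v with h | ⟨a, b, h1, h2, -⟩
  · rw [h]
  · simp [h1, h2]

/-- Fillings that agree are equal if they look the same through the two letters. -/
theorem Agree.eq_of_twoLetter_eq (hT : IsSemistandard n γ T) (h : Agree i T T')
    (e : twoLetter i T = twoLetter i T') : T = T' := by
  funext ⟨k, l⟩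
  rcases h (k, l) with h | ⟨a, b, h1, h2, h3, h4⟩
  · exact h
  · have hmem : (k, l) ∈ γ.cells := by rw [← hT.shape, h1]; rfl
    have hk : 1 ≤ k := (StrictPartition.mem_cells.1 hmem).1
    have e' := congrFun e ((k : ℤ), (l : ℤ))
    rw [twoLetter_natCast hk, twoLetter_natCast hk, h1, h2] at e'
    simp only [Option.elim] at e'
    rw [h1, h2, Option.some.injEq, Entry.ext_iff']
    rcases code_cases i a with c1 | c1 | c1 | c1 | c1 | c1 <;>
    rcases code_cases i b with c2 | c2 | c2 | c2 | c2 | c2 <;>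
    first
    | omega
    | exact ⟨by omega, by rw [c1.2.1, c2.2.1]⟩

/-- Different codes decide the order of two entries. Equal codes in 1, 2, 3, 4 mean equal entries;
with equal codes 0 or 5 both entries are unchanged, and the order is inherited from `T`. The
diagonal stays unmarked because `Similar` preserves the parity of its codes. -/
theorem Agree.isSemistandard (hT : IsSemistandard n γ T) (h : Agree i T T') (hi : 1 ≤ i)
    (hin : i + 1 ≤ n) (hv : Valid (twoLetter i T')) (hs : TwoLetter.Similar (twoLetter i T) (twoLetter i T')) :
    IsSemistandard n γ T' := by
  have hshape : ∀ c, (T' c).isSome ↔ c ∈ γ.cells := fun c => by rw [h.isSome_iff, hT.shape]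
  have hmem : ∀ {k l : ℕ} {a : Entry}, T' (k, l) = some a → (k, l) ∈ γ.cells := fun {k l a} ha => by
    rw [← hshape, ha]
    rfl
  have hrow : ∀ {k l : ℕ} {a : Entry}, T' (k, l) = some a → 1 ≤ k ∧ k ≤ l := fun {k l a} ha => by
    have := StrictPartition.mem_cells.1 (hmem ha)
    exact ⟨this.1, this.2.2.1⟩
  have hcode : ∀ {k l : ℕ} {a : Entry}, T' (k, l) = some a →
      twoLetter i T' ((k : ℤ), (l : ℤ)) = code i a := fun {k l a} ha => by
    rw [twoLetter_natCast (hrow ha).1, ha]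
    rfl
  have hsame : ∀ {k l : ℕ} {a : Entry}, T' (k, l) = some a → a.val ≠ i → a.val ≠ i + 1 →
      T (k, l) = some a := fun {k l a} ha h1 h2 => by
    rcases h (k, l) with e | ⟨p, q, e1, e2, e3, e4⟩
    · rw [e, ha]
    · rw [ha, Option.some.injEq] at e2
      subst e2
      omega
  have hval : ∀ {a : Entry} {c : ℤ}, code i a = c → (1 ≤ c ∧ c ≤ 4) ∨ (a.val ≠ i ∧ a.val ≠ i + 1) :=
    fun {a c} hc => by
      rcases code_cases i a with h1 | h1 | h1 | h1 | h1 | h1 <;> omega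
  have hle : ∀ {u v : ℕ × ℕ} {a b : Entry}, T' u = some a → T' v = some b → code i a ≤ code i b →
      (∀ a ∈ T u, ∀ b ∈ T v, a ≤ b) → a ≤ b := fun {u v a b} ha hb hab hold => by
    rcases eq_or_lt_of_le hab with e | hlt
    · rcases hval e with hr | hr
      · refine le_of_eq (Entry.ext_iff'.2 ?_)
        rcases code_cases i a with c1 | c1 | c1 | c1 | c1 | c1 <;>
        rcases code_cases i b with c2 | c2 | c2 | c2 | c2 | c2 <;>
        first
        | omega
        | exact ⟨by omega, by rw [c1.2.1, c2.2.1]⟩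
      · have hr' : b.val ≠ i ∧ b.val ≠ i + 1 := by
          rcases hval (rfl : code i b = code i b) with h1 | h1
          · rcases code_cases i a with c1 | c1 | c1 | c1 | c1 | c1 <;> omega
          · exact h1
        exact hold a (hsame ha hr.1 hr.2) b (hsame hb hr'.1 hr'.2)
    · exact le_of_code_lt hlt
  refine ⟨hshape, fun c a ha => ?_, fun k c c' hc a ha b hb => ?_, fun k k' c hc a ha b hb => ?_,
    fun k c c' v ha hb => ?_, fun k k' c v ha hb => ?_, fun k v ha => ?_⟩
  · rcases h c with e | ⟨p, q, e1, e2, e3, e4⟩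
    · exact hT.range c a (by rw [e]; exact ha)
    · rw [Option.mem_def, e2, Option.some.injEq] at ha
      subst ha
      omega
  · refine hle ha hb ?_ (hT.row_weak k c c' hc)
    rw [← hcode ha, ← hcode hb]
    exact hv.row_le (by have := hrow ha; omega) (by omega)
  · refine hle ha hb ?_ (hT.col_weak k k' c hc)
    rw [← hcode ha, ← hcode hb]
    exact hv.col_le (by have := hrow hb; omega) (by omega)
  · by_contra hne
    by_cases hr : v = i ∨ v = i + 1
    · have hcv : code i (mk v) = 1 ∨ code i (mk v) = 3 := by
        rcases hr with rfl | rfl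
        · exact .inl (code_eq_one.2 rfl)
        · exact .inr (code_eq_three.2 rfl)
      have e1 := hcode ha
      have e2 := hcode hb
      have r1 := hrow ha
      have r2 := hrow hb
      rcases lt_or_gt_of_ne hne with hlt | hlt
      · have := hv.row_ne (k := k) (l := c) (l' := c') (by omega) (by omega) (by omega)
        omega
      · have := hv.row_ne (k := k) (l := c') (l' := c) (by omega) (by omega) (by omega)
        omega
    · push Not at hr
      exact hne (hT.row_marked k c c' v (hsame ha hr.1 hr.2) (hsame hb hr.1 hr.2))
  · by_contra hne
    by_cases hr : v = i ∨ v = i + 1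
    · have hcv : code i (un v) = 2 ∨ code i (un v) = 4 := by
        rcases hr with rfl | rfl
        · exact .inl (code_eq_two.2 rfl)
        · exact .inr (code_eq_four.2 rfl)
      have e1 := hcode ha
      have e2 := hcode hb
      have r1 := hrow ha
      have r2 := hrow hb
      rcases lt_or_gt_of_ne hne with hlt | hlt
      · have := hv.col_ne (k := k) (k' := k') (l := c) (by omega) (by omega) (by omega)
        omega
      · have := hv.col_ne (k := k') (k' := k) (l := c) (by omega) (by omega) (by omega)
        omega
    · push Not at hr
      exact hne (hT.col_unmarked k k' c v (hsame ha hr.1 hr.2) (hsame hb hr.1 hr.2))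
  · by_cases hr : v = i ∨ v = i + 1
    · have hcv : code i (mk v) = 1 ∨ code i (mk v) = 3 := by
        rcases hr with rfl | rfl
        · exact .inl (code_eq_one.2 rfl)
        · exact .inr (code_eq_three.2 rfl)
      have e1 := hcode ha
      have hs' := hs ((k : ℤ), (k : ℤ))
      have hk := (hrow ha).1
      simp only [forall_const] at hs'
      rw [e1, twoLetter_natCast hk] at hs'
      have hsome := (hT.shape (k, k)).2 (hmem ha)
      obtain ⟨b, hb⟩ := Option.isSome_iff_exists.1 hsome
      rw [hb] at hs'
      simp only [Option.elim] at hs'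
      have : code i b = 1 ∨ code i b = 3 := by omega
      rcases this with h' | h'
      · exact hT.diag k i (by rw [hb, code_eq_one.1 h'])
      · exact hT.diag k (i + 1) (by rw [hb, code_eq_three.1 h'])
    · push Not at hr
      exact hT.diag k v (hsame ha hr.1 hr.2)

end Shifted

namespace Shifted

open TwoLetter Relation Function

variable {i n : ℕ} {γ : StrictPartition} {T T' : Filling}

/-! ## The rules on fillings -/

theorem IsSemistandard.one_le (hT : IsSemistandard n γ T) {v : ℕ × ℕ} {a : Entry}
    (h : T v = some a) : 1 ≤ v.1 ∧ v.1 ≤ v.2 := by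
  obtain ⟨k, l⟩ := v
  have : (k, l) ∈ γ.cells := by rw [← hT.shape, h]; rfl
  have := StrictPartition.mem_cells.1 this
  exact ⟨this.1, this.2.2.1⟩

theorem twoLetter_toInt {v : ℕ × ℕ} (h : 1 ≤ v.1) :
    twoLetter i T (toInt v) = (T v).elim 5 (code i) :=
  twoLetter_natCast (k := v.1) (l := v.2) h

theorem IsSemistandard.twoLetter_eq_iff (hT : IsSemistandard n γ T) {v : ℕ × ℕ} {c : ℤ}
    (h1 : 1 ≤ c) (h2 : c ≤ 4) :
    twoLetter i T (toInt v) = c ↔ ∃ a, T v = some a ∧ code i a = c := by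
  by_cases hk : 1 ≤ v.1
  · rw [twoLetter_toInt hk]
    rcases h : T v with _ | a
    · simp only [Option.elim, reduceCtorEq, false_and, exists_false, iff_false]
      omega
    · simp
  · have hv : T v = none := hT.eq_none fun h => by
      obtain ⟨k, l⟩ := v
      exact hk (StrictPartition.mem_cells.1 h).1
    obtain ⟨k, l⟩ := v
    unfold toInt
    rw [twoLetter_of_nonpos (by simp only at hk ⊢; omega), hv]
    simp only [reduceCtorEq, false_and, exists_false, iff_false]
    omega

theorem IsSemistandard.eq_one_iff (hT : IsSemistandard n γ T) (v : ℕ × ℕ) :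
    twoLetter i T (toInt v) = 1 ↔ T v = some (Shifted.mk i) := by
  rw [hT.twoLetter_eq_iff (by omega) (by omega)]
  simp [code_eq_one]

theorem IsSemistandard.eq_two_iff (hT : IsSemistandard n γ T) (v : ℕ × ℕ) :
    twoLetter i T (toInt v) = 2 ↔ T v = some (un i) := by
  rw [hT.twoLetter_eq_iff (by omega) (by omega)]
  simp [code_eq_two]

theorem IsSemistandard.eq_three_iff (hT : IsSemistandard n γ T) (v : ℕ × ℕ) :
    twoLetter i T (toInt v) = 3 ↔ T v = some (Shifted.mk (i + 1)) := by
  rw [hT.twoLetter_eq_iff (by omega) (by omega)]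
  simp [code_eq_three]

theorem IsSemistandard.eq_four_iff (hT : IsSemistandard n γ T) (v : ℕ × ℕ) :
    twoLetter i T (toInt v) = 4 ↔ T v = some (un (i + 1)) := by
  rw [hT.twoLetter_eq_iff (by omega) (by omega)]
  simp [code_eq_four]

theorem IsSemistandard.hasVal_iff_isOne (hT : IsSemistandard n γ T) (v : ℕ × ℕ) :
    HasVal T i v ↔ IsOne (twoLetter i T) (toInt v) := by
  unfold IsOne HasVal
  rw [hT.eq_one_iff, hT.eq_two_iff]
  rcases T v with _ | a
  · simp
  · simp only [Option.map_some, Option.some.injEq, Entry.ext_iff', val_mk, marked_mk, val_un,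
      marked_un]
    cases a.marked <;> simp

theorem IsSemistandard.hasVal_iff_isTwo (hT : IsSemistandard n γ T) (v : ℕ × ℕ) :
    HasVal T (i + 1) v ↔ IsTwo (twoLetter i T) (toInt v) := by
  unfold IsTwo HasVal
  rw [hT.eq_three_iff, hT.eq_four_iff]
  rcases T v with _ | a
  · simp
  · simp only [Option.map_some, Option.some.injEq, Entry.ext_iff', val_mk, marked_mk, val_un,
      marked_un]
    cases a.marked <;> simp

theorem toInt_north (v : ℕ × ℕ) : toInt (north v) = ((toInt v).1 + 1, (toInt v).2) := by
  simp [toInt, north]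

theorem toInt_east (v : ℕ × ℕ) : toInt (east v) = ((toInt v).1, (toInt v).2 + 1) := by
  simp [toInt, east]

theorem toInt_south {v : ℕ × ℕ} (h : 1 ≤ v.1) :
    toInt (south v) = ((toInt v).1 - 1, (toInt v).2) := by
  simp [toInt, south, h]

theorem toInt_west {v : ℕ × ℕ} (h : 1 ≤ v.2) :
    toInt (west v) = ((toInt v).1, (toInt v).2 - 1) := by
  simp [toInt, west, h]

theorem twoLetter_setEntry {x : ℕ × ℕ} (h1 : 1 ≤ x.1) (h2 : 1 ≤ x.2) (a : Entry) :
    twoLetter i (setEntry T x a) = update (twoLetter i T) (toInt x) (code i a) := by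
  funext ⟨k, l⟩
  by_cases h : ((k, l) : ℤ × ℤ) = toInt x
  · rw [h, update_self, twoLetter_toInt h1, setEntry, update_self]
    rfl
  · rw [update_of_ne h]
    rcases le_or_gt k 0 with hk | hk
    · rw [twoLetter_of_nonpos hk, twoLetter_of_nonpos hk]
    · unfold twoLetter setEntry
      have hne : ((k.toNat, l.toNat) : ℕ × ℕ) ≠ x := fun e => h (by
        subst e
        simp only [toInt, Prod.mk.injEq] at *
        omega)
      simp only [update_of_ne hne]

theorem hasVal_mem (hT : IsSemistandard n γ T) {k : ℕ} {v : ℕ × ℕ} (h : HasVal T k v) :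
    v ∈ γ.cells := by
  unfold HasVal at h
  rw [← hT.shape]
  rcases hv : T v with _ | a
  · simp [hv] at h
  · rfl

theorem le_of_mem_cells {v : ℕ × ℕ} (h : v ∈ γ.cells) : 1 ≤ v.1 ∧ v.1 ≤ v.2 := by
  obtain ⟨k, l⟩ := v
  have := StrictPartition.mem_cells.1 h
  exact ⟨this.1, this.2.2.1⟩

/-- A set of cells in which the steps along a ribbon are unique. -/
structure IsRibbonLike (S : ℤ × ℤ → Prop) : Prop where
  northwest : ∀ k l, S (k, l) → k + 1 ≤ l → k ≤ l - 1 → S (k + 1, l) → S (k, l - 1) → False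
  southeast : ∀ k l, k ≤ l → S (k, l + 1) → S (k - 1, l) → False

/-! ### Ribbons of a filling and of the half plane -/

theorem _root_.Shifted.TwoLetter.Valid.isRibbonLike_one {G : ℤ × ℤ → ℤ} (hG : Valid G) :
    IsRibbonLike (IsOne G) := by
  refine ⟨fun k l h h1 h2 h3 h4 => ?_, fun k l h h1 h2 => ?_⟩
  · have r1 := hG.row_le (k := k) (l := l - 1) (l' := l) h2 (by omega)
    have r2 := hG.row_ne (k := k) (l := l - 1) (l' := l) h2 (by omega)
    have c1 := hG.north_le k l h1
    have c2 := hG.north_ne k l h1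
    unfold IsOne at *
    omega
  · unfold IsOne at *
    have := hG.diag_one (k := k - 1) (l := l) (k' := k) (l' := l + 1) (by omega) (by omega)
      (by omega) (by omega) (by omega)
    omega

theorem _root_.Shifted.TwoLetter.Valid.isRibbonLike_two {G : ℤ × ℤ → ℤ} (hG : Valid G) :
    IsRibbonLike (IsTwo G) := by
  refine ⟨fun k l h h1 h2 h3 h4 => ?_, fun k l h h1 h2 => ?_⟩
  · have r1 := hG.row_le (k := k) (l := l - 1) (l' := l) h2 (by omega)
    have r2 := hG.row_ne (k := k) (l := l - 1) (l' := l) h2 (by omega)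
    have c1 := hG.north_le k l h1
    have c2 := hG.north_ne k l h1
    unfold IsTwo at *
    omega
  · unfold IsTwo at *
    have := hG.diag_two (k := k - 1) (l := l) (k' := k) (l' := l + 1) (by omega) (by omega)
      (by omega) (by omega) (by omega)
    omega

/-- The function `stepNW` prefers north, while the relation `StepNW` allows both directions. They
agree because a ribbon does not branch. The content counts the steps. -/
theorem exists_iterate_stepNW (hT : IsSemistandard n γ T) {k : ℕ} {S : ℤ × ℤ → Prop}
    (hS : ∀ y : ℕ × ℕ, HasVal T k y ↔ S (toInt y)) (hR : IsRibbonLike S) {V : ℕ × ℕ} (hV : HasVal T k V) {u : ℤ × ℤ}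
    (h : ReflTransGen (StepNW S) (toInt V) u) :
    ∃ (m : ℕ) (U : ℕ × ℕ), toInt U = u ∧ (stepNW T k)^[m] V = U ∧ HasVal T k U ∧
      u.2 - u.1 + m = (V.2 : ℤ) - V.1 := by
  induction h with
  | refl => exact ⟨0, V, rfl, rfl, hV, by simp [toInt]⟩
  | @tail v v' _ hst ih =>
    obtain ⟨m, U, rfl, h2, h3, h4⟩ := ih
    have hle := le_of_mem_cells (hasVal_mem hT h3)
    obtain ⟨h5, h6, h7⟩ := hst
    refine ⟨m + 1, stepNW T k U, ?_, ?_, ?_⟩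
    rotate_left
    · rw [iterate_succ_apply', h2]
    all_goals
      unfold stepNW
      rcases h7 with rfl | rfl
      · rw [← toInt_north] at h5
        rw [if_pos ((hS _).2 h5)]
        first
        | exact toInt_north U
        | exact ⟨(hS _).2 h5, by push_cast; omega⟩
      · rw [← toInt_west (by omega)] at h5
        have hn : ¬ HasVal T k (north U) := fun hn => by
          have hn' := le_of_mem_cells (hasVal_mem hT hn)
          have e1 := (hS _).1 hn
          have e2 := (hS _).1 h3
          rw [toInt_north] at e1
          rw [toInt_west (by omega)] at h5
          simp only [north] at hn'
          refine hR.northwest _ _ e2 ?_ h6 e1 h5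
          omega
        rw [if_neg hn, if_pos ((hS _).2 h5)]
        first
        | exact toInt_west (by omega)
        | exact ⟨(hS _).2 h5, by push_cast; omega⟩

/-- The number of steps to the head is at most the initial content, hence less than the number of
cells; the head is a fixed point, so the remaining iterations do nothing. -/
theorem ribbonHead_eq (hT : IsSemistandard n γ T) {k : ℕ} {S : ℤ × ℤ → Prop}
    (hS : ∀ y : ℕ × ℕ, HasVal T k y ↔ S (toInt y)) (hR : IsRibbonLike S) {V : ℕ × ℕ} (hV : HasVal T k V) {u : ℤ × ℤ}
    (h : IsHead S (toInt V) u) : toInt (ribbonHead γ T k V) = u ∧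
      HasVal T k (ribbonHead γ T k V) := by
  obtain ⟨m, U, rfl, h2, h3, h4⟩ := exists_iterate_stepNW hT hS hR hV h.1
  have hU := le_of_mem_cells (hasVal_mem hT h3)
  have hVm := le_of_mem_cells (hasVal_mem hT hV)
  have hcard := StrictPartition.content_lt_card (k := V.1) (l := V.2) (hasVal_mem hT hV)
  have hfix : stepNW T k U = U := by
    unfold stepNW
    rw [if_neg, if_neg]
    · intro hw
      have hw' := le_of_mem_cells (hasVal_mem hT hw)
      have := (hS _).1 hw
      rw [toInt_west (by omega)] at this
      refine h.2 _ ⟨this, ?_, .inr rfl⟩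
      simp only [west, toInt] at hw' ⊢
      omega
    · intro hn
      have hn' := le_of_mem_cells (hasVal_mem hT hn)
      have := (hS _).1 hn
      rw [toInt_north] at this
      refine h.2 _ ⟨this, ?_, .inl rfl⟩
      simp only [north, toInt] at hn' ⊢
      omega
  have : ribbonHead γ T k V = U := by
    unfold ribbonHead
    have hm : γ.cells.card = (γ.cells.card - m) + m := by
      simp only [toInt] at h4
      omega
    rw [hm, iterate_add_apply, h2]
    exact iterate_fixed hfix _
  rw [this]
  exact ⟨rfl, h3⟩

theorem exists_iterate_stepSE (hT : IsSemistandard n γ T) {k : ℕ} {S halt : ℤ × ℤ → Prop}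
    (hS : ∀ y : ℕ × ℕ, HasVal T k y ↔ S (toInt y)) (hR : IsRibbonLike S) {V : ℕ × ℕ}
    (hV : HasVal T k V) {u : ℤ × ℤ} (h : ReflTransGen (StepSE S halt) (toInt V) u) :
    ∃ (m : ℕ) (U : ℕ × ℕ), toInt U = u ∧ (stepSE T k)^[m] V = U ∧ HasVal T k U ∧
      u.2 - u.1 = (V.2 : ℤ) - V.1 + m ∧ ∀ t < m, ¬ halt (toInt ((stepSE T k)^[t] V)) := by
  induction h with
  | refl => exact ⟨0, V, rfl, rfl, hV, by simp [toInt], by simp⟩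
  | @tail v v' _ hst ih =>
    obtain ⟨m, U, rfl, h2, h3, h4, h4'⟩ := ih
    have hle := le_of_mem_cells (hasVal_mem hT h3)
    obtain ⟨h5, h6, h7⟩ := hst
    have hnot : ∀ t < m + 1, ¬ halt (toInt ((stepSE T k)^[t] V)) := fun t ht => by
      rcases eq_or_lt_of_le (Nat.lt_succ_iff.1 ht) with rfl | hlt
      · rw [h2]
        exact h5
      · exact h4' t hlt
    refine ⟨m + 1, stepSE T k U, ?_, ?_, ?_⟩
    rotate_left
    · rw [iterate_succ_apply', h2]
    all_goals
      unfold stepSE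
      rcases h7 with rfl | rfl
      · rw [← toInt_east] at h6
        rw [if_pos ((hS _).2 h6)]
        first
        | exact toInt_east U
        | exact ⟨(hS _).2 h6, by push_cast; omega, hnot⟩
      · rw [← toInt_south hle.1] at h6
        have hn : ¬ HasVal T k (east U) := fun hn => by
          have e1 := (hS _).1 hn
          rw [toInt_east] at e1
          rw [toInt_south hle.1] at h6
          refine hR.southeast _ _ ?_ e1 h6
          simp only [toInt]
          omega
        rw [if_neg hn, if_pos ((hS _).2 h6)]
        first
        | exact toInt_south hle.1
        | exact ⟨(hS _).2 h6, by push_cast; omega, hnot⟩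

theorem find?_iterate {α : Type*} (f : α → α) (p : α → Bool) (N m : ℕ) (a : α) (hm : m < N)
    (h : p (f^[m] a) = true) (h' : ∀ t < m, p (f^[t] a) = false) :
    (List.iterate f a N).find? p = some (f^[m] a) := by
  induction N generalizing a m with
  | zero => omega
  | succ N ih =>
    rw [List.iterate, List.find?_cons]
    cases m with
    | zero =>
      simp only [iterate_zero, id_eq] at h ⊢
      rw [h]
    | succ m =>
      have h0 := h' 0 (by omega)
      simp only [iterate_zero, id_eq] at h0
      rw [h0]
      simp only [iterate_succ_apply] at h ⊢
      refine ih m (f a) (by omega) h fun t ht => ?_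
      have := h' (t + 1) (by omega)
      rwa [iterate_succ_apply] at this

/-- The number of steps to `U` is at most its content, so `U` is in the list; no earlier cell
satisfies `p`, since the relational walk would have stopped there. -/
theorem ribbonFrom_find? (hT : IsSemistandard n γ T) {k : ℕ} {S halt : ℤ × ℤ → Prop}
    (hS : ∀ y : ℕ × ℕ, HasVal T k y ↔ S (toInt y)) (hR : IsRibbonLike S) {V : ℕ × ℕ}
    (hV : HasVal T k V) {u : ℤ × ℤ} (h : ReflTransGen (StepSE S halt) (toInt V) u) (hu : halt u)
    {p : ℕ × ℕ → Bool} (hp : ∀ y, y ∈ γ.cells → (p y = true ↔ halt (toInt y)))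
    (hp' : ∀ y, p y = true → y ∈ γ.cells) :
    ∃ U : ℕ × ℕ, toInt U = u ∧ HasVal T k U ∧ (ribbonFrom γ T k V).find? p = some U := by
  obtain ⟨m, U, rfl, h2, h3, h4, h5⟩ := exists_iterate_stepSE hT hS hR hV h
  have hUm := hasVal_mem hT h3
  have hU := le_of_mem_cells hUm
  have hVm := le_of_mem_cells (hasVal_mem hT hV)
  have hcard := StrictPartition.content_lt_card (k := U.1) (l := U.2) hUm
  refine ⟨U, rfl, h3, ?_⟩
  unfold ribbonFrom
  rw [find?_iterate _ p _ m V ?_ ?_ fun t ht => ?_, h2]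
  · simp only [toInt] at h4
    omega
  · rw [h2]
    exact (hp U hUm).2 hu
  · rw [← Bool.not_eq_true]
    intro hpt
    exact h5 t ht ((hp _ (hp' _ hpt)).1 hpt)

end Shifted

namespace Shifted

open TwoLetter Relation Function

variable {i n : ℕ} {γ : StrictPartition} {T T' : Filling}

/-! ### The rules on fillings match the rules on the half plane -/

@[simp] theorem code_mk (i : ℕ) : code i (mk i) = 1 := code_eq_one.2 rfl
@[simp] theorem code_un (i : ℕ) : code i (un i) = 2 := code_eq_two.2 rfl
@[simp] theorem code_mk_succ (i : ℕ) : code i (mk (i + 1)) = 3 := code_eq_three.2 rfl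
@[simp] theorem code_un_succ (i : ℕ) : code i (un (i + 1)) = 4 := code_eq_four.2 rfl

theorem north_rule_iff (hT : IsSemistandard n γ T) {X : ℕ × ℕ} :
    (∀ y ∈ T (north X), un (i + 1) < y) ↔ ((toInt X).1 + 1 ≤ (toInt X).2 →
      4 < twoLetter i T ((toInt X).1 + 1, (toInt X).2)) := by
  rw [← toInt_north, twoLetter_toInt (v := north X) (by simp [north])]
  rcases h : T (north X) with _ | a
  · simp
  · have := hT.one_le h
    simp only [north] at this
    have h' : (toInt X).1 + 1 ≤ (toInt X).2 := by
      simp only [toInt]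
      omega
    simp only [Option.mem_def, Option.some.injEq, forall_eq', Option.elim, h', true_imp_iff,
      Entry.lt_iff, val_un, marked_un]
    rcases code_cases i a with c | c | c | c | c | c <;> (simp [c]; try omega)

theorem east_rule_iff {X : ℕ × ℕ} (hX : X ∈ γ.cells) :
    (∀ z ∈ T (east X), mk (i + 1) < z) ↔
      3 < twoLetter i T ((toInt X).1, (toInt X).2 + 1) := by
  rw [← toInt_east, twoLetter_toInt (v := east X) (by simpa [east] using (le_of_mem_cells hX).1)]
  rcases h : T (east X) with _ | a
  · simp
  · simp only [Option.mem_def, Option.some.injEq, forall_eq', Option.elim,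
      Entry.lt_iff, val_mk, marked_mk]
    rcases code_cases i a with c | c | c | c | c | c <;> (simp [c]; try omega)

/-- South of row 1 the tableau has no cell and the coded filling is 0, so both sides hold. Elsewhere
the south neighbour belongs to the diagram. -/
theorem south_rule_iff (hT : IsSemistandard n γ T) {X : ℕ × ℕ} (hX : X ∈ γ.cells) :
    (∀ y ∈ T (south X), y < un i) ↔
      twoLetter i T ((toInt X).1 - 1, (toInt X).2) < 2 := by
  obtain ⟨k, l⟩ := X
  have hk := (le_of_mem_cells hX).1
  rw [← toInt_south hk]
  simp only at hk
  rcases eq_or_lt_of_le hk with rfl | hlt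
  · have : T (south (1, l)) = none := hT.eq_none fun h => by
      have := (le_of_mem_cells h).1
      simp [south] at this
    rw [this, toInt, twoLetter_of_nonpos (by simp [south])]
    simp
  · have hmem : south (k, l) ∈ γ.cells :=
      StrictPartition.mem_cells_of_col hX (by omega) (by omega)
    rw [twoLetter_toInt (v := south (k, l)) (by simp only [south]; omega)]
    obtain ⟨a, ha⟩ := Option.isSome_iff_exists.1 ((hT.shape _).2 hmem)
    rw [ha]
    simp only [Option.mem_def, Option.some.injEq, forall_eq', Option.elim,
      Entry.lt_iff, val_un, marked_un]
    rcases code_cases i a with c | c | c | c | c | c <;> (simp [c]; try omega)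

theorem west_rule_iff (hT : IsSemistandard n γ T) {X : ℕ × ℕ} (hX : X ∈ γ.cells) :
    (∀ z ∈ T (west X), z < mk i) ↔ ((toInt X).1 ≤ (toInt X).2 - 1 →
      twoLetter i T ((toInt X).1, (toInt X).2 - 1) < 1) := by
  obtain ⟨k, l⟩ := X
  have hk := le_of_mem_cells hX
  rw [← toInt_west (by omega)]
  simp only at hk
  rw [twoLetter_toInt (v := west (k, l)) (by simp only [west]; omega)]
  rcases h : T (west (k, l)) with _ | a
  · simp only [Option.mem_def, reduceCtorEq, false_imp_iff, implies_true, true_iff]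
    intro hkl
    exfalso
    have hmem : west (k, l) ∈ γ.cells :=
      StrictPartition.mem_cells_of_row hX (by simp only [toInt] at hkl; omega) (by omega)
    rw [← hT.shape, h] at hmem
    simp at hmem
  · have := hT.one_le h
    simp only [west] at this
    have h' : (toInt (k, l)).1 ≤ (toInt (k, l)).2 - 1 := by
      simp only [toInt]
      omega
    simp only [Option.mem_def, Option.some.injEq, forall_eq', Option.elim, h', true_imp_iff,
      Entry.lt_iff, val_mk, marked_mk]
    rcases code_cases i a with c | c | c | c | c | c <;> (simp [c]; try omega)

theorem setEntry_of_ne {x y : ℕ × ℕ} (h : y ≠ x) (a : Entry) : setEntry T x a y = T y :=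
  update_of_ne h _ _

theorem Agree.setEntry_setEntry {x u : ℕ × ℕ} {p q a b : Entry} (hx : T x = some p)
    (hu : T u = some q) (hp : p.val = i ∨ p.val = i + 1) (hq : q.val = i ∨ q.val = i + 1)
    (ha : a.val = i ∨ a.val = i + 1) (hb : b.val = i ∨ b.val = i + 1) :
    Agree i T (Shifted.setEntry (Shifted.setEntry T x a) u b) := by
  have h1 := (Agree.refl i T).setEntry hx hp ha
  by_cases h : u = x
  · subst h
    exact h1.setEntry (a := a) (by simp [Shifted.setEntry]) ha hb
  · exact h1.setEntry (a := q) (by rw [setEntry_of_ne h, hu]) hq hb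

theorem twoLetter_setEntry_setEntry {x u : ℕ × ℕ} (hx : x ∈ γ.cells) (hu : u ∈ γ.cells)
    (a b : Entry) : twoLetter i (setEntry (setEntry T x a) u b)
      = update (update (twoLetter i T) (toInt x) (code i a)) (toInt u) (code i b) := by
  have h1 := le_of_mem_cells hx
  have h2 := le_of_mem_cells hu
  rw [twoLetter_setEntry h2.1 (by omega), twoLetter_setEntry h1.1 (by omega)]

theorem mem_cells_of_eq (hT : IsSemistandard n γ T) {v : ℕ × ℕ} {a : Entry} (h : T v = some a) :
    v ∈ γ.cells := by
  rw [← hT.shape, h]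
  rfl

theorem IsSemistandard.lowerStop_iff (hT : IsSemistandard n γ T) (y : ℕ × ℕ) :
    (T y = some (un i) ∧ T (east y) ≠ some (un i) ∧ T (east y) ≠ some (Shifted.mk (i + 1))) ↔
      LowerStop (twoLetter i T) (toInt y) := by
  unfold LowerStop
  rw [← toInt_east, hT.eq_two_iff, Ne, Ne, Ne, Ne, hT.eq_two_iff, hT.eq_three_iff]

theorem IsSemistandard.raiseStop_iff (hT : IsSemistandard n γ T) {y : ℕ × ℕ} (hy : y ∈ γ.cells) :
    (T y = some (Shifted.mk (i + 1)) ∧ T (south y) ≠ some (un i) ∧ T (south y) ≠ some (Shifted.mk (i + 1))) ↔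
      RaiseStop (twoLetter i T) (toInt y) := by
  unfold RaiseStop
  rw [← toInt_south (le_of_mem_cells hy).1, hT.eq_three_iff, Ne, Ne, Ne, Ne, hT.eq_two_iff,
    hT.eq_three_iff]

/-- The lowering rules for a cell. -/
def lowerAt (γ : StrictPartition) (i : ℕ) (T : Filling) (x : ℕ × ℕ) : Option Filling :=
  if T x = some (un i) then some (lowerUnmarked γ i T x)
  else if T x = some (mk i) then lowerMarked γ i T x
  else none

/-- The raising rules for a cell. -/
def raiseAt (γ : StrictPartition) (i : ℕ) (T : Filling) (x : ℕ × ℕ) : Option Filling :=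
  if T x = some (un (i + 1)) then raiseUnmarked γ i T x
  else if T x = some (Shifted.mk (i + 1)) then some (raiseMarked γ i T x)
  else none

theorem exists_lowerAt_eq (hT : IsSemistandard n γ T) {X : ℕ × ℕ} {G' : ℤ × ℤ → ℤ}
    (h : LowerRel (twoLetter i T) (toInt X) G') :
    ∃ T', lowerAt γ i T X = some T' ∧ twoLetter i T' = G' ∧ Agree i T T' := by
  have hv := hT.valid i
  rcases h with ⟨h, hz, rfl⟩ | ⟨h, hz, hy, rfl⟩ | ⟨h, hz, hxy, hy, u, hu, hd, hgu, rfl⟩ |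
    ⟨h, hz, hxy, hy, u, hu, hd, rfl⟩ | ⟨h, hxy, hy, rfl⟩ | ⟨h, hy, hz, rfl⟩ |
    ⟨h, hy, hz, u, hp, hu, rfl⟩
  · rw [hT.eq_two_iff] at h
    rw [← toInt_east, hT.eq_three_iff] at hz
    have hX := mem_cells_of_eq hT h
    refine ⟨setEntry (setEntry T X (mk (i + 1))) (east X) (un (i + 1)), ?_, ?_, ?_⟩
    · rw [lowerAt, if_pos h, lowerUnmarked, if_pos hz]
    · rw [twoLetter_setEntry_setEntry hX (mem_cells_of_eq hT hz), code_mk_succ, code_un_succ,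
        toInt_east]
    · exact Agree.setEntry_setEntry h hz (by simp) (by simp) (by simp) (by simp)
  · rw [hT.eq_two_iff] at h
    rw [← toInt_east, Ne, hT.eq_three_iff] at hz
    rw [← north_rule_iff hT] at hy
    have hX := le_of_mem_cells (mem_cells_of_eq hT h)
    refine ⟨setEntry T X (un (i + 1)), ?_, ?_, ?_⟩
    · rw [lowerAt, if_pos h, lowerUnmarked, if_neg hz, if_pos hy]
    · rw [twoLetter_setEntry hX.1 (by omega), code_un_succ]
    · exact (Agree.refl i T).setEntry h (by simp) (by simp)
  · have hn : ¬ ∀ y ∈ T (north X), un (i + 1) < y := by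
      rw [north_rule_iff hT]
      exact fun hh => absurd (hh hxy) (by omega)
    have hn1 := hv.north_le _ _ hxy
    have hn2 := hv.north_ne _ _ hxy
    have hN : IsTwo (twoLetter i T) ((toInt X).1 + 1, (toInt X).2) := by
      unfold IsTwo
      rw [Prod.mk.eta, h] at hn1 hn2
      omega
    rw [hT.eq_two_iff] at h
    rw [← toInt_east, Ne, hT.eq_three_iff] at hz
    rw [← toInt_north] at hu hN
    rw [← hT.hasVal_iff_isTwo] at hN
    obtain ⟨e1, e2⟩ := ribbonHead_eq hT hT.hasVal_iff_isTwo hv.isRibbonLike_two hN hu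
    have hX := mem_cells_of_eq hT h
    rw [← e1, hT.eq_three_iff] at hgu
    refine ⟨setEntry (setEntry T X (mk (i + 1))) (ribbonHead γ T (i + 1) (north X)) (un (i + 1)),
      ?_, ?_, ?_⟩
    · rw [lowerAt, if_pos h, lowerUnmarked, if_neg hz, if_neg hn, if_pos hgu]
    · rw [twoLetter_setEntry_setEntry hX (hasVal_mem hT e2), code_mk_succ, code_un_succ, e1]
    · exact Agree.setEntry_setEntry h hgu (by simp) (by simp) (by simp) (by simp)
  · have hn : ¬ ∀ y ∈ T (north X), un (i + 1) < y := by
      rw [north_rule_iff hT]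
      exact fun hh => absurd (hh hxy) (by omega)
    have hn1 := hv.north_le _ _ hxy
    have hn2 := hv.north_ne _ _ hxy
    have hN : IsTwo (twoLetter i T) ((toInt X).1 + 1, (toInt X).2) := by
      unfold IsTwo
      rw [Prod.mk.eta, h] at hn1 hn2
      omega
    rw [hT.eq_two_iff] at h
    rw [← toInt_east, Ne, hT.eq_three_iff] at hz
    rw [← toInt_north] at hu hN
    rw [← hT.hasVal_iff_isTwo] at hN
    obtain ⟨e1, e2⟩ := ribbonHead_eq hT hT.hasVal_iff_isTwo hv.isRibbonLike_two hN hu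
    have hX := le_of_mem_cells (mem_cells_of_eq hT h)
    -- A head on the diagonal is unmarked in a tableau, so the last rule applies.
    have hgu : T (ribbonHead γ T (i + 1) (north X)) ≠ some (mk (i + 1)) := fun hh => by
      rw [← e1] at hd
      simp only [toInt, Nat.cast_inj] at hd
      refine hT.diag (ribbonHead γ T (i + 1) (north X)).1 (i + 1) ?_
      rw [← hh]
      congr 1
      exact Prod.ext rfl hd
    refine ⟨setEntry T X (mk (i + 1)), ?_, ?_, ?_⟩
    · rw [lowerAt, if_pos h, lowerUnmarked, if_neg hz, if_neg hn, if_neg hgu]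
    · rw [twoLetter_setEntry hX.1 (by omega), code_mk_succ]
    · exact (Agree.refl i T).setEntry h (by simp) (by simp)
  · rw [hT.eq_one_iff] at h
    rw [← toInt_north, hT.eq_two_iff] at hy
    have hX := mem_cells_of_eq hT h
    refine ⟨setEntry (setEntry T X (un i)) (north X) (mk (i + 1)), ?_, ?_, ?_⟩
    · rw [lowerAt, if_neg (by rw [h]; simp [mk, un]), if_pos h, lowerMarked, if_pos hy]
    · rw [twoLetter_setEntry_setEntry hX (mem_cells_of_eq hT hy), code_mk_succ, code_un,
        toInt_north]
    · exact Agree.setEntry_setEntry h hy (by simp) (by simp) (by simp) (by simp)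
  · rw [hT.eq_one_iff] at h
    have hX := mem_cells_of_eq hT h
    have hX' := le_of_mem_cells hX
    rw [← east_rule_iff hX] at hz
    have hy' : T (north X) ≠ some (un i) := fun hh => by
      have := hT.one_le hh
      rw [← hT.eq_two_iff, toInt_north] at hh
      refine hy ?_ hh
      simp only [north] at this
      simp only [toInt]
      omega
    refine ⟨setEntry T X (mk (i + 1)), ?_, ?_, ?_⟩
    · rw [lowerAt, if_neg (by rw [h]; simp [mk, un]), if_pos h, lowerMarked, if_neg hy',
        if_pos hz]
    · rw [twoLetter_setEntry hX'.1 (by omega), code_mk_succ]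
    · exact (Agree.refl i T).setEntry h (by simp) (by simp)
  · rw [hT.eq_one_iff] at h
    have hX := mem_cells_of_eq hT h
    have hz' : ¬ ∀ z ∈ T (east X), mk (i + 1) < z := by
      rw [east_rule_iff hX]
      omega
    have hy' : T (north X) ≠ some (un i) := fun hh => by
      have := hT.one_le hh
      rw [← hT.eq_two_iff, toInt_north] at hh
      refine hy ?_ hh
      simp only [north] at this
      simp only [toInt]
      omega
    have hXv : HasVal T i X := by simp [HasVal, h]
    obtain ⟨U, rfl, hU, hf⟩ := ribbonFrom_find? hT hT.hasVal_iff_isOne hv.isRibbonLike_one hXv hp hu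
      (p := fun u => decide (T u = some (un i) ∧
        T (east u) ≠ some (un i) ∧ T (east u) ≠ some (mk (i + 1))))
      (fun y _ => by rw [decide_eq_true_iff, hT.lowerStop_iff])
      (fun y hy => mem_cells_of_eq hT (of_decide_eq_true hy).1)
    rw [← hT.lowerStop_iff] at hu
    refine ⟨setEntry (setEntry T X (un i)) U (mk (i + 1)), ?_, ?_, ?_⟩
    · rw [lowerAt, if_neg (by rw [h]; simp [mk, un]), if_pos h, lowerMarked, if_neg hy',
        if_neg hz', hf]
      rfl
    · rw [twoLetter_setEntry_setEntry hX (hasVal_mem hT hU), code_mk_succ, code_un]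
    · exact Agree.setEntry_setEntry h hu.1 (by simp) (by simp) (by simp) (by simp)

theorem exists_raiseAt_eq (hT : IsSemistandard n γ T) {X : ℕ × ℕ} {G' : ℤ × ℤ → ℤ}
    (h : RaiseRel (twoLetter i T) (toInt X) G') :
    ∃ T', raiseAt γ i T X = some T' ∧ twoLetter i T' = G' ∧ Agree i T T' := by
  have hv := hT.valid i
  have hX : X ∈ γ.cells := by
    rcases h with ⟨h, -, -⟩ | ⟨h, -, -, -⟩ | ⟨h, -, -, -, -, -, -, -, -⟩ |
      ⟨h, -, -, -, -, -, -, -⟩ | ⟨h, -, -, -⟩ | ⟨h, -, -, -⟩ | ⟨h, -, -, -, -, -, -⟩ <;>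
    first
    | exact mem_cells_of_eq hT ((hT.eq_three_iff X).1 h)
    | exact mem_cells_of_eq hT ((hT.eq_four_iff X).1 h)
  have hX' := le_of_mem_cells hX
  have hsouth := toInt_south hX'.1
  have hwest := toInt_west (v := X) (by omega)
  rcases h with ⟨h, hz, rfl⟩ | ⟨h, hz, hy, rfl⟩ | ⟨h, hz, hxy, hy, u, hu, hd, hgu, rfl⟩ |
    ⟨h, hz, hxy, hy, u, hu, hd, rfl⟩ | ⟨h, hxy, hy, rfl⟩ | ⟨h, hy, hz, rfl⟩ |
    ⟨h, hy, hz, u, hp, hu, rfl⟩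
  · rw [hT.eq_three_iff] at h
    rw [← hsouth, hT.eq_two_iff] at hz
    refine ⟨setEntry (setEntry T X (un i)) (south X) (mk i), ?_, ?_, ?_⟩
    · rw [raiseAt, if_neg (by rw [h]; simp [mk, un]), if_pos h, raiseMarked, if_pos hz]
    · rw [twoLetter_setEntry_setEntry hX (mem_cells_of_eq hT hz), code_mk, code_un, hsouth]
    · exact Agree.setEntry_setEntry h hz (by simp) (by simp) (by simp) (by simp)
  · rw [hT.eq_three_iff] at h
    rw [← hsouth, Ne, hT.eq_two_iff] at hz
    rw [← west_rule_iff hT hX] at hy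
    refine ⟨setEntry T X (mk i), ?_, ?_, ?_⟩
    · rw [raiseAt, if_neg (by rw [h]; simp [mk, un]), if_pos h, raiseMarked, if_neg hz, if_pos hy]
    · rw [twoLetter_setEntry hX'.1 (by omega), code_mk]
    · exact (Agree.refl i T).setEntry h (by simp) (by simp)
  · have hn : ¬ ∀ z ∈ T (west X), z < mk i := by
      rw [west_rule_iff hT hX]
      exact fun hh => absurd (hh hxy) (by omega)
    have hn1 := hv.row_le (k := (toInt X).1) (l := (toInt X).2 - 1) (l' := (toInt X).2) hxy
      (by omega)
    have hn2 := hv.row_ne (k := (toInt X).1) (l := (toInt X).2 - 1) (l' := (toInt X).2) hxy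
      (by omega)
    have hN : IsOne (twoLetter i T) ((toInt X).1, (toInt X).2 - 1) := by
      unfold IsOne
      rw [Prod.mk.eta, h] at hn1 hn2
      omega
    rw [hT.eq_three_iff] at h
    rw [← hsouth, Ne, hT.eq_two_iff] at hz
    rw [← hwest] at hu hN
    rw [← hT.hasVal_iff_isOne] at hN
    obtain ⟨e1, e2⟩ := ribbonHead_eq hT hT.hasVal_iff_isOne hv.isRibbonLike_one hN hu
    rw [← e1, hT.eq_two_iff] at hgu
    rw [← e1] at hd
    simp only [toInt, ne_eq, Nat.cast_inj] at hd
    refine ⟨setEntry (setEntry T X (un i)) (ribbonHead γ T i (west X)) (mk i), ?_, ?_, ?_⟩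
    · rw [raiseAt, if_neg (by rw [h]; simp [mk, un]), if_pos h, raiseMarked, if_neg hz, if_neg hn,
        if_pos hd]
    · rw [twoLetter_setEntry_setEntry hX (hasVal_mem hT e2), code_mk, code_un, e1]
    · exact Agree.setEntry_setEntry h hgu (by simp) (by simp) (by simp) (by simp)
  · have hn : ¬ ∀ z ∈ T (west X), z < mk i := by
      rw [west_rule_iff hT hX]
      exact fun hh => absurd (hh hxy) (by omega)
    have hn1 := hv.row_le (k := (toInt X).1) (l := (toInt X).2 - 1) (l' := (toInt X).2) hxy
      (by omega)
    have hn2 := hv.row_ne (k := (toInt X).1) (l := (toInt X).2 - 1) (l' := (toInt X).2) hxy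
      (by omega)
    have hN : IsOne (twoLetter i T) ((toInt X).1, (toInt X).2 - 1) := by
      unfold IsOne
      rw [Prod.mk.eta, h] at hn1 hn2
      omega
    rw [hT.eq_three_iff] at h
    rw [← hsouth, Ne, hT.eq_two_iff] at hz
    rw [← hwest] at hu hN
    rw [← hT.hasVal_iff_isOne] at hN
    obtain ⟨e1, e2⟩ := ribbonHead_eq hT hT.hasVal_iff_isOne hv.isRibbonLike_one hN hu
    rw [← e1] at hd
    simp only [toInt, Nat.cast_inj] at hd
    refine ⟨setEntry T X (un i), ?_, ?_, ?_⟩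
    · rw [raiseAt, if_neg (by rw [h]; simp [mk, un]), if_pos h, raiseMarked, if_neg hz, if_neg hn,
        if_neg (by simpa using hd)]
    · rw [twoLetter_setEntry hX'.1 (by omega), code_un]
    · exact (Agree.refl i T).setEntry h (by simp) (by simp)
  · rw [hT.eq_four_iff] at h
    rw [← hwest, hT.eq_three_iff] at hy
    refine ⟨setEntry (setEntry T X (mk (i + 1))) (west X) (un i), ?_, ?_, ?_⟩
    · rw [raiseAt, if_pos h, raiseUnmarked, if_pos hy]
    · rw [twoLetter_setEntry_setEntry hX (mem_cells_of_eq hT hy), code_mk_succ, code_un, hwest]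
    · exact Agree.setEntry_setEntry h hy (by simp) (by simp) (by simp) (by simp)
  · rw [hT.eq_four_iff] at h
    rw [← south_rule_iff hT hX] at hz
    have hy' : T (west X) ≠ some (mk (i + 1)) := fun hh => by
      have := hT.one_le hh
      rw [← hT.eq_three_iff, hwest] at hh
      refine hy ?_ hh
      simp only [west] at this
      simp only [toInt]
      omega
    refine ⟨setEntry T X (un i), ?_, ?_, ?_⟩
    · rw [raiseAt, if_pos h, raiseUnmarked, if_neg hy', if_pos hz]
    · rw [twoLetter_setEntry hX'.1 (by omega), code_un]
    · exact (Agree.refl i T).setEntry h (by simp) (by simp)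
  · rw [hT.eq_four_iff] at h
    have hz' : ¬ ∀ y ∈ T (south X), y < un i := by
      rw [south_rule_iff hT hX]
      omega
    have hy' : T (west X) ≠ some (mk (i + 1)) := fun hh => by
      have := hT.one_le hh
      rw [← hT.eq_three_iff, hwest] at hh
      refine hy ?_ hh
      simp only [west] at this
      simp only [toInt]
      omega
    have hXv : HasVal T (i + 1) X := by simp [HasVal, h]
    obtain ⟨U, rfl, hU, hf⟩ := ribbonFrom_find? hT hT.hasVal_iff_isTwo hv.isRibbonLike_two hXv hp hu
      (p := fun u => decide (T u = some (mk (i + 1)) ∧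
        T (south u) ≠ some (un i) ∧ T (south u) ≠ some (mk (i + 1))))
      (fun y hy => by rw [decide_eq_true_iff, hT.raiseStop_iff hy])
      (fun y hy => mem_cells_of_eq hT (of_decide_eq_true hy).1)
    rw [← hT.raiseStop_iff (hasVal_mem hT hU)] at hu
    refine ⟨setEntry (setEntry T X (mk (i + 1))) U (un i), ?_, ?_, ?_⟩
    · rw [raiseAt, if_pos h, raiseUnmarked, if_neg hy', if_neg hz', hf]
      rfl
    · rw [twoLetter_setEntry_setEntry hX (hasVal_mem hT hU), code_mk_succ, code_un]
    · exact Agree.setEntry_setEntry h hu.1 (by simp) (by simp) (by simp) (by simp)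

end Shifted

namespace Shifted

open TwoLetter

variable {i n : ℕ} {γ : StrictPartition} {T : Filling}

/-! ## The reading order -/

/-- The position at which a cell is read: its hook, negated, and its place on the hook. -/
def readPos (T : Filling) (v : ℕ × ℕ) : ℤ × ℤ :=
  if (T v).any Entry.marked then (-(v.2 : ℤ), (v.1 : ℤ) - v.2) else (-(v.1 : ℤ), (v.2 : ℤ) - v.1)

/-- The cell `v` is read before the position `(h, d)`. -/
def ReadBefore (T : Filling) (h d : ℤ) (v : ℕ × ℕ) : Prop := Before (readPos T v).1 (readPos T v).2 h d

instance (T : Filling) (h d : ℤ) (v : ℕ × ℕ) : Decidable (ReadBefore T h d v) := by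
  unfold ReadBefore; infer_instance

theorem StrictPartition.le_line {γ : StrictPartition} {v : ℕ × ℕ} (h : v ∈ γ.cells) :
    v.1 ≤ max (γ.part 1) γ.length ∧ v.2 ≤ max (γ.part 1) γ.length := by
  obtain ⟨k, l⟩ := v
  rw [StrictPartition.mem_cells] at h
  have := γ.part_add_le (k := 1) (k' := k) le_rfl h.1 h.2.1
  simp only
  omega

theorem IsSemistandard.lt_of_marked (hT : IsSemistandard n γ T) {v : ℕ × ℕ}
    (h : (T v).any Entry.marked) : 1 ≤ v.1 ∧ v.1 < v.2 := by
  rcases ha : T v with _ | a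
  · simp [ha] at h
  · have h1 := hT.one_le ha
    refine ⟨h1.1, lt_of_le_of_ne h1.2 fun e => ?_⟩
    rw [ha, Option.any_some] at h
    refine hT.diag v.1 a.val ?_
    have : (v.1, v.1) = v := Prod.ext rfl e
    rw [this, ha, Option.some.injEq, Entry.ext_iff', h]
    exact ⟨rfl, rfl⟩

theorem any_not_marked {v : ℕ × ℕ} (h : (T v).any fun a => !a.marked) :
    (T v).any Entry.marked = false ∧ (T v).isSome := by
  rcases ha : T v with _ | a
  · simp [ha] at h
  · simpa [ha] using h

theorem isSome_of_any {v : ℕ × ℕ} {p : Entry → Bool} (h : (T v).any p) : (T v).isSome := by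
  rcases ha : T v with _ | a
  · simp [ha] at h
  · rfl

theorem mem_hookCells (hT : IsSemistandard n γ T) {v : ℕ × ℕ} :
    v ∈ hookCells γ T ↔ v ∈ γ.cells := by
  unfold hookCells
  simp only [List.mem_flatMap, List.mem_append, List.mem_filter, List.mem_map, List.mem_reverse,
    List.mem_range'_1]
  constructor
  · rintro ⟨j, -, ⟨-, h⟩ | ⟨-, h⟩⟩ <;> exact (hT.shape v).1 (isSome_of_any h)
  · intro h
    have h1 := StrictPartition.le_line h
    have h2 := le_of_mem_cells h
    obtain ⟨a, ha⟩ := Option.isSome_iff_exists.1 ((hT.shape v).2 h)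
    cases hm : a.marked
    · exact ⟨v.1, by omega, .inr ⟨⟨v.2, by omega, rfl⟩, by simp [ha, hm]⟩⟩
    · exact ⟨v.2, by omega, .inl ⟨⟨v.1, by omega, rfl⟩, by simp [ha, hm]⟩⟩

/-- Hooks are read by decreasing index. On one hook marked entries have negative places, as the
diagonal carries no marks, and unmarked ones nonnegative places. -/
theorem pairwise_hookCells (hT : IsSemistandard n γ T) :
    (hookCells γ T).Pairwise fun v w => ReadBefore T (readPos T w).1 (readPos T w).2 v := by
  unfold hookCells
  rw [List.pairwise_flatMap]
  have hmark : ∀ {v : ℕ × ℕ}, (T v).any (fun a => a.marked) →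
      readPos T v = (-(v.2 : ℤ), (v.1 : ℤ) - v.2) := fun h => if_pos h
  have hun : ∀ {v : ℕ × ℕ}, (T v).any (fun a => !a.marked) →
      readPos T v = (-(v.1 : ℤ), (v.2 : ℤ) - v.1) := fun h => if_neg (by simp [any_not_marked h])
  refine ⟨fun j _ => ?_, ?_⟩
  · rw [List.pairwise_append]
    refine ⟨?_, ?_, ?_⟩
    · rw [List.pairwise_filter, List.pairwise_map]
      refine (List.pairwise_lt_range' (s := 1)).imp fun {a b} hab h1 h2 => ?_
      unfold ReadBefore Before
      rw [hmark h1, hmark h2]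
      exact .inr ⟨rfl, by simp only; omega⟩
    · rw [List.pairwise_filter, List.pairwise_map]
      refine (List.pairwise_lt_range' (s := 1)).imp fun {a b} hab h1 h2 => ?_
      unfold ReadBefore Before
      rw [hun h1, hun h2]
      exact .inr ⟨rfl, by simp only; omega⟩
    · simp only [List.mem_filter, List.mem_map]
      rintro _ ⟨⟨k, -, rfl⟩, h1⟩ _ ⟨⟨c, -, rfl⟩, h2⟩
      have h3 := hT.lt_of_marked h1
      obtain ⟨b, hb⟩ := Option.isSome_iff_exists.1 (isSome_of_any h2)
      have h4 := hT.one_le hb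
      unfold ReadBefore Before
      rw [hmark h1, hun h2]
      simp only at *
      exact .inr ⟨trivial, by omega⟩
  · rw [List.pairwise_reverse]
    refine (List.pairwise_lt_range' (s := 1)).imp fun {a b} hab v hv w hw => ?_
    have key : ∀ {j : ℕ} {u : ℕ × ℕ},
        u ∈ (List.map (fun k => (k, j)) (List.range' 1 (max (γ.part 1) γ.length))).filter
          (fun x => (T x).any fun a => a.marked) ++
          (List.map (fun c => (j, c)) (List.range' 1 (max (γ.part 1) γ.length))).filter
          (fun x => (T x).any fun a => !a.marked) → (readPos T u).1 = -(j : ℤ) := by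
      intro j u hu
      simp only [List.mem_append, List.mem_filter, List.mem_map] at hu
      rcases hu with ⟨⟨k, -, rfl⟩, h⟩ | ⟨⟨k, -, rfl⟩, h⟩
      · rw [hmark h]
      · rw [hun h]
    unfold ReadBefore Before
    rw [key hv, key hw]
    omega

theorem nodup_hookCells (hT : IsSemistandard n γ T) : (hookCells γ T).Nodup :=
  (pairwise_hookCells hT).imp fun {a b} h e => by
    subst e
    unfold ReadBefore Before at h
    omega

/-- In an ordered list, the elements of an initial part of the order form an initial part. -/
theorem exists_filter_eq_take {α : Type*} {R : α → α → Prop} {L : List α} (hL : L.Pairwise R)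
    (P : α → Prop) [DecidablePred P] (hP : ∀ a b, R a b → P b → P a) :
    ∃ p ≤ L.length, L.filter P = L.take p ∧ ∀ q (hq : q < L.length), P L[q] ↔ q < p := by
  induction L with
  | nil => exact ⟨0, by simp⟩
  | cons a l ih =>
    rw [List.pairwise_cons] at hL
    by_cases ha : P a
    · obtain ⟨p, hp, h1, h2⟩ := ih hL.2
      refine ⟨p + 1, by simpa using hp, by simp [ha, h1], fun q hq => ?_⟩
      cases q with
      | zero => simpa using ha
      | succ q => simpa using h2 q (by simpa using hq)
    · have h0 : ∀ b ∈ l, ¬ P b := fun b hb h => ha (hP a b (hL.1 b hb) h)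
      refine ⟨0, by simp, by simpa [ha] using h0, fun q hq => ?_⟩
      cases q with
      | zero => simpa using ha
      | succ q => simpa using h0 _ (List.getElem_mem _)

theorem count_sub_count (l : List ℕ) : (l.count i : ℤ) - (l.count (i + 1) : ℤ)
    = (l.map fun a => if a = i then (1 : ℤ) else if a = i + 1 then -1 else 0).sum := by
  induction l with
  | nil => simp
  | cons a l ih =>
    rw [List.map_cons, List.sum_cons, ← ih, List.count_cons, List.count_cons]
    split_ifs with h1 h2 <;> simp_all <;> omega

theorem sgn_code (a : Entry) :
    sgn (code i a) = if a.val = i then (1 : ℤ) else if a.val = i + 1 then -1 else 0 := by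
  unfold sgn
  rcases code_cases i a with h | h | h | h | h | h <;> simp [h] <;> omega

/-! ### Prefixes of the word as partial sums -/

theorem hookWord_eq (hT : IsSemistandard n γ T) :
    hookWord γ T = (hookCells γ T).map fun v => ((T v).map Entry.val).getD 0 := by
  unfold hookWord
  rw [← List.filterMap_eq_map]
  refine List.filterMap_congr fun v hv => ?_
  obtain ⟨a, ha⟩ := Option.isSome_iff_exists.1 ((hT.shape v).2 ((mem_hookCells hT).1 hv))
  simp [ha]

theorem length_hookWord (hT : IsSemistandard n γ T) :
    (hookWord γ T).length = (hookCells γ T).length := by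
  rw [hookWord_eq hT, List.length_map]

theorem prefixDiff_hookWord (hT : IsSemistandard n γ T) (p : ℕ) : prefixDiff i (hookWord γ T) p
    = (((hookCells γ T).take p).map fun v => sgn (twoLetter i T (toInt v))).sum := by
  unfold prefixDiff
  rw [count_sub_count, hookWord_eq hT, ← List.map_take, List.map_map]
  congr 1
  refine List.map_congr_left fun v hv => ?_
  have hv' := (mem_hookCells hT).1 (List.mem_of_mem_take hv)
  obtain ⟨a, ha⟩ := Option.isSome_iff_exists.1 ((hT.shape v).2 hv')
  rw [twoLetter_toInt (le_of_mem_cells hv').1, ha]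
  simp [sgn_code, ha]

/-- The positions seen through two letters are the true ones. -/
theorem readPos_eq (hT : IsSemistandard n γ T) {v : ℕ × ℕ} (h1 : 1 ≤ twoLetter i T (toInt v))
    (h4 : twoLetter i T (toInt v) ≤ 4) :
    (hookOf (twoLetter i T (toInt v)) (toInt v), placeOf (twoLetter i T (toInt v)) (toInt v))
      = readPos T v := by
  obtain ⟨a, ha, hc⟩ := (hT.twoLetter_eq_iff h1 h4).1 rfl
  unfold readPos hookOf placeOf
  rw [← hc] at h1 h4 ⊢
  rw [ha]
  rcases code_cases i a with h | h | h | h | h | h <;> first | omega | simp [h, toInt]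

theorem contrib_eq (hT : IsSemistandard n γ T) (v : ℕ × ℕ) (h d : ℤ) :
    contrib (twoLetter i T (toInt v)) (toInt v) h d
      = if ReadBefore T h d v then sgn (twoLetter i T (toInt v)) else 0 := by
  unfold contrib
  by_cases hr : 1 ≤ twoLetter i T (toInt v) ∧ twoLetter i T (toInt v) ≤ 4
  · have e := readPos_eq hT hr.1 hr.2
    exact if_congr (by unfold ReadBefore; rw [← e]) rfl rfl
  · have : sgn (twoLetter i T (toInt v)) = 0 := by
      unfold sgn
      split_ifs <;> omega
    simp [this]

/-- The list of cells is sorted by position, so the cells read before (h, d) form an initial part of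
it. -/
theorem exists_partialSum_eq (hT : IsSemistandard n γ T) (i : ℕ) (h d : ℤ) :
    ∃ p ≤ (hookCells γ T).length,
      partialSum (intCells γ) (twoLetter i T) h d = prefixDiff i (hookWord γ T) p ∧
      ∀ q (hq : q < (hookCells γ T).length), ReadBefore T h d (hookCells γ T)[q] ↔ q < p := by
  obtain ⟨p, hp, h1, h2⟩ := exists_filter_eq_take (pairwise_hookCells hT) (ReadBefore T h d)
    fun a b hab hb => by
      unfold ReadBefore Before at *
      omega
  refine ⟨p, hp, ?_, h2⟩
  have hcells : γ.cells = (hookCells γ T).toFinset := by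
    ext v
    rw [List.mem_toFinset, mem_hookCells hT]
  rw [prefixDiff_hookWord hT, ← h1, partialSum, intCells,
    Finset.sum_image fun _ _ _ _ e => toInt_injective e, hcells,
    List.sum_toFinset _ (nodup_hookCells hT)]
  simp only [contrib_eq hT]
  generalize hookCells γ T = L
  induction L with
  | nil => simp
  | cons a l ih =>
    by_cases ha : ReadBefore T h d a <;> simp [ha, ih]

theorem partialSum_at (hT : IsSemistandard n γ T) (i : ℕ) {q : ℕ} (hq : q < (hookCells γ T).length) :
    partialSum (intCells γ) (twoLetter i T) (readPos T (hookCells γ T)[q]).1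
      (readPos T (hookCells γ T)[q]).2 = prefixDiff i (hookWord γ T) q := by
  obtain ⟨p, hp, h1, h2⟩ := exists_partialSum_eq hT i (readPos T (hookCells γ T)[q]).1
      (readPos T (hookCells γ T)[q]).2
  have hs := List.pairwise_iff_getElem.1 (pairwise_hookCells hT)
  have e : p = q := by
    refine le_antisymm (not_lt.1 fun hlt => ?_) (not_lt.1 fun hlt => ?_)
    · have := (h2 q hq).2 hlt
      unfold ReadBefore Before at this
      omega
    · have := hs p q (by omega) hq hlt
      exact absurd ((h2 p _).1 this) (lt_irrefl p)
  rw [h1, e]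

theorem totalSum_eq (hT : IsSemistandard n γ T) (i : ℕ) :
    totalSum (intCells γ) (twoLetter i T)
      = prefixDiff i (hookWord γ T) (hookWord γ T).length := by
  have hcells : γ.cells = (hookCells γ T).toFinset := by
    ext v
    rw [List.mem_toFinset, mem_hookCells hT]
  rw [prefixDiff_hookWord hT, length_hookWord hT, List.take_length, totalSum, intCells,
    Finset.sum_image fun _ _ _ _ e => toInt_injective e, hcells,
    List.sum_toFinset _ (nodup_hookCells hT)]

end Shifted

namespace Shifted

open TwoLetter

variable {i n : ℕ} {γ : StrictPartition} {T : Filling}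

/-! ## The letters on which the operators act -/

theorem prefixDiff_hookWord_succ (hT : IsSemistandard n γ T) {q : ℕ}
    (hq : q < (hookCells γ T).length) : prefixDiff i (hookWord γ T) (q + 1)
      = prefixDiff i (hookWord γ T) q + sgn (twoLetter i T (toInt (hookCells γ T)[q])) := by
  rw [prefixDiff_hookWord hT, prefixDiff_hookWord hT, List.take_succ_eq_append_getElem hq,
    List.map_append, List.sum_append]
  simp

theorem exists_position (hT : IsSemistandard n γ T) (i : ℕ) {p : ℕ}
    (hp : p ≤ (hookCells γ T).length) : ∃ h d,
      partialSum (intCells γ) (twoLetter i T) h d = prefixDiff i (hookWord γ T) p ∧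
      ∀ q (hq : q < (hookCells γ T).length), ReadBefore T h d (hookCells γ T)[q] ↔ q < p := by
  rcases hp.eq_or_lt with rfl | hp
  -- Negated hook indices are at most 0, so every cell is read before (1, 0).
  · obtain ⟨p, hp, h1, h2⟩ := exists_partialSum_eq hT i 1 0
    have hall : ∀ q (hq : q < (hookCells γ T).length), ReadBefore T 1 0 (hookCells γ T)[q] := by
      intro q hq
      unfold ReadBefore Before readPos
      split_ifs <;> simp only <;> omega
    have e : p = (hookCells γ T).length := by
      by_contra hne
      exact lt_irrefl p ((h2 p (by omega)).1 (hall p (by omega)))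
    exact ⟨1, 0, by rw [h1, e], fun q hq => iff_of_true (hall q hq) hq⟩
  · refine ⟨_, _, partialSum_at hT i hp, fun q hq => ?_⟩
    have hs := List.pairwise_iff_getElem.1 (pairwise_hookCells hT)
    rcases lt_trichotomy q p with h | rfl | h
    · exact iff_of_true (hs q p hq hp h) h
    · refine iff_of_false (fun h => ?_) (lt_irrefl q)
      unfold ReadBefore Before at h
      omega
    · have := hs p q hp hq h
      refine iff_of_false (fun h' => ?_) h.not_gt
      unfold ReadBefore Before at *
      omega

theorem exists_getElem_hookCells (hT : IsSemistandard n γ T) {X : ℕ × ℕ}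
    (hX : toInt X ∈ intCells γ) : ∃ (q : ℕ) (hq : q < (hookCells γ T).length),
      (hookCells γ T)[q] = X := by
  obtain ⟨Y, hY, e⟩ := Finset.mem_image.1 hX
  rw [toInt_injective e] at hY
  exact List.getElem_of_mem ((mem_hookCells hT).2 hY)

theorem mem_intCells (hT : IsSemistandard n γ T) {q : ℕ} (hq : q < (hookCells γ T).length) :
    toInt (hookCells γ T)[q] ∈ intCells γ :=
  Finset.mem_image_of_mem _ ((mem_hookCells hT).1 (List.getElem_mem hq))

/-- Before and after reading the cell number `q`, the word and the cells have equal sums. -/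
theorem partialSum_hookCells (hT : IsSemistandard n γ T) {q : ℕ}
    (hq : q < (hookCells γ T).length)
    (h1 : 1 ≤ twoLetter i T (toInt (hookCells γ T)[q]))
    (h4 : twoLetter i T (toInt (hookCells γ T)[q]) ≤ 4) :
    partialSum (intCells γ) (twoLetter i T)
      (hookOf (twoLetter i T (toInt (hookCells γ T)[q])) (toInt (hookCells γ T)[q]))
      (placeOf (twoLetter i T (toInt (hookCells γ T)[q])) (toInt (hookCells γ T)[q]))
      = prefixDiff i (hookWord γ T) q := by
  have e := Prod.ext_iff.1 (readPos_eq hT h1 h4)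
  simp only at e
  rw [e.1, e.2, partialSum_at hT i hq]

theorem readBefore_hookCells (hT : IsSemistandard n γ T) {X : ℕ × ℕ}
    (h1 : 1 ≤ twoLetter i T (toInt X)) (h4 : twoLetter i T (toInt X) ≤ 4) (h d : ℤ) :
    Before (hookOf (twoLetter i T (toInt X)) (toInt X))
      (placeOf (twoLetter i T (toInt X)) (toInt X)) h d ↔ ReadBefore T h d X := by
  have e := Prod.ext_iff.1 (readPos_eq hT h1 h4)
  simp only at e
  rw [ReadBefore, e.1, e.2]

theorem find?_reverse_range {p : ℕ → Bool} {N q : ℕ} (hq : q < N) (h : p q = true)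
    (h' : ∀ r, q < r → r < N → p r = false) : (List.range N).reverse.find? p = some q := by
  induction N with
  | zero => omega
  | succ N ih =>
    rw [List.range_succ, List.reverse_append, List.reverse_singleton, List.singleton_append]
    rcases (Nat.lt_succ_iff.1 hq).eq_or_lt with rfl | hlt
    · rw [List.find?_cons_of_pos h]
    · rw [List.find?_cons_of_neg (by simp [h' N hlt (by omega)])]
      exact ih hlt fun r h1 h2 => h' r h1 (by omega)

theorem sgn_of_isOne {G : ℤ × ℤ → ℤ} {x : ℤ × ℤ} (h : IsOne G x) : sgn (G x) = 1 := if_pos h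

theorem lower_of_firstMax (hT : IsSemistandard n γ T) {X : ℕ × ℕ} {m : ℤ}
    (hm : FirstMax (intCells γ) (twoLetter i T) (toInt X) m) :
    maxDiff i (hookWord γ T) = m ∧ lower γ i T = lowerAt γ i T X := by
  obtain ⟨q, hq, rfl⟩ := exists_getElem_hookCells hT hm.mem
  have h14 : 1 ≤ twoLetter i T (toInt (hookCells γ T)[q]) ∧
      twoLetter i T (toInt (hookCells γ T)[q]) ≤ 4 := by
    have := hm.one
    unfold IsOne at this
    omega
  have hq0 := hm.eq
  rw [partialSum_hookCells hT hq h14.1 h14.2] at hq0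
  have hq1 := prefixDiff_hookWord_succ (i := i) hT hq
  rw [hq0, sgn_of_isOne hm.one, sub_add_cancel] at hq1
  have hle : ∀ p, prefixDiff i (hookWord γ T) p ≤ m := by
    intro p
    rcases le_or_gt p (hookCells γ T).length with hp | hp
    · obtain ⟨h, d, e, -⟩ := exists_position hT i hp
      rw [← e]
      exact hm.le h d
    · rw [prefixDiff_of_length_le (by rw [length_hookWord hT]; exact hp.le)]
      obtain ⟨h, d, e, -⟩ := exists_position hT i (length_hookWord hT).le
      rw [← e]
      exact hm.le h d
  have hmax := maxDiff_eq hq1 hle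
  have hlt : ∀ p ≤ q, prefixDiff i (hookWord γ T) p ≤ m - 1 := by
    intro p hp
    obtain ⟨h, d, e, e'⟩ := exists_position hT i (show p ≤ (hookCells γ T).length by omega)
    rw [← e]
    refine hm.before h d fun hb => ?_
    rw [readBefore_hookCells hT h14.1 h14.2, e' q hq] at hb
    omega
  -- The maximum is attained after q + 1 letters, the last of which has index q; this matches the `p
  -- - 1` in `lower`.
  have hfirst : firstMax i (hookWord γ T) = some (q + 1) := by
    unfold firstMax
    rw [List.find?_range_eq_some]
    refine ⟨by simpa [hmax] using hq1, ?_, fun p hp => ?_⟩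
    · rw [List.mem_range, length_hookWord hT]
      omega
    · have := hlt p (by omega)
      simp only [hmax, Bool.not_eq_eq_eq_not, Bool.not_true, decide_eq_false_iff_not]
      omega
  refine ⟨hmax, ?_⟩
  have h0 := hlt 0 (by omega)
  rw [prefixDiff_zero] at h0
  rw [lower, if_neg (by omega), hfirst]
  simp only [Option.bind_some, Nat.add_sub_cancel, List.getElem?_eq_getElem hq]
  rfl

theorem raise_of_lastMax (hT : IsSemistandard n γ T) {X : ℕ × ℕ} {m : ℤ}
    (hm : LastMax (intCells γ) (twoLetter i T) (toInt X) m) :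
    maxDiff i (hookWord γ T) = m ∧ raise γ i T = raiseAt γ i T X := by
  obtain ⟨q, hq, rfl⟩ := exists_getElem_hookCells hT hm.mem
  have h14 : 1 ≤ twoLetter i T (toInt (hookCells γ T)[q]) ∧
      twoLetter i T (toInt (hookCells γ T)[q]) ≤ 4 := by
    have := hm.two
    unfold IsTwo at this
    omega
  have hq0 := hm.eq
  rw [partialSum_hookCells hT hq h14.1 h14.2] at hq0
  have hle : ∀ p, prefixDiff i (hookWord γ T) p ≤ m := by
    intro p
    rcases le_or_gt p (hookCells γ T).length with hp | hp
    · obtain ⟨h, d, e, -⟩ := exists_position hT i hp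
      rw [← e]
      exact hm.le h d
    · rw [prefixDiff_of_length_le (by rw [length_hookWord hT]; exact hp.le)]
      obtain ⟨h, d, e, -⟩ := exists_position hT i (length_hookWord hT).le
      rw [← e]
      exact hm.le h d
  have hmax := maxDiff_eq hq0 hle
  have hlt : ∀ p, q < p → p ≤ (hookCells γ T).length →
      prefixDiff i (hookWord γ T) p ≤ m - 1 := by
    intro p hp hp'
    obtain ⟨h, d, e, e'⟩ := exists_position hT i hp'
    rw [← e]
    refine hm.after h d ?_
    rw [readBefore_hookCells hT h14.1 h14.2, e' q hq]
    exact hp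
  have hlast : lastMax i (hookWord γ T) = some q := by
    unfold lastMax
    rw [length_hookWord hT]
    refine find?_reverse_range (by omega) (by simpa [hmax] using hq0) fun p h1 h2 => ?_
    have := hlt p h1 (by omega)
    simp only [hmax, decide_eq_false_iff_not]
    omega
  refine ⟨hmax, ?_⟩
  have h0 := hlt _ hq le_rfl
  rw [← length_hookWord hT] at h0
  rw [raise, if_neg (by omega), hlast]
  simp only [Option.bind_some, List.getElem?_eq_getElem hq]
  rfl

theorem exists_firstMax (hT : IsSemistandard n γ T) (h : 0 < maxDiff i (hookWord γ T)) :
    ∃ X, FirstMax (intCells γ) (twoLetter i T) (toInt X) (maxDiff i (hookWord γ T)) := by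
  have hex : ∃ p, prefixDiff i (hookWord γ T) p = maxDiff i (hookWord γ T) := by
    obtain ⟨p, -, hp⟩ := exists_prefixDiff_eq_maxDiff i (hookWord γ T)
    exact ⟨p, hp⟩
  classical
  obtain ⟨p, hp, hmin⟩ : ∃ p, prefixDiff i (hookWord γ T) p = maxDiff i (hookWord γ T) ∧
      ∀ p' < p, prefixDiff i (hookWord γ T) p' ≠ maxDiff i (hookWord γ T) :=
    ⟨Nat.find hex, Nat.find_spec hex, fun p' => Nat.find_min hex⟩
  have hp0 : p ≠ 0 := by
    rintro rfl
    rw [prefixDiff_zero] at hp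
    omega
  obtain ⟨q, rfl⟩ := Nat.exists_eq_add_one_of_ne_zero hp0
  have hq : q < (hookCells γ T).length := by
    by_contra hcon
    refine hmin q (by omega) ?_
    rw [← hp, prefixDiff_of_length_le (p := q) (by rw [length_hookWord hT]; omega),
      prefixDiff_of_length_le (p := q + 1) (by rw [length_hookWord hT]; omega)]
  have hlt : ∀ p' ≤ q, prefixDiff i (hookWord γ T) p' ≤ maxDiff i (hookWord γ T) - 1 := by
    intro p' hp'
    have := hmin p' (by omega)
    have := prefixDiff_le_maxDiff i (hookWord γ T) p'
    omega
  have hs := prefixDiff_hookWord_succ (i := i) hT hq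
  have h1 := hlt q le_rfl
  have hone : IsOne (twoLetter i T) (toInt (hookCells γ T)[q]) := by
    by_contra hcon
    have : sgn (twoLetter i T (toInt (hookCells γ T)[q])) ≤ 0 := by
      unfold sgn
      unfold IsOne at hcon
      split_ifs <;> omega
    omega
  rw [sgn_of_isOne hone] at hs
  have h14 : 1 ≤ twoLetter i T (toInt (hookCells γ T)[q]) ∧
      twoLetter i T (toInt (hookCells γ T)[q]) ≤ 4 := by
    unfold IsOne at hone
    omega
  refine ⟨(hookCells γ T)[q], mem_intCells hT hq, hone, ?_, fun h d hb => ?_, fun h d => ?_⟩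
  · rw [partialSum_hookCells hT hq h14.1 h14.2]
    omega
  · rw [readBefore_hookCells hT h14.1 h14.2] at hb
    obtain ⟨p', -, e, e'⟩ := exists_partialSum_eq hT i h d
    rw [e' q hq] at hb
    rw [e]
    exact hlt p' (by omega)
  · obtain ⟨p', -, e, -⟩ := exists_partialSum_eq hT i h d
    rw [e]
    exact prefixDiff_le_maxDiff _ _ _

theorem exists_lastMax (hT : IsSemistandard n γ T)
    (h : prefixDiff i (hookWord γ T) (hookWord γ T).length ≠ maxDiff i (hookWord γ T)) :
    ∃ X, LastMax (intCells γ) (twoLetter i T) (toInt X) (maxDiff i (hookWord γ T)) := by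
  classical
  obtain ⟨p, hp, hpe⟩ := exists_prefixDiff_eq_maxDiff i (hookWord γ T)
  have hne : ((Finset.range ((hookWord γ T).length + 1)).filter fun p =>
      prefixDiff i (hookWord γ T) p = maxDiff i (hookWord γ T)).Nonempty :=
    ⟨p, Finset.mem_filter.2 ⟨Finset.mem_range.2 (by omega), hpe⟩⟩
  obtain ⟨q, hq, hmax⟩ := Finset.exists_max_image _ id hne
  simp only [Finset.mem_filter, Finset.mem_range, id] at hq hmax
  obtain ⟨hq, hqe⟩ := hq
  have hq : q < (hookCells γ T).length := by
    rw [← length_hookWord hT]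
    by_contra hcon
    rw [prefixDiff_of_length_le (by omega)] at hqe
    exact h hqe
  have hlt : ∀ p', q < p' → p' ≤ (hookCells γ T).length →
      prefixDiff i (hookWord γ T) p' ≤ maxDiff i (hookWord γ T) - 1 := by
    intro p' hp' hl
    have h1 := prefixDiff_le_maxDiff i (hookWord γ T) p'
    have h2 : prefixDiff i (hookWord γ T) p' ≠ maxDiff i (hookWord γ T) := fun e => by
      have := hmax p' ⟨by rw [length_hookWord hT]; omega, e⟩
      omega
    omega
  have hs := prefixDiff_hookWord_succ (i := i) hT hq
  have h1 := hlt (q + 1) (by omega) hq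
  have htwo : IsTwo (twoLetter i T) (toInt (hookCells γ T)[q]) := by
    by_contra hcon
    have : 0 ≤ sgn (twoLetter i T (toInt (hookCells γ T)[q])) := by
      unfold sgn
      unfold IsTwo at hcon
      split_ifs <;> omega
    omega
  have h14 : 1 ≤ twoLetter i T (toInt (hookCells γ T)[q]) ∧
      twoLetter i T (toInt (hookCells γ T)[q]) ≤ 4 := by
    unfold IsTwo at htwo
    omega
  refine ⟨(hookCells γ T)[q], mem_intCells hT hq, htwo, ?_, fun h d hb => ?_, fun h d => ?_⟩
  · rw [partialSum_hookCells hT hq h14.1 h14.2, hqe]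
  · rw [readBefore_hookCells hT h14.1 h14.2] at hb
    obtain ⟨p', hp', e, e'⟩ := exists_partialSum_eq hT i h d
    rw [e' q hq] at hb
    rw [e]
    exact hlt p' hb hp'
  · obtain ⟨p', -, e, -⟩ := exists_partialSum_eq hT i h d
    rw [e]
    exact prefixDiff_le_maxDiff _ _ _

/-! ## One step of the operators -/

/-- Lowering replaces `T` by `T'`, and raising undoes it. -/
structure IsStep (n : ℕ) (γ : StrictPartition) (i : ℕ) (T T' : Filling) : Prop where
  semistandard : IsSemistandard n γ T'
  agree : Agree i T T'
  lower : lower γ i T = some T'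
  raise : raise γ i T' = some T
  maxDiff : maxDiff i (hookWord γ T') = maxDiff i (hookWord γ T) - 1
  total : prefixDiff i (hookWord γ T') (hookWord γ T').length
    = prefixDiff i (hookWord γ T) (hookWord γ T).length - 2

theorem Agree.symm {T' : Filling} (h : Agree i T T') : Agree i T' T := fun v => by
  rcases h v with h | ⟨a, b, h1, h2, h3, h4⟩
  · exact .inl h.symm
  · exact .inr ⟨b, a, h2, h1, h4, h3⟩

/-- Lowering and raising back on the half plane are carried out on fillings one after the other. The
result agrees with `T` outside the two letters and has the same coded picture, so it is `T`. -/
theorem exists_isStep_lower (hT : IsSemistandard n γ T) (hi : 1 ≤ i) (hin : i + 1 ≤ n)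
    (h : 0 < maxDiff i (hookWord γ T)) : ∃ T', IsStep n γ i T T' := by
  obtain ⟨X, hX⟩ := exists_firstMax hT h
  obtain ⟨G', x', hl⟩ := hX.exists_isLowering (hT.valid i) (hT.supported i)
  obtain ⟨T', e1, rfl, h2⟩ := exists_lowerAt_eq hT hl.lower
  have hT' := h2.isSemistandard hT hi hin hl.valid hl.similar
  obtain ⟨Y, hY, rfl⟩ := Finset.mem_image.1 hl.lastMax.mem
  obtain ⟨T'', e3, e4, h4⟩ := exists_raiseAt_eq hT' hl.raise
  have hback : T = T'' := (h2.trans h4).eq_of_twoLetter_eq hT e4.symm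
  obtain ⟨hmax, hr⟩ := raise_of_lastMax hT' hl.lastMax
  refine ⟨T', hT', h2, by rw [(lower_of_firstMax hT hX).2, e1], by rw [hr, e3, hback], hmax, ?_⟩
  rw [← totalSum_eq hT', ← totalSum_eq hT]
  exact hl.total

theorem exists_isStep_raise (hT : IsSemistandard n γ T) (hi : 1 ≤ i) (hin : i + 1 ≤ n)
    (h : prefixDiff i (hookWord γ T) (hookWord γ T).length ≠ maxDiff i (hookWord γ T)) :
    ∃ T', IsSemistandard n γ T' ∧ IsStep n γ i T' T := by
  obtain ⟨X, hX⟩ := exists_lastMax hT h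
  obtain ⟨G', x', hl⟩ := hX.exists_isRaising (hT.valid i) (hT.supported i)
  obtain ⟨T', e1, rfl, h2⟩ := exists_raiseAt_eq hT hl.raise
  have hT' := h2.isSemistandard hT hi hin hl.valid hl.similar
  obtain ⟨Y, hY, rfl⟩ := Finset.mem_image.1 hl.firstMax.mem
  obtain ⟨T'', e3, e4, h4⟩ := exists_lowerAt_eq hT' hl.lower
  have hback : T = T'' := (h2.trans h4).eq_of_twoLetter_eq hT e4.symm
  obtain ⟨hmax, hr⟩ := lower_of_firstMax hT' hl.firstMax
  refine ⟨T', hT', hT, h2.symm, by rw [hr, e3, hback], by rw [(raise_of_lastMax hT hX).2, e1],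
    by omega, ?_⟩
  rw [← totalSum_eq hT', ← totalSum_eq hT, hl.total]
  omega

theorem lower_eq_none (h : maxDiff i (hookWord γ T) ≤ 0) : lower γ i T = none := if_pos h

theorem raise_eq_none
    (h : prefixDiff i (hookWord γ T) (hookWord γ T).length = maxDiff i (hookWord γ T)) :
    raise γ i T = none := if_pos h

/-- A value of the operator exists only if the maximum is positive, and then it is the result of the
step constructed above. -/
theorem isStep_of_lower_eq {T' : Filling} (hT : IsSemistandard n γ T) (hi : 1 ≤ i)
    (hin : i + 1 ≤ n) (h : lower γ i T = some T') : IsStep n γ i T T' := by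
  have hpos : 0 < maxDiff i (hookWord γ T) := by
    by_contra hcon
    rw [lower_eq_none (not_lt.1 hcon)] at h
    cases h
  obtain ⟨T'', hs⟩ := exists_isStep_lower hT hi hin hpos
  rw [hs.lower, Option.some.injEq] at h
  exact h ▸ hs

theorem isStep_of_raise_eq {T' : Filling} (hT : IsSemistandard n γ T) (hi : 1 ≤ i)
    (hin : i + 1 ≤ n) (h : raise γ i T = some T') :
    IsSemistandard n γ T' ∧ IsStep n γ i T' T := by
  have hne : prefixDiff i (hookWord γ T) (hookWord γ T).length ≠ maxDiff i (hookWord γ T) := by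
    intro hcon
    rw [raise_eq_none hcon] at h
    cases h
  obtain ⟨T'', hs, hs'⟩ := exists_isStep_raise hT hi hin hne
  rw [hs'.raise, Option.some.injEq] at h
  exact h ▸ ⟨hs, hs'⟩

end Shifted

/-! ### String lengths of partial maps -/

section PartialPow

variable {B : Type*} {g : B → Option B} {b b' : B}

theorem partialPow_succ (g : B → Option B) (k : ℕ) (b : B) :
    partialPow g (k + 1) b = (g b).bind (partialPow g k) := by
  unfold partialPow
  rw [Function.iterate_succ_apply, Option.bind_some]
  rcases g b with _ | b'
  · exact Function.iterate_fixed rfl k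
  · rfl

theorem isStringLength_zero (h : g b = none) : IsStringLength g b 0 := by
  refine ⟨by simp [partialPow], fun k hk => ?_⟩
  cases k with
  | zero => exact le_rfl
  | succ k => simp [partialPow_succ, h] at hk

theorem IsStringLength.succ {m : ℕ} (h : g b = some b') (hm : IsStringLength g b' m) :
    IsStringLength g b (m + 1) := by
  have hs : ∀ k, partialPow g (k + 1) b = partialPow g k b' := fun k => by
    rw [partialPow_succ, h, Option.bind_some]
  refine ⟨?_, fun k hk => ?_⟩
  · change partialPow g (m + 1) b ≠ none
    rw [hs]
    exact hm.1
  · cases k with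
    | zero => omega
    | succ k =>
      change partialPow g (k + 1) b ≠ none at hk
      rw [hs] at hk
      exact Nat.succ_le_succ (hm.2 hk)

/-- The string length is any function that drops by one along the partial map, and is zero exactly
where the partial map is not defined. -/
theorem isStringLength_of_drop (N : B → ℕ) (h0 : ∀ b, N b = 0 → g b = none)
    (h1 : ∀ b, N b ≠ 0 → ∃ b', g b = some b' ∧ N b' + 1 = N b) (b : B) :
    IsStringLength g b (N b) := by
  induction hN : N b generalizing b with
  | zero => exact isStringLength_zero (h0 b hN)
  | succ m ih =>
    obtain ⟨b', e, hb'⟩ := h1 b (by omega)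
    exact .succ e (ih b' (by omega))

end PartialPow

namespace Shifted

variable {i n r : ℕ} {γ : StrictPartition} {T T' : Filling}

/-! ## Weights -/

/-- The number of entries with a given value. -/
def content (γ : StrictPartition) (T : Filling) (v : ℕ) : ℕ :=
  (γ.cells.filter fun c => (T c).map Entry.val = some v).card

/-- Every cell is read exactly once. The value 0 is excluded because it is the default in
`hookWord_eq`. -/
theorem count_hookWord (hT : IsSemistandard n γ T) {v : ℕ} (hv : v ≠ 0) :
    (hookWord γ T).count v = content γ T v := by
  have hcells : γ.cells = (hookCells γ T).toFinset := by
    ext v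
    rw [List.mem_toFinset, mem_hookCells hT]
  have hfilter : (hookCells γ T).toFinset.filter (fun c => (T c).map Entry.val = some v)
      = ((hookCells γ T).filter fun c => (T c).map Entry.val = some v).toFinset := by
    ext c
    simp
  rw [content, hcells, hfilter,
    List.toFinset_card_of_nodup ((nodup_hookCells hT).filter _), hookWord_eq hT,
    List.count_eq_countP, List.countP_map, List.countP_eq_length_filter]
  congr 2
  funext c
  simp only [Function.comp_apply]
  rcases T c with _ | a
  · simp [hv.symm]
  · simp only [Option.map_some, Option.getD_some, Option.some.injEq]
    rfl

theorem prefixDiff_length (hT : IsSemistandard n γ T) (hi : i ≠ 0) :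
    prefixDiff i (hookWord γ T) (hookWord γ T).length
      = (content γ T i : ℤ) - content γ T (i + 1) := by
  rw [prefixDiff, List.take_length, count_hookWord hT hi, count_hookWord hT i.succ_ne_zero]

theorem Agree.content_eq (h : Agree i T T') {v : ℕ} (h1 : v ≠ i) (h2 : v ≠ i + 1) :
    content γ T' v = content γ T v := by
  unfold content
  congr 1
  refine Finset.filter_congr fun c _ => ?_
  rcases h c with e | ⟨a, b, ha, hb, ha', hb'⟩
  · rw [e]
  · simp only [ha, hb, Option.map_some, Option.some.injEq]
    omega

theorem Agree.content_add (h : Agree i T T') :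
    content γ T' i + content γ T' (i + 1) = content γ T i + content γ T (i + 1) := by
  unfold content
  have hd : ∀ S : Filling, Disjoint (γ.cells.filter fun c => (S c).map Entry.val = some i)
      (γ.cells.filter fun c => (S c).map Entry.val = some (i + 1)) := fun S =>
    Finset.disjoint_filter.2 fun c _ h1 h2 => by
      rw [h1, Option.some.injEq] at h2
      omega
  rw [← Finset.card_union_of_disjoint (hd T), ← Finset.card_union_of_disjoint (hd T'),
    ← Finset.filter_or, ← Finset.filter_or]
  congr 1
  refine Finset.filter_congr fun c _ => ?_
  rcases h c with e | ⟨a, b, ha, hb, ha', hb'⟩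
  · rw [e]
  · simp only [ha, hb, Option.map_some, Option.some.injEq]
    exact iff_of_true hb' ha'

theorem SSHT.wt_eq (T : SSHT n γ) (j : Fin n) : T.wt j = content γ T.1 (j + 1) := rfl

/-- The number of entries of value i or i+1 is kept and their difference drops by 2, so exactly one
entry changes from i to i+1 in weight. -/
theorem IsStep.wt_eq {T T' : SSHT (r + 1) γ} {i : Fin r} (h : IsStep (r + 1) γ (i + 1) T.1 T'.1) :
    T.wt = T'.wt + simpleRoot i := by
  have h1 := h.total
  rw [prefixDiff_length (i := i + 1) T.2 (Nat.succ_ne_zero _), prefixDiff_length (i := i + 1) T'.2 (Nat.succ_ne_zero _)] at h1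
  have h2 := h.agree.content_add (γ := γ)
  funext j
  simp only [Pi.add_apply, simpleRoot, Pi.sub_apply, Pi.single_apply, SSHT.wt_eq]
  by_cases ha : j = i.castSucc
  · subst ha
    have : i.castSucc ≠ i.succ := (Fin.castSucc_lt_succ).ne
    simp only [this, if_true, if_false, Fin.val_castSucc]
    omega
  · by_cases hb : j = i.succ
    · subst hb
      simp only [ha, if_true, if_false, Fin.val_succ]
      omega
    · simp only [ha, hb, if_false, sub_zero, add_zero]
      rw [Nat.cast_inj]
      refine (h.agree.content_eq (fun e => ha ?_) (fun e => hb ?_)).symm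
      · exact Fin.ext (by simpa using e)
      · exact Fin.ext (by simpa using e)

/-! ## The crystal -/

/-- The filling of row `k` by the letter `k`. -/
theorem nonempty_SSHT (h : γ.length ≤ n) : Nonempty (SSHT n γ) := by
  let S : Filling := fun v => if v ∈ γ.cells then some (un v.1) else none
  have hS : ∀ {v a}, S v = some a → v ∈ γ.cells ∧ a = un v.1 := fun {v a} e => by
    simp only [S, Option.ite_none_right_eq_some, Option.some.injEq] at e
    exact ⟨e.1, e.2.symm⟩
  refine ⟨⟨S, fun c => ?_, fun c a ha => ?_, fun k c c' _ a ha b hb => ?_,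
    fun k k' c hk a ha b hb => ?_, fun k c c' v ha _ => ?_, fun k k' c v ha hb => ?_,
    fun k v ha => ?_⟩⟩
  · by_cases hc : c ∈ γ.cells <;> simp [S, hc]
  · obtain ⟨hc, rfl⟩ := hS ha
    obtain ⟨k, l⟩ := c
    rw [StrictPartition.mem_cells] at hc
    simp only [val_un]
    omega
  · rw [(hS ha).2, (hS hb).2]
  · rw [(hS ha).2, (hS hb).2, Entry.le_iff]
    exact .inl hk
  · have := congrArg Entry.marked (hS ha).2
    simp at this
  · have h1 := congrArg Entry.val (hS ha).2
    have h2 := congrArg Entry.val (hS hb).2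
    exact h1.symm.trans h2
  · have := congrArg Entry.marked (hS ha).2
    simp at this

/-- The raising operator `e_i` on semistandard tableaux. -/
def raiseOp (i : Fin r) (T : SSHT (r + 1) γ) : Option (SSHT (r + 1) γ) :=
  (raise γ (i + 1) T.1).pmap Subtype.mk fun _ h =>
    (isStep_of_raise_eq T.2 (by omega) (by omega) h).1

/-- The lowering operator `f_i` on semistandard tableaux. -/
def lowerOp (i : Fin r) (T : SSHT (r + 1) γ) : Option (SSHT (r + 1) γ) :=
  (lower γ (i + 1) T.1).pmap Subtype.mk fun _ h =>
    (isStep_of_lower_eq T.2 (by omega) (by omega) h).semistandard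

theorem map_raiseOp (i : Fin r) (T : SSHT (r + 1) γ) :
    (raiseOp i T).map Subtype.val = raise γ (i + 1) T.1 := by
  unfold raiseOp SSHT
  rw [Option.map_pmap]
  simp

theorem map_lowerOp (i : Fin r) (T : SSHT (r + 1) γ) :
    (lowerOp i T).map Subtype.val = lower γ (i + 1) T.1 := by
  unfold lowerOp SSHT
  rw [Option.map_pmap]
  simp

theorem map_val_eq_some {o : Option (SSHT n γ)} {T : SSHT n γ} :
    o.map Subtype.val = some T.1 ↔ o = some T := by
  constructor
  · rcases o with _ | T'
    · exact fun h => nomatch h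
    · exact fun h => congrArg some (Subtype.ext (Option.some.inj h))
  · rintro rfl
    rfl

/-- Both operators have the same graph `IsStep`, read in opposite directions, which is the inverse
property of the crystal. -/
theorem raiseOp_eq_some {i : Fin r} {T T' : SSHT (r + 1) γ} :
    raiseOp i T = some T' ↔ IsStep (r + 1) γ (i + 1) T'.1 T.1 := by
  rw [← map_val_eq_some, map_raiseOp]
  exact ⟨fun h => (isStep_of_raise_eq T.2 (by omega) (by omega) h).2, fun h => h.raise⟩

theorem lowerOp_eq_some {i : Fin r} {T T' : SSHT (r + 1) γ} :
    lowerOp i T = some T' ↔ IsStep (r + 1) γ (i + 1) T.1 T'.1 := by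
  rw [← map_val_eq_some, map_lowerOp]
  exact ⟨fun h => isStep_of_lower_eq T.2 (by omega) (by omega) h, fun h => h.lower⟩

/-- The number of free i+1 is the maximum minus the total. Raising increases these by 1 and 2, so
the number drops by one, and it is zero exactly when raising gives 0. -/
theorem isStringLength_raiseOp (i : Fin r) (T : SSHT (r + 1) γ) :
    IsStringLength (raiseOp i) T (numFree (i + 1) (hookWord γ T.1) (i + 2)) := by
  refine isStringLength_of_drop
    (fun T : SSHT (r + 1) γ => numFree (i + 1) (hookWord γ T.1) (i + 2)) (fun T h => ?_)
    (fun T h => ?_) T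
  · have h1 := numFree_upper (i + 1) (hookWord γ T.1)
    refine Option.map_eq_none_iff.1 ((map_raiseOp i T).trans (raise_eq_none ?_))
    simp only [add_assoc, Nat.reduceAdd] at h h1 ⊢
    omega
  · have h1 := numFree_upper (i + 1) (hookWord γ T.1)
    obtain ⟨T', hT', hs⟩ := exists_isStep_raise (i := i + 1) T.2 (by omega) (by omega) fun e => by
      simp only [add_assoc, Nat.reduceAdd] at h h1 e
      omega
    refine ⟨⟨T', hT'⟩, raiseOp_eq_some.2 hs, ?_⟩
    have h2 := numFree_upper (i + 1) (hookWord γ T')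
    have h3 := hs.maxDiff
    have h4 := hs.total
    simp only [add_assoc, Nat.reduceAdd] at h1 h2 h3 h4 ⊢
    omega

theorem isStringLength_lowerOp (i : Fin r) (T : SSHT (r + 1) γ) :
    IsStringLength (lowerOp i) T (numFree (i + 1) (hookWord γ T.1) (i + 1)) := by
  refine isStringLength_of_drop
    (fun T : SSHT (r + 1) γ => numFree (i + 1) (hookWord γ T.1) (i + 1)) (fun T h => ?_)
    (fun T h => ?_) T
  · have h1 := numFree_lower (i + 1) (hookWord γ T.1)
    refine Option.map_eq_none_iff.1 ((map_lowerOp i T).trans (lower_eq_none ?_))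
    omega
  · have h1 := numFree_lower (i + 1) (hookWord γ T.1)
    obtain ⟨T', hs⟩ := exists_isStep_lower (i := i + 1) T.2 (by omega) (by omega) (by omega)
    refine ⟨⟨T', hs.semistandard⟩, lowerOp_eq_some.2 hs, ?_⟩
    have h2 := numFree_lower (i + 1) (hookWord γ T')
    have h3 := hs.maxDiff
    simp only
    omega

theorem isCrystal_SSHT (hγ : γ.length ≤ r + 1) :
    IsCrystal (raiseOp (r := r) (γ := γ)) lowerOp SSHT.wt where
  nonempty := nonempty_SSHT hγ
  inverse i T T' := by rw [raiseOp_eq_some, lowerOp_eq_some]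
  weight i T T' h := (raiseOp_eq_some.1 h).wt_eq
  string i T := by
    refine ⟨_, _, isStringLength_raiseOp i T, isStringLength_lowerOp i T, ?_⟩
    have h1 := numFree_lower (i + 1) (hookWord γ T.1)
    have h2 := numFree_upper (i + 1) (hookWord γ T.1)
    rw [prefixDiff_length (i := i + 1) T.2 (Nat.succ_ne_zero _)] at h2
    simp only [SSHT.wt_eq, Fin.val_castSucc, Fin.val_succ, add_assoc, Nat.reduceAdd] at h1 h2 ⊢
    omega

end Shifted

theorem mainTheorem7 (γ : Shifted.StrictPartition) (r : ℕ) (hγ : γ.length ≤ r + 1) :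
    ∃ e f : Fin r → Shifted.SSHT (r + 1) γ → Option (Shifted.SSHT (r + 1) γ),
      (∀ (i : Fin r) (T : Shifted.SSHT (r + 1) γ),
        (e i T).map Subtype.val = Shifted.raise γ (i + 1) T.1) ∧
      (∀ (i : Fin r) (T : Shifted.SSHT (r + 1) γ),
        (f i T).map Subtype.val = Shifted.lower γ (i + 1) T.1) ∧
      IsCrystal e f Shifted.SSHT.wt ∧
      ∀ (i : Fin r) (T : Shifted.SSHT (r + 1) γ),
        IsStringLength (e i) T
          (Shifted.numFree (i + 1) (Shifted.hookWord γ T.1) (i + 2)) ∧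
        IsStringLength (f i) T
          (Shifted.numFree (i + 1) (Shifted.hookWord γ T.1) (i + 1)) := by
  exact ⟨Shifted.raiseOp, Shifted.lowerOp, Shifted.map_raiseOp, Shifted.map_lowerOp,
    Shifted.isCrystal_SSHT hγ, fun i T =>
      ⟨Shifted.isStringLength_raiseOp i T, Shifted.isStringLength_lowerOp i T⟩⟩
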